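/- Let $f:\mathbb R^n\to\mathbb R$ be convex and differentiable, and suppose that on $\mathbb R^n_+$ it is non-negative, non-decreasing, and has a monotone gradient: $\nabla f(x)\ge\nabla f(x')$ whenever $x\ge x'\ge 0$. Let $A=(a_{ij})$ be a non-negative $m\times n$ matrix with at most $d$ non-zero entries in each row, and let $\delta>0$. Consider the covering program $\min\{f(x): Ax\ge \mathbf 1,\ x\ge 0\}$ and its Fenchel dual $\max\{\sum_i y_i-f^\star(\mu): A^{\top}y\le\mu,\ y\ge 0\}$, where $f^\star(\mu)=\sup_{z\in\mathbb R^n}(\mu^{\top}z-f(z))$. The rows of $A$ arrive one at a time. The algorithm starts with $x=0$, $y=0$ and always keeps $\mu=\nabla f(\delta x)$. When row $t$ arrives, then as long as $\sum_j a_{tj}x_j<1$ it changes its variables continuously in time as follows. * Each $x_j$ with $a_{tj}>0$ is increased at rate $\dfrac{a_{tj}x_j+1/d}{\nabla_j f(x)}$; the other $x_j$ do not change. * $y_t$ is increased at rate $r=\dfrac{1}{\ln(1+2d^2)}\min_{\ell}\dfrac{\nabla_\ell f(\delta x)}{\nabla_\ell f(x)}$. * For each $j$ whose dual constraint $\sum_i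 a_{ij}y_i\le\mu_j$ is tight, in addition $y_{m_j}$ is decreased at rate $\dfrac{a_{tj}}{a_{m_jj}}\,r$, where $m_j$ is any row attaining $\max\{a_{ij}: y_i>0\}$. A run is an absolutely continuous trajectory that obeys these rules at almost every time. The switching rule in the third item is understood in the Filippov sense: the decrease for column $j$ is multiplied by an intensity $\lambda_j\in[0,1]$ with $\lambda_j=0$ if $\sum_i a_{ij}y_i<\mu_j$, $\lambda_j=1$ if $\sum_i a_{ij}y_i>\mu_j$, and $\lambda_j$ arbitrary if equality holds. Minima over $\ell$ of quotients $\nabla_\ell f(\delta z)/\nabla_\ell f(z)$ are taken over those $\ell$ with $\nabla_\ell f(z)>0$. Then the following hold. 1. Suppose that every row of $A$ has a positive entry, and that $\nabla_\ell f(z)>0$ whenever $z\ge 0$ and $z_\ell>0$. Then the algorithm can always be carried out: from every state that it can reach before row $t$, there is a run on row $t$, and this run ends after finite time with $\sum_j a_{tj}x_j\ge 1$. 2. In every run, $x$ and $\mu=\nabla f(\delta x)$ are non-decreasing in time, and $(y,\mu)$ is feasible for the dual program at all times. 3. After every round $t$ of every run, $x\ge 0$ satisfies the constraints of all rows $i\le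 t$, $y_i=0$ for all rows $i>t$, and $(y,\mu)$ is dual feasible. If moreover $f(0)=0$, then $$\sum_i y_i-f^\star(\mu)\ \ge\ \left[\ \inf_{z\ge 0}\ \frac{\min_{\ell}\frac{\nabla_\ell f(\delta z)}{\nabla_\ell f(z)}}{4\ln(1+2d^2)}\ -\ \sup_{z\ge 0,\ f(z)>0}\frac{(\delta z)^{\top}\nabla f(\delta z)-f(\delta z)}{f(z)}\ \right]\cdot f(x).$$ (All quantities are extended reals; if the supremum is $+\infty$ the bracket is $-\infty$. An infimum or minimum over the empty set is $+\infty$, a supremum over the empty set is $-\infty$, and $\pm\infty\cdot 0=0$.) The same holds at the start, before any row has arrived. -/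

import Mathlib

open scoped Matrix

namespace OnlineCovering

/-- The `ℓ`-th coordinate of the gradient of `f` at `z`. -/
noncomputable def grad {n : ℕ} (f : (Fin n → ℝ) → ℝ) (z : Fin n → ℝ) : Fin n → ℝ :=
  fun ℓ => fderiv ℝ f z (Pi.single ℓ 1)

/-- The Fenchel dual `f⋆(μ) = sup_z (μᵀ z - f z)`, over all `z ∈ ℝⁿ`, as an extended real. -/
noncomputable def fenchel {n : ℕ} (f : (Fin n → ℝ) → ℝ) (μ : Fin n → ℝ) : EReal :=
  ⨆ z : Fin n → ℝ, ((μ ⬝ᵥ z - f z : ℝ) : EReal)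

/-- The objective `∑ i, y i - f⋆(μ)` of the dual (packing) program. -/
noncomputable def dualObjective {m n : ℕ} (f : (Fin n → ℝ) → ℝ)
    (y : Fin m → ℝ) (μ : Fin n → ℝ) : EReal :=
  ((∑ i, y i : ℝ) : EReal) - fenchel f μ

/-- Feasibility for the dual program: `y ≥ 0` and `yᵀ A ≤ μᵀ`. -/
def DualFeasible {m n : ℕ} (A : Matrix (Fin m) (Fin n) ℝ)
    (y : Fin m → ℝ) (μ : Fin n → ℝ) : Prop :=
  0 ≤ y ∧ y ᵥ* A ≤ μ

/-- `min_ℓ ∇_ℓ f(δ z) / ∇_ℓ f(z)`, over the coordinates at which the denominator is positive. -/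
noncomputable def gradRatio {n : ℕ} (f : (Fin n → ℝ) → ℝ) (δ : ℝ) (z : Fin n → ℝ) : EReal :=
  ⨅ ℓ : Fin n, ⨅ _ : 0 < grad f z ℓ, ((grad f (δ • z) ℓ / grad f z ℓ : ℝ) : EReal)

/-- `min_z (min_ℓ ∇_ℓ f(δz) / ∇_ℓ f(z)) / (4 ln (1 + 2 d²))
  - max_z ((δz)ᵀ ∇f(δz) - f(δz)) / f(z)`, over `z ≥ 0` at which the denominators are positive. -/
noncomputable def competitiveRatio {n : ℕ} (f : (Fin n → ℝ) → ℝ) (d : ℕ) (δ : ℝ) : EReal :=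
  (⨅ z : Fin n → ℝ, ⨅ _ : 0 ≤ z,
      gradRatio f δ z / ((4 * Real.log (1 + 2 * (d : ℝ) ^ 2) : ℝ) : EReal))
    - ⨆ z : Fin n → ℝ, ⨆ _ : 0 ≤ z, ⨆ _ : 0 < f z,
        ((((δ • z) ⬝ᵥ grad f (δ • z) - f (δ • z)) / f z : ℝ) : EReal)

/-- The rate `r` at which the dual variable of the current row is increased. -/
noncomputable def dualRate {n : ℕ} (f : (Fin n → ℝ) → ℝ) (d : ℕ) (δ : ℝ) (x : Fin n → ℝ) : ℝ :=
  (gradRatio f δ x).toReal / Real.log (1 + 2 * (d : ℝ) ^ 2)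

/-- The primal velocity `p` at the point `x` while row `t` is processed. -/
def IsPrimalRate {m n : ℕ} (f : (Fin n → ℝ) → ℝ) (A : Matrix (Fin m) (Fin n) ℝ) (d : ℕ)
    (t : Fin m) (x p : Fin n → ℝ) : Prop :=
  ∀ j, (A t j = 0 → p j = 0) ∧
    (0 < A t j → 0 < grad f x j ∧ p j = (A t j * x j + 1 / (d : ℝ)) / grad f x j)

/-- `i` is a row attaining `max {a_{ij} | y_i > 0}` (and this maximum is positive). Rows that have
not arrived yet have `y_i = 0`, so they do not take part. -/
def IsTopRow {m n : ℕ} (A : Matrix (Fin m) (Fin n) ℝ) (y : Fin m → ℝ)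
    (j : Fin n) (i : Fin m) : Prop :=
  0 < y i ∧ 0 < A i j ∧ ∀ i', 0 < y i' → A i' j ≤ A i j

/-- `v` is an admissible velocity of the dual variables at the state `(x, y)` while row `t` is
processed. The variable `y_t` is raised at rate `r`, and for a column `j` whose constraint
`∑ i, a_{ij} y_i ≤ μ_j`, with `μ = ∇f(δx)`, is tight, the variable of a top row `m_j` is lowered at
rate `(a_{tj} / a_{m_j j}) r`. Several tight constraints, or a moving `μ`, make the state slide
along a constraint, so the switching rule is read in the usual (Filippov) sense: the decrease for
column `j` is performed with an intensity `lam j ∈ [0, 1]` which is `0` below the constraint, `1`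
above it, and arbitrary on it. That the region above the constraint is never entered is not
assumed. -/
def IsDualRate {m n : ℕ} (f : (Fin n → ℝ) → ℝ) (A : Matrix (Fin m) (Fin n) ℝ) (d : ℕ) (δ : ℝ)
    (t : Fin m) (x : Fin n → ℝ) (y v : Fin m → ℝ) : Prop :=
  ∃ (lam : Fin n → ℝ) (top : Fin n → Fin m),
    (∀ j, 0 ≤ lam j ∧ lam j ≤ 1) ∧
    (∀ j, (y ᵥ* A) j < grad f (δ • x) j → lam j = 0) ∧
    (∀ j, grad f (δ • x) j < (y ᵥ* A) j → lam j = 1) ∧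
    (∀ j, 0 < lam j → IsTopRow A y j (top j)) ∧
    ∀ i, v i = (if i = t then dualRate f d δ x else 0)
      - ∑ j, if top j = i then lam j * (A t j / A (top j) j * dualRate f d δ x) else 0

/-- `u` is absolutely continuous on `[0, T]` and its velocity satisfies the rule `R` at almost
every time. -/
def Follows {k : ℕ} (T : ℝ) (u : ℝ → Fin k → ℝ) (R : ℝ → (Fin k → ℝ) → Prop) : Prop :=
  ∃ w : ℝ → Fin k → ℝ,
    (∀ i, IntervalIntegrable (fun s => w s i) MeasureTheory.volume 0 T) ∧
    (∀ s ∈ Set.Icc 0 T, ∀ i, u s i = u 0 i + ∫ σ in (0 : ℝ)..s, w σ i) ∧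
    ∀ᵐ s ∂(MeasureTheory.volume.restrict (Set.Ioo 0 T)), R s (w s)

/-- `(x, y)` on the time interval `[0, T]` is a run of the algorithm on row `t`. It lasts exactly
as long as the constraint of row `t` is unsatisfied. -/
structure IsRound {m n : ℕ} (f : (Fin n → ℝ) → ℝ) (A : Matrix (Fin m) (Fin n) ℝ) (d : ℕ) (δ : ℝ)
    (t : Fin m) (T : ℝ) (x : ℝ → Fin n → ℝ) (y : ℝ → Fin m → ℝ) : Prop where
  nonneg : 0 ≤ T
  unsatisfied : ∀ s ∈ Set.Ico 0 T, A t ⬝ᵥ x s < 1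
  satisfied : 1 ≤ A t ⬝ᵥ x T
  primal : Follows T x fun s p => IsPrimalRate f A d t (x s) p
  dual : Follows T y fun s v => IsDualRate f A d δ t (x s) (y s) v

/-- `Reachable f A d δ k x y`: after processing the first `k` rows of `A`, starting from `x = 0`
and `y = 0`, the algorithm can be in the state `(x, y)`. -/
inductive Reachable {m n : ℕ} (f : (Fin n → ℝ) → ℝ) (A : Matrix (Fin m) (Fin n) ℝ) (d : ℕ)
    (δ : ℝ) : ℕ → (Fin n → ℝ) → (Fin m → ℝ) → Prop
  | start : Reachable f A d δ 0 0 0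
  | step {k : ℕ} (hk : k < m) {T : ℝ} {x : ℝ → Fin n → ℝ} {y : ℝ → Fin m → ℝ}
      (h : Reachable f A d δ k (x 0) (y 0)) (hr : IsRound f A d δ ⟨k, hk⟩ T x y) :
      Reachable f A d δ (k + 1) (x T) (y T)

end OnlineCovering

/-! Write `L = ln(1 + 2d²)`. The heart of the matter is the invariant `IsExpBounded`: `L ∑_{i ∈ S}
a_{ij} y_i ≤ μ_j ln(1 + a d x_j)` whenever the rows in `S` have entries at most `a` in column `j`.
While a row `t ∈ S` is processed, `ln(1 + a d x_j)` grows at rate `a (d a_{tj} x_j + 1) / ((1 + a d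
x_j) ∇_j f(x)) ≥ a_{tj} / ∇_j f(x)`, because `a_{tj} ≤ a`, and `L r ≤ μ_j / ∇_j f(x)` by the choice
of `r`; decreases of `y` only help. Since `μ` is merely known to be continuous and monotone, such
growth estimates are made on increments over short intervals (`integral_sum_le_sub`).

Taking for `S` the rows with `y_i > 0` and for `a` their largest entry, a tight column satisfies `a
x_j ≥ 2d` (`two_mul_le_of_tight`). As `∑_j a_{tj} x_j ≤ 1` during the round, all decreases together
amount to at most `r/2`, so `∑ y_i` grows at rate at least `r/2`, whereas `f(x)` grows at rate at
most `2`. Together with the Fenchel equality at `μ = ∇f(δx)` this is the competitive ratio.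
Feasibility is a barrier argument (`le_barrier`): a negative `y_i` would not decrease, and the load
of a violated column would not increase.

Existence meets two obstacles. The primal field is singular where a partial derivative vanishes; the
coordinates `u_j = f(x_j e_j)` make it bounded, and continuous after time `0`, so that Peano's
theorem applies (`exists_primalRun`). The dual rule is discontinuous at tight constraints. As long
as no old variable reaches zero the top rows can be kept fixed, and the cumulative decreases solve a
reflection problem (`exists_reflection`) whose pushes grow at most at rate `r`; their densities
relative to `r` are the intensities. Each phase that stops early loses a positive old variable, so
finitely many phases suffice. Peano's theorem and the reflection problem both rest on
`exists_fixedPoint_of_causal`. -/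

namespace OnlineCovering

open MeasureTheory Set Filter Topology

/-! ### Gradients of differentiable convex functions. -/

section Gradient

variable {n : ℕ} {f : (Fin n → ℝ) → ℝ}

lemma fderiv_apply_eq_dotProduct (z v : Fin n → ℝ) : fderiv ℝ f z v = grad f z ⬝ᵥ v := by
  conv_lhs => rw [pi_eq_sum_univ' v]
  simp [map_sum, dotProduct, grad, mul_comm, Pi.single]

lemma hasDerivAt_line (hdiff : Differentiable ℝ f) (z v : Fin n → ℝ) (s : ℝ) :
    HasDerivAt (fun r : ℝ => f (z + r • v)) (grad f (z + s • v) ⬝ᵥ v) s := by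
  have h1 : HasDerivAt (fun r : ℝ => z + r • v) v s := by
    simpa using ((hasDerivAt_id s).smul_const v).const_add z
  have h2 := (hdiff (z + s • v)).hasFDerivAt.comp_hasDerivAt s h1
  rwa [fderiv_apply_eq_dotProduct] at h2

lemma convexOn_line (hconv : ConvexOn ℝ univ f) (z v : Fin n → ℝ) :
    ConvexOn ℝ univ (fun r : ℝ => f (z + r • v)) := by
  have := hconv.comp_affineMap (AffineMap.lineMap z (z + v) : ℝ →ᵃ[ℝ] (Fin n → ℝ))
  have h : (f ∘ (AffineMap.lineMap z (z + v) : ℝ →ᵃ[ℝ] (Fin n → ℝ))) =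
      fun r : ℝ => f (z + r • v) := by
    funext r
    simp [AffineMap.lineMap_apply, add_comm]
  rwa [h, preimage_univ] at this

/-- The gradient inequality of a differentiable convex function. -/
lemma grad_dotProduct_sub_le (hconv : ConvexOn ℝ univ f) (hdiff : Differentiable ℝ f)
    (z w : Fin n → ℝ) : grad f z ⬝ᵥ (w - z) ≤ f w - f z := by
  have h := (convexOn_line hconv z (w - z)).le_slope_of_hasDerivAt (mem_univ 0) (mem_univ 1)
    one_pos (hasDerivAt_line hdiff z (w - z) 0)
  simpa [slope_def_field] using h

/-- The gradient of a differentiable convex function is continuous. -/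
lemma continuous_grad_apply (hconv : ConvexOn ℝ univ f) (hdiff : Differentiable ℝ f) (j : Fin n) :
    Continuous fun z => grad f z j := by
  have hline : ∀ z : Fin n → ℝ, ∀ h : ℝ, grad f z j * h ≤ f (z + h • Pi.single j 1) - f z := by
    intro z h
    have := grad_dotProduct_sub_le hconv hdiff z (z + h • Pi.single j 1)
    simpa [mul_comm] using this
  have hslope : ∀ z, Tendsto (fun h : ℝ => h⁻¹ * (f (z + h • Pi.single j 1) - f z)) (𝓝[≠] 0)
      (𝓝 (grad f z j)) := by
    intro z
    have := (hasDerivAt_line hdiff z (Pi.single j 1) 0).tendsto_slope_zero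
    simpa using this
  have hc : ∀ h : ℝ, Continuous fun z => h⁻¹ * (f (z + h • Pi.single j 1) - f z) := by
    intro h
    have := hdiff.continuous
    fun_prop
  refine continuous_iff_continuousAt.2 fun z => ?_
  -- By convexity, difference quotients with negative step lie below the partial derivative and
  -- those with positive step above it. For a fixed step they are continuous in the point, so a
  -- strict bound at `z` spreads to a neighbourhood.
  refine tendsto_order.2 ⟨fun a ha => ?_, fun a ha => ?_⟩
  · have h1 : ∀ᶠ h : ℝ in 𝓝[<] 0, a < h⁻¹ * (f (z + h • Pi.single j 1) - f z) :=
      ((hslope z).mono_left (nhdsWithin_mono _ fun x hx => ne_of_lt hx)).eventually_const_lt ha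
    obtain ⟨h, hh, hneg⟩ := (h1.and self_mem_nhdsWithin).exists
    filter_upwards [(hc h).continuousAt.eventually_const_lt hh] with w hw
    refine hw.trans_le ?_
    have h2 := hline w h
    have hneg : h < 0 := hneg
    rw [inv_mul_eq_div, div_le_iff_of_neg hneg]
    linarith
  · have h1 : ∀ᶠ h : ℝ in 𝓝[>] 0, h⁻¹ * (f (z + h • Pi.single j 1) - f z) < a :=
      ((hslope z).mono_left (nhdsWithin_mono _ fun x hx => ne_of_gt hx)).eventually_lt_const ha
    obtain ⟨h, hh, hpos⟩ := (h1.and self_mem_nhdsWithin).exists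
    filter_upwards [(hc h).continuousAt.eventually_lt_const hh] with w hw
    refine lt_of_le_of_lt ?_ hw
    have h2 := hline w h
    have hpos : 0 < h := hpos
    rw [le_inv_mul_iff₀ hpos]
    linarith

lemma grad_nonneg (hdiff : Differentiable ℝ f)
    (hmono : ∀ x x', 0 ≤ x' → x' ≤ x → f x' ≤ f x) {z : Fin n → ℝ} (hz : 0 ≤ z) : 0 ≤ grad f z := by
  intro j
  have h1 := (hasDerivAt_line hdiff z (Pi.single j 1) 0).tendsto_slope_zero
  simp only [zero_add, zero_smul, add_zero, dotProduct_single_one, smul_eq_mul] at h1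
  refine ge_of_tendsto (h1.mono_left (nhdsWithin_mono (0 : ℝ) (s := Ioi 0) fun x hx => ne_of_gt hx))
    ?_
  filter_upwards [self_mem_nhdsWithin] with h hh
  have hh : 0 < h := hh
  refine mul_nonneg (inv_nonneg.2 hh.le) (sub_nonneg.2 (hmono _ _ hz ?_))
  refine le_add_of_nonneg_right (smul_nonneg hh.le ?_)
  simp [Pi.single_nonneg]

/-- The Fenchel dual at a gradient. -/
lemma fenchel_grad (hconv : ConvexOn ℝ univ f) (hdiff : Differentiable ℝ f) (w : Fin n → ℝ) :
    fenchel f (grad f w) = ((w ⬝ᵥ grad f w - f w : ℝ) : EReal) := by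
  refine le_antisymm (iSup_le fun z => EReal.coe_le_coe_iff.2 ?_) ?_
  · have := grad_dotProduct_sub_le hconv hdiff w z
    rw [dotProduct_sub] at this
    rw [dotProduct_comm w]
    linarith
  · refine le_trans (le_of_eq ?_) (le_iSup _ w)
    rw [dotProduct_comm w]

end Gradient

/-! ### The gradient ratio and the dual rate. -/

section GradRatio

variable {n : ℕ} {f : (Fin n → ℝ) → ℝ} {δ : ℝ}

lemma gradRatio_le {z : Fin n → ℝ} {j : Fin n} (hj : 0 < grad f z j) :
    gradRatio f δ z ≤ ((grad f (δ • z) j / grad f z j : ℝ) : EReal) :=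
  iInf₂_le j hj

lemma gradRatio_nonneg (hdiff : Differentiable ℝ f)
    (hmono : ∀ x x', 0 ≤ x' → x' ≤ x → f x' ≤ f x) (hδ : 0 < δ) {z : Fin n → ℝ} (hz : 0 ≤ z) :
    0 ≤ gradRatio f δ z := by
  refine le_iInf₂ fun j hj => EReal.coe_nonneg.2 (div_nonneg ?_ hj.le)
  exact grad_nonneg hdiff hmono (smul_nonneg hδ.le hz) j

/-- A single positive partial derivative rules out the value `⊤` of the empty infimum, which
`toReal` in `dualRate` would turn into `0`. -/
lemma coe_toReal_gradRatio (hdiff : Differentiable ℝ f)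
    (hmono : ∀ x x', 0 ≤ x' → x' ≤ x → f x' ≤ f x) (hδ : 0 < δ) {z : Fin n → ℝ} (hz : 0 ≤ z)
    {j : Fin n} (hj : 0 < grad f z j) : ((gradRatio f δ z).toReal : EReal) = gradRatio f δ z := by
  refine EReal.coe_toReal (ne_top_of_le_ne_top (EReal.coe_ne_top _) (gradRatio_le hj)) ?_
  exact ne_bot_of_le_ne_bot EReal.zero_ne_bot (gradRatio_nonneg hdiff hmono hδ hz)

/-- The index set of the infimum changes with `z`, so continuity is not available; measurability is
what integrating the dual rate along a run requires. -/
lemma measurable_gradRatio (hconv : ConvexOn ℝ univ f) (hdiff : Differentiable ℝ f) (δ : ℝ) :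
    Measurable (gradRatio f δ) := by
  refine Measurable.iInf fun j => ?_
  have h1 : Measurable fun z => grad f z j := (continuous_grad_apply hconv hdiff j).measurable
  have h2 : Measurable fun z => grad f (δ • z) j :=
    ((continuous_grad_apply hconv hdiff j).comp (continuous_const_smul δ)).measurable
  have h3 : (fun z => ⨅ _ : 0 < grad f z j, ((grad f (δ • z) j / grad f z j : ℝ) : EReal)) =
      fun z => open Classical in
        if 0 < grad f z j then ((grad f (δ • z) j / grad f z j : ℝ) : EReal) else ⊤ := by
    funext z
    split_ifs with h <;> simp [h]
  rw [h3]
  exact Measurable.ite (measurableSet_lt measurable_const h1)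
    (measurable_coe_real_ereal.comp (h2.div h1)) measurable_const

lemma dualRate_nonneg (hdiff : Differentiable ℝ f)
    (hmono : ∀ x x', 0 ≤ x' → x' ≤ x → f x' ≤ f x) (hδ : 0 < δ) {z : Fin n → ℝ} (hz : 0 ≤ z)
    (d : ℕ) : 0 ≤ dualRate f d δ z :=
  div_nonneg (EReal.toReal_nonneg (gradRatio_nonneg hdiff hmono hδ hz))
    (Real.log_nonneg (by nlinarith [sq_nonneg (d : ℝ)]))

lemma log_pos_of_one_le {d : ℕ} (hd : 1 ≤ d) : 0 < Real.log (1 + 2 * (d : ℝ) ^ 2) := by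
  have : (1 : ℝ) ≤ d := by exact_mod_cast hd
  exact Real.log_pos (by nlinarith)

lemma log_mul_dualRate_le (hdiff : Differentiable ℝ f)
    (hmono : ∀ x x', 0 ≤ x' → x' ≤ x → f x' ≤ f x) (hδ : 0 < δ) {z : Fin n → ℝ} (hz : 0 ≤ z)
    {d : ℕ} (hd : 1 ≤ d) {j : Fin n} (hj : 0 < grad f z j) :
    Real.log (1 + 2 * (d : ℝ) ^ 2) * dualRate f d δ z ≤ grad f (δ • z) j / grad f z j := by
  rw [dualRate, mul_div_cancel₀ _ (log_pos_of_one_le hd).ne', ← EReal.coe_le_coe_iff,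
    coe_toReal_gradRatio hdiff hmono hδ hz hj]
  exact gradRatio_le hj

lemma measurable_dualRate (hconv : ConvexOn ℝ univ f) (hdiff : Differentiable ℝ f) (d : ℕ)
    (δ : ℝ) : Measurable (dualRate f d δ) :=
  (measurable_gradRatio hconv hdiff δ).ereal_toReal.div_const _

end GradRatio

/-! ### Absolutely continuous functions on an interval: growth estimates and barriers. -/

section Interval

variable {a b : ℝ}

lemma ae_restrict_Ioo_mono {P : ℝ → Prop} {s t : ℝ}
    (h : ∀ᵐ σ ∂volume.restrict (Ioo a b), P σ) (hs : a ≤ s) (ht : t ≤ b) :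
    ∀ᵐ σ ∂volume.restrict (Ioo s t), P σ :=
  ae_restrict_of_ae_restrict_of_subset (Ioo_subset_Ioo hs ht) h

lemma integral_mono_of_ae_Ioo {g h : ℝ → ℝ} (hab : a ≤ b) (hg : IntervalIntegrable g volume a b)
    (hh : IntervalIntegrable h volume a b) (hle : ∀ᵐ σ ∂volume.restrict (Ioo a b), g σ ≤ h σ) :
    ∫ σ in a..b, g σ ≤ ∫ σ in a..b, h σ := by
  refine intervalIntegral.integral_mono_ae_restrict hab hg hh ?_
  rwa [← Measure.restrict_congr_set Ioo_ae_eq_Icc]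

lemma integral_congr_of_ae_Ioo {g h : ℝ → ℝ} (hab : a ≤ b)
    (hle : ∀ᵐ σ ∂volume.restrict (Ioo a b), g σ = h σ) :
    ∫ σ in a..b, g σ = ∫ σ in a..b, h σ := by
  rw [intervalIntegral.integral_of_le hab, intervalIntegral.integral_of_le hab,
    ← Measure.restrict_congr_set Ioo_ae_eq_Ioc]
  exact integral_congr_ae hle

lemma intervalIntegrable_mono {g : ℝ → ℝ} {s t : ℝ} (hg : IntervalIntegrable g volume a b)
    (hs : s ∈ Icc a b) (ht : t ∈ Icc a b) : IntervalIntegrable g volume s t := by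
  refine hg.mono_set ?_
  rw [uIcc_of_le (hs.1.trans hs.2)]
  exact uIcc_subset_Icc hs ht

lemma integral_sub_primitive {g : ℝ → ℝ} {s t : ℝ} (hg : IntervalIntegrable g volume a b)
    (hs : s ∈ Icc a b) (ht : t ∈ Icc a b) :
    (∫ σ in a..t, g σ) - ∫ σ in a..s, g σ = ∫ σ in s..t, g σ :=
  intervalIntegral.integral_interval_sub_left
    (intervalIntegrable_mono hg ⟨le_rfl, hs.1.trans hs.2⟩ ht)
    (intervalIntegrable_mono hg ⟨le_rfl, hs.1.trans hs.2⟩ hs)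

lemma continuousOn_primitive_Icc {g : ℝ → ℝ} (hab : a ≤ b) (hg : IntervalIntegrable g volume a b) :
    ContinuousOn (fun s => ∫ σ in a..s, g σ) (Icc a b) := by
  have := intervalIntegral.continuousOn_primitive_interval' hg (left_mem_uIcc)
  rwa [uIcc_of_le hab] at this

lemma intervalIntegrable_of_ae_le {g h : ℝ → ℝ} (hab : a ≤ b)
    (hg : AEStronglyMeasurable g (volume.restrict (Ioo a b)))
    (hh : IntervalIntegrable h volume a b)
    (hle : ∀ᵐ σ ∂volume.restrict (Ioo a b), |g σ| ≤ h σ) : IntervalIntegrable g volume a b := by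
  rw [intervalIntegrable_iff_integrableOn_Ioo_of_le hab] at hh ⊢
  exact Integrable.mono' hh hg hle

lemma intervalIntegrable_sum {ι : Type*} [Fintype ι] {p : ι → ℝ → ℝ}
    (hp : ∀ i, IntervalIntegrable (p i) volume a b) :
    IntervalIntegrable (fun σ => ∑ i, p i σ) volume a b := by
  have h := IntervalIntegrable.sum Finset.univ (fun i _ => hp i)
  rwa [Finset.sum_fn] at h

lemma le_of_continuousOn_of_Ico {c : ℝ} (hab : a < b) {g : ℝ → ℝ} (hg : ContinuousOn g (Icc a b))
    (hlt : ∀ s ∈ Ico a b, g s < c) : ∀ s ∈ Icc a b, g s ≤ c := by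
  have h : ∀ s ∈ closure (Ico a b), g s ≤ c := by
    refine fun s hs => le_on_closure (fun σ hσ => (hlt σ hσ).le) ?_ continuousOn_const hs
    rwa [closure_Ico hab.ne]
  rwa [closure_Ico hab.ne] at h

/-- A function that increases over all short intervals increases. -/
lemma le_of_locally_le {G : ℝ → ℝ} {η : ℝ} (hη : 0 < η) (hab : a ≤ b)
    (hG : ∀ s ∈ Icc a b, ∀ t ∈ Icc a b, s ≤ t → t - s < η → G s ≤ G t) : G a ≤ G b := by
  obtain ⟨N, hN⟩ := exists_nat_gt ((b - a) / η)
  have hN0 : (0 : ℝ) < N := lt_of_le_of_lt (div_nonneg (sub_nonneg.2 hab) hη.le) hN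
  have hstep : (b - a) / N < η := by
    rw [div_lt_iff₀ hη] at hN
    rw [div_lt_iff₀ hN0]
    linarith
  have hba : 0 ≤ (b - a) / N := div_nonneg (sub_nonneg.2 hab) hN0.le
  have key : ∀ i : ℕ, i ≤ N → G a ≤ G (a + i * ((b - a) / N)) := by
    intro i
    induction i with
    | zero => intro _; simp
    | succ i ih =>
      intro hi
      have hmem : ∀ k : ℕ, k ≤ N → a + k * ((b - a) / N) ∈ Icc a b := by
        intro k hk
        have hk' : (k : ℝ) ≤ N := by exact_mod_cast hk
        refine ⟨le_add_of_nonneg_right (by positivity), ?_⟩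
        have := mul_le_mul_of_nonneg_right hk' hba
        rw [mul_div_cancel₀ _ hN0.ne'] at this
        linarith
      refine (ih (by omega)).trans (hG _ (hmem i (by omega)) _ (hmem (i + 1) hi) ?_ ?_) <;>
        push_cast <;> linarith
  have := key N le_rfl
  rwa [mul_div_cancel₀ _ hN0.ne', add_sub_cancel] at this

/-- A lower bound for increments over short intervals, integrated. -/
lemma integral_sum_le_sub {ι : Type*} [Fintype ι] (hab : a ≤ b) {F : ℝ → ℝ} {p : ι → ℝ → ℝ}
    {c : ι → ℝ → ℝ → ℝ} (hp : ∀ i, IntervalIntegrable (p i) volume a b)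
    (hp0 : ∀ᵐ σ ∂volume.restrict (Ioo a b), ∀ i, 0 ≤ p i σ)
    (hc : ∀ i, ContinuousOn (fun q : ℝ × ℝ => c i q.1 q.2) (Icc a b ×ˢ Icc a b))
    (hF : ∀ s ∈ Icc a b, ∀ t ∈ Icc a b, s ≤ t →
      ∑ i, c i s t * ∫ σ in s..t, p i σ ≤ F t - F s) :
    ∫ σ in a..b, ∑ i, c i σ σ * p i σ ≤ F b - F a := by
  have hdiag : ∀ i, ContinuousOn (fun σ => c i σ σ) (Icc a b) := fun i =>
    (hc i).comp (f := fun σ : ℝ => (σ, σ)) (by fun_prop) fun σ hσ => ⟨hσ, hσ⟩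
  have hcp : ∀ i, IntervalIntegrable (fun σ => c i σ σ * p i σ) volume a b := fun i =>
    (hp i).continuousOn_mul (by rw [uIcc_of_le hab]; exact hdiag i)
  have hsum : IntervalIntegrable (fun σ => ∑ i, c i σ σ * p i σ) volume a b :=
    intervalIntegrable_sum hcp
  have hps : IntervalIntegrable (fun σ => ∑ i, p i σ) volume a b :=
    intervalIntegrable_sum hp
  -- Uniform continuity gives `c i σ σ ≤ c i s t + ε` for all `σ` in a short interval `[s, t]`. The
  -- error costs `ε ∑ p`, which is subtracted here and disappears as `ε → 0`.
  have key : ∀ ε > 0, (∫ σ in a..b, ∑ i, c i σ σ * p i σ) - ε * ∫ σ in a..b, ∑ i, p i σ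
      ≤ F b - F a := by
    intro ε hε
    have huc : ∃ η > 0, ∀ i, ∀ q ∈ Icc a b ×ˢ Icc a b, ∀ q' ∈ Icc a b ×ˢ Icc a b, dist q q' < η →
        dist (c i q.1 q.2) (c i q'.1 q'.2) < ε := by
      have h1 : ∀ i, ∀ᶠ η in 𝓝[>] (0 : ℝ), ∀ q ∈ Icc a b ×ˢ Icc a b, ∀ q' ∈ Icc a b ×ˢ Icc a b,
          dist q q' < η → dist (c i q.1 q.2) (c i q'.1 q'.2) < ε := by
        intro i
        have := (isCompact_Icc.prod isCompact_Icc).uniformContinuousOn_of_continuous (hc i)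
        obtain ⟨η, hη, h⟩ := Metric.uniformContinuousOn_iff.1 this ε hε
        filter_upwards [Ioo_mem_nhdsGT hη] with η' hη' q hq q' hq' hd
        exact h q hq q' hq' (hd.trans hη'.2)
      obtain ⟨η, hη, hpos⟩ := ((eventually_all.2 h1).and self_mem_nhdsWithin).exists
      exact ⟨η, hpos, hη⟩
    obtain ⟨η, hη, huc⟩ := huc
    set g : ℝ → ℝ := fun σ => (∑ i, c i σ σ * p i σ) - ε * ∑ i, p i σ with hg
    have hgi : IntervalIntegrable g volume a b := hsum.sub (hps.const_mul ε)
    have := le_of_locally_le (G := fun s => F s - ∫ σ in a..s, g σ) hη hab ?_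
    · simp only [intervalIntegral.integral_same] at this
      rw [hg, intervalIntegral.integral_sub hsum (hps.const_mul ε),
        intervalIntegral.integral_const_mul] at this
      linarith
    · intro s hs t ht hst hlt
      have h1 := integral_sub_primitive hgi hs ht
      have h2 := hF s hs t ht hst
      have h3 : ∫ σ in s..t, g σ ≤ ∑ i, c i s t * ∫ σ in s..t, p i σ := by
        have h4 : ∑ i, c i s t * ∫ σ in s..t, p i σ = ∫ σ in s..t, ∑ i, c i s t * p i σ := by
          rw [intervalIntegral.integral_finsetSum]
          · simp
          · exact fun i _ => (intervalIntegrable_mono (hp i) hs ht).const_mul _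
        rw [h4]
        refine integral_mono_of_ae_Ioo hst (intervalIntegrable_mono hgi hs ht)
          (intervalIntegrable_sum fun i =>
            (intervalIntegrable_mono (hp i) hs ht).const_mul (c i s t)) ?_
        · filter_upwards [ae_restrict_Ioo_mono hp0 hs.1 ht.2, ae_restrict_mem measurableSet_Ioo]
            with σ hσ hσm
          simp only [hg]
          rw [Finset.mul_sum, ← Finset.sum_sub_distrib]
          refine Finset.sum_le_sum fun i _ => ?_
          rw [← sub_mul]
          refine mul_le_mul_of_nonneg_right ?_ (hσ i)
          have hσI : σ ∈ Icc a b := ⟨hs.1.trans hσm.1.le, hσm.2.le.trans ht.2⟩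
          have := huc i (σ, σ) ⟨hσI, hσI⟩ (s, t) ⟨hs, ht⟩ (by
            rw [Prod.dist_eq, Real.dist_eq, Real.dist_eq]
            refine max_lt ?_ ?_ <;> rw [abs_lt] <;> constructor <;> linarith [hσm.1, hσm.2])
          rw [Real.dist_eq, abs_lt] at this
          linarith [this.2]
      linarith
  have hlim : Tendsto (fun ε : ℝ => (∫ σ in a..b, ∑ i, c i σ σ * p i σ) -
      ε * ∫ σ in a..b, ∑ i, p i σ) (𝓝[>] 0) (𝓝 ((∫ σ in a..b, ∑ i, c i σ σ * p i σ) -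
      0 * ∫ σ in a..b, ∑ i, p i σ)) :=
    Tendsto.mono_left (Continuous.tendsto (by fun_prop) 0) nhdsWithin_le_nhds
  rw [zero_mul, sub_zero] at hlim
  refine le_of_tendsto hlim ?_
  filter_upwards [self_mem_nhdsWithin] with ε hε
  exact key ε hε

/-- An absolutely continuous function which does not increase while slightly above a non-decreasing
barrier never crosses it. -/
lemma le_barrier {u w M : ℝ → ℝ} {κ : ℝ} (hκ : 0 < κ)
    (hw : IntervalIntegrable w volume a b)
    (hu : ∀ s ∈ Icc a b, u s = u a + ∫ σ in a..s, w σ)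
    (hM : MonotoneOn M (Icc a b)) (h0 : u a ≤ M a)
    (hle : ∀ᵐ σ ∂volume.restrict (Ioo a b), M σ < u σ → u σ < M σ + κ → w σ ≤ 0) :
    ∀ s ∈ Icc a b, u s ≤ M s := by
  intro s hs
  by_contra! hlt
  have hab := hs.1.trans hs.2
  have hcont : ContinuousOn u (Icc a b) := by
    refine ContinuousOn.congr ?_ hu
    exact (continuousOn_const).add (continuousOn_primitive_Icc hab hw)
  set Z : Set ℝ := {σ ∈ Icc a s | u σ ≤ M σ}
  have hZne : Z.Nonempty := ⟨a, ⟨le_rfl, hs.1⟩, h0⟩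
  have hZb : BddAbove Z := ⟨s, fun σ hσ => hσ.1.2⟩
  set c := sSup Z
  have hcs : c ∈ Icc a s := ⟨le_csSup hZb ⟨⟨le_rfl, hs.1⟩, h0⟩, csSup_le hZne fun σ hσ => hσ.1.2⟩
  have hcI : c ∈ Icc a b := ⟨hcs.1, hcs.2.trans hs.2⟩
  -- No continuity of `M` is needed: monotonicity alone carries the inequality from `Z` to its
  -- supremum.
  have hc : u c ≤ M c := by
    have h1 : c ∈ closure Z := csSup_mem_closure hZne hZb
    have h2 : Z ⊆ Icc a b := fun σ hσ => ⟨hσ.1.1, hσ.1.2.trans hs.2⟩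
    have : (𝓝[Z] c).NeBot := mem_closure_iff_nhdsWithin_neBot.1 h1
    refine le_of_tendsto ((hcont c hcI).mono_left (nhdsWithin_mono _ h2)) ?_
    filter_upwards [self_mem_nhdsWithin] with σ hσ
    exact hσ.2.trans (hM (h2 hσ) hcI (le_csSup hZb hσ))
  have habove : ∀ σ ∈ Ioc c s, M σ < u σ := by
    intro σ hσ
    by_contra! h
    exact absurd (le_csSup hZb ⟨⟨hcs.1.trans hσ.1.le, hσ.2⟩, h⟩) (not_le.2 hσ.1)
  have hcs' : c < s := lt_of_le_of_ne hcs.2 fun h => by rw [h] at hc; exact absurd hlt (not_lt.2 hc)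
  have hnear : ∀ᶠ σ in 𝓝[>] c, u σ < M c + κ := by
    have h1 : Tendsto u (𝓝[Ioc c s] c) (𝓝 (u c)) :=
      (hcont c hcI).mono_left (nhdsWithin_mono _ fun σ hσ =>
        ⟨hcs.1.trans hσ.1.le, hσ.2.trans hs.2⟩)
    rw [nhdsWithin_Ioc_eq_nhdsGT hcs'] at h1
    exact h1.eventually_lt_const (by linarith)
  obtain ⟨e, he, hec⟩ := (mem_nhdsGT_iff_exists_Ioo_subset' hcs').1 hnear
  -- On `(c, e')` the function `u` is above `M` by less than `κ`, because `M c + κ ≤ M σ + κ`. So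
  -- `u` does not grow there, against `u c ≤ M c ≤ M e' < u e'`.
  set e' := min ((c + e) / 2) s with he'
  have he : c < e := he
  have hce' : c < e' := lt_min (by linarith) hcs'
  have he'e : e' < e := (min_le_left _ _).trans_lt (by linarith)
  have he's : e' ≤ s := min_le_right _ _
  have he'I : e' ∈ Icc a b := ⟨hcs.1.trans hce'.le, he's.trans hs.2⟩
  have hint : ∫ σ in c..e', w σ ≤ 0 := by
    have := integral_mono_of_ae_Ioo hce'.le (intervalIntegrable_mono hw hcI he'I)
      (intervalIntegrable_const (c := (0 : ℝ))) (g := w) ?_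
    · simpa using this
    · filter_upwards [ae_restrict_Ioo_mono hle hcI.1 he'I.2, ae_restrict_mem measurableSet_Ioo]
        with σ hσ hσm
      have hσs : σ ∈ Ioc c s := ⟨hσm.1, hσm.2.le.trans he's⟩
      refine hσ (habove σ hσs) ?_
      have h1 : u σ < M c + κ := hec ⟨hσm.1, hσm.2.trans he'e⟩
      have h2 := hM hcI ⟨hcs.1.trans hσs.1.le, hσs.2.trans hs.2⟩ hσs.1.le
      linarith
  have h1 := integral_sub_primitive hw hcI he'I
  have h2 := hu c hcI
  have h3 := hu e' he'I
  have h4 := habove e' ⟨hce', he's⟩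
  have h5 := hM hcI he'I hce'.le
  linarith

end Interval

/-! ### Fixed points of causal operators. -/

section Volterra

variable {a b : ℝ}

/-- The map `s ↦ max a (s - ε)` of `[a, b]` into itself. -/
def delay (hab : a ≤ b) (ε : ℝ) (hε : 0 ≤ ε) : C(Icc a b, Icc a b) where
  toFun s := ⟨max a (s - ε), le_max_left _ _, max_le hab (by linarith [s.2.2])⟩
  continuous_toFun := by fun_prop

/-- A causal operator with values in a set of uniformly equicontinuous functions has a fixed
point. -/
lemma exists_fixedPoint_of_causal {E : Type*} [NormedAddCommGroup E] [ProperSpace E] (hab : a ≤ b)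
    {Φ : C(Icc a b, E) → C(Icc a b, E)} (hΦ : Continuous Φ)
    (hcausal : ∀ u v : C(Icc a b, E), ∀ s, (∀ σ ≤ s, u σ = v σ) → Φ u s = Φ v s)
    {e : E} (hstart : ∀ u, Φ u ⟨a, le_rfl, hab⟩ = e)
    {ρ : Icc a b → ℝ} (hρ : Continuous ρ)
    (hmod : ∀ u s t, dist (Φ u s) (Φ u t) ≤ |ρ s - ρ t|) : ∃ u, Φ u = u := by
  -- Arzelà–Ascoli: all values of `Φ` share the starting point `e` and the modulus of continuity
  -- given by `ρ`.
  have hK : IsCompact (range Φ |> closure) := by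
    set S : Set C(Icc a b, E) :=
      {u | u ⟨a, le_rfl, hab⟩ = e ∧ ∀ s t, dist (u s) (u t) ≤ |ρ s - ρ t|} with hS
    have hSc : IsClosed S := by
      have h1 : ∀ s : Icc a b, Continuous fun u : C(Icc a b, E) => u s := fun s =>
        continuous_eval_const s
      rw [hS, Set.ofPred_and]
      refine (isClosed_eq (h1 _) continuous_const).inter ?_
      simp only [Set.ofPred_forall]
      exact isClosed_iInter fun s => isClosed_iInter fun t =>
        isClosed_le ((h1 s).dist (h1 t)) continuous_const
    refine IsCompact.of_isClosed_subset (s := S) ?_ isClosed_closure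
      (closure_minimal (range_subset_iff.2 fun u => ⟨hstart u, hmod u⟩) hSc)
    refine ArzelaAscoli.isCompact_of_equicontinuous S ?_ ?_
    · have h2 : ContinuousMap.toFun '' S = {u : Icc a b → E | u ⟨a, le_rfl, hab⟩ = e ∧
          ∀ s t, dist (u s) (u t) ≤ |ρ s - ρ t|} := by
        ext u
        constructor
        · rintro ⟨v, hv, rfl⟩
          exact hv
        · intro hu
          refine ⟨⟨u, ?_⟩, hu, rfl⟩
          refine continuous_iff_continuousAt.2 fun s => tendsto_iff_dist_tendsto_zero.2 ?_
          refine squeeze_zero (fun _ => dist_nonneg) (fun t => hu.2 t s) ?_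
          have : Tendsto (fun t => |ρ t - ρ s|) (𝓝 s) (𝓝 |ρ s - ρ s|) :=
            Continuous.tendsto (by fun_prop) s
          simpa using this
      rw [h2]
      refine IsCompact.of_isClosed_subset
        (isCompact_univ_pi fun s => isCompact_closedBall e |ρ s - ρ ⟨a, le_rfl, hab⟩|) ?_ ?_
      · rw [Set.ofPred_and]
        refine (isClosed_eq (continuous_apply _) continuous_const).inter ?_
        simp only [Set.ofPred_forall]
        exact isClosed_iInter fun s => isClosed_iInter fun t =>
          isClosed_le ((continuous_apply s).dist (continuous_apply t)) continuous_const
      · rintro u ⟨hu, hu'⟩ s -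
        rw [Metric.mem_closedBall, ← hu]
        exact hu' _ _
    · refine fun s => Metric.equicontinuousAt_of_continuity_modulus (fun t => |ρ s - ρ t|) ?_ _ ?_
      · have : Tendsto (fun t => |ρ s - ρ t|) (𝓝 s) (𝓝 |ρ s - ρ s|) :=
          Continuous.tendsto (by fun_prop) s
        simpa using this
      · exact Eventually.of_forall fun t u => u.2.2 s t
  -- The equation with a delay `ε N` is solved exactly by finite iteration; a limit of these
  -- solutions as the delay shrinks is a fixed point of `Φ`. No contraction property is required.
  set ε : ℕ → ℝ := fun N => (b - a) / (N + 1) with hεdef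
  have hε : ∀ N, 0 ≤ ε N := fun N => div_nonneg (sub_nonneg.2 hab) (by positivity)
  have hdel : ∀ N, ∃ u, Φ (u.comp (delay hab (ε N) (hε N))) = u := by
    intro N
    set Ψ : C(Icc a b, E) → C(Icc a b, E) := fun u => Φ (u.comp (delay hab (ε N) (hε N))) with hΨ
    -- Method of steps: by causality each iteration settles the function on one more interval of
    -- length `ε N`.
    have key : ∀ i : ℕ, ∀ s : Icc a b, (s : ℝ) ≤ a + i * ε N →
        Ψ^[i + 1] 0 s = Ψ^[i + 2] 0 s := by
      intro i
      induction i with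
      | zero =>
        intro s hs
        have : s = ⟨a, le_rfl, hab⟩ := Subtype.ext (le_antisymm (by simpa using hs) s.2.1)
        rw [this, Function.iterate_succ_apply', Function.iterate_succ_apply']
        simp only [hΨ, hstart]
      | succ i ih =>
        intro s hs
        rw [Function.iterate_succ_apply' Ψ (i + 1), Function.iterate_succ_apply' Ψ (i + 2)]
        refine hcausal _ _ _ fun σ hσ => ?_
        refine ih _ (max_le (le_add_of_nonneg_right (mul_nonneg i.cast_nonneg (hε N))) ?_)
        have : (σ : ℝ) ≤ s := hσ
        push_cast at hs
        linarith
    -- `N + 1` delays of length `(b - a) / (N + 1)` cover `[a, b]`, so this iterate no longer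
    -- changes.
    refine ⟨Ψ^[N + 2] 0, ?_⟩
    change Ψ _ = _
    rw [← Function.iterate_succ_apply' Ψ]
    ext s
    refine (key (N + 1) s (s.2.2.trans (le_of_eq ?_))).symm
    simp only [hεdef]
    push_cast
    field_simp
    ring
  choose v hv using hdel
  obtain ⟨u, -, φ, hφ, hlim⟩ := hK.tendsto_subseq (x := v)
    (fun N => subset_closure ⟨_, hv N⟩)
  refine ⟨u, ?_⟩
  have hτ : Tendsto (fun N => delay hab (ε (φ N)) (hε (φ N))) atTop
      (𝓝 (ContinuousMap.id (Icc a b))) := by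
    rw [tendsto_iff_dist_tendsto_zero]
    have h0 : Tendsto (fun N => ε (φ N)) atTop (𝓝 0) :=
      Tendsto.comp (f := φ) (g := ε) (((tendsto_const_div_atTop_nhds_zero_nat (b - a)).comp
        (tendsto_add_atTop_nat 1)).congr fun N => by simp [hεdef]) hφ.tendsto_atTop
    refine squeeze_zero (fun _ => dist_nonneg) (fun N => ?_) h0
    rw [ContinuousMap.dist_le (hε _)]
    intro s
    rw [Subtype.dist_eq, Real.dist_eq, abs_le]
    have h1 := hε (φ N)
    have h2 := s.2.1
    change -_ ≤ max a ((s : ℝ) - ε (φ N)) - s ∧ max a ((s : ℝ) - ε (φ N)) - s ≤ _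
    constructor
    · linarith [le_max_right a ((s : ℝ) - ε (φ N))]
    · have : max a ((s : ℝ) - ε (φ N)) ≤ s := max_le h2 (by linarith)
      linarith
  have h1 := (hΦ.tendsto _).comp (hlim.compCM hτ)
  have h2 : (Φ ∘ fun N => ((v ∘ φ) N).comp (delay hab (ε (φ N)) (hε (φ N)))) = v ∘ φ := by
    funext N
    exact hv (φ N)
  rw [h2, ContinuousMap.comp_id] at h1
  exact tendsto_nhds_unique h1 hlim

end Volterra

/-! ### Running maxima and the reflection problem. -/

section RunningMax

variable {a b : ℝ}

/-- The running maximum of a continuous function on `[a, b]`. -/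
noncomputable def runningMax (u : C(Icc a b, ℝ)) : C(Icc a b, ℝ) where
  toFun s := sSup ((fun σ => u (min σ s)) '' univ)
  continuous_toFun := isCompact_univ.continuous_sSup
    (f := fun s σ : Icc a b => u (min σ s)) (by fun_prop)

lemma exists_runningMax_eq (u : C(Icc a b, ℝ)) (s : Icc a b) :
    ∃ σ ≤ s, runningMax u s = u σ := by
  have h : Continuous fun σ => u (min σ s) := by fun_prop
  obtain ⟨σ, -, hσ⟩ := (isCompact_univ.image h).sSup_mem (by
    have : Nonempty (Icc a b) := ⟨s⟩
    exact univ_nonempty.image _)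
  exact ⟨min σ s, min_le_right _ _, hσ.symm⟩

lemma le_runningMax (u : C(Icc a b, ℝ)) {σ s : Icc a b} (h : σ ≤ s) : u σ ≤ runningMax u s := by
  have hc : Continuous fun σ => u (min σ s) := by fun_prop
  refine le_csSup (isCompact_univ.image hc).bddAbove ⟨σ, mem_univ _, ?_⟩
  simp [h]

lemma runningMax_mono (u : C(Icc a b, ℝ)) : Monotone (runningMax u) := by
  intro s t hst
  obtain ⟨σ, hσ, h⟩ := exists_runningMax_eq u s
  rw [h]
  exact le_runningMax u (hσ.trans hst)

lemma runningMax_congr {u v : C(Icc a b, ℝ)} {s : Icc a b} (h : ∀ σ ≤ s, u σ = v σ) :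
    runningMax u s = runningMax v s := by
  obtain ⟨σ, hσ, h1⟩ := exists_runningMax_eq u s
  obtain ⟨τ, hτ, h2⟩ := exists_runningMax_eq v s
  refine le_antisymm ?_ ?_
  · rw [h1, h σ hσ]
    exact le_runningMax v hσ
  · rw [h2, ← h τ hτ]
    exact le_runningMax u hτ

lemma runningMax_le_add_dist (u v : C(Icc a b, ℝ)) (s : Icc a b) :
    runningMax u s ≤ runningMax v s + dist u v := by
  obtain ⟨σ, hσ, h⟩ := exists_runningMax_eq u s
  have h1 := ContinuousMap.dist_apply_le_dist (f := u) (g := v) σ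
  rw [Real.dist_eq] at h1
  have h2 := le_abs_self (u σ - v σ)
  have h3 := le_runningMax v hσ
  linarith

lemma continuous_runningMax : Continuous (runningMax (a := a) (b := b)) := by
  refine LipschitzWith.continuous (K := 1) (LipschitzWith.of_dist_le_mul fun u v => ?_)
  rw [NNReal.coe_one, one_mul, ContinuousMap.dist_le dist_nonneg]
  intro s
  rw [Real.dist_eq, abs_le]
  have h1 := runningMax_le_add_dist u v s
  have h2 := runningMax_le_add_dist v u s
  rw [dist_comm] at h2
  constructor <;> linarith

lemma runningMax_eq_of_monotone {u : C(Icc a b, ℝ)} (hu : Monotone u) : runningMax u = u := by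
  ext s
  obtain ⟨σ, hσ, h⟩ := exists_runningMax_eq u s
  exact le_antisymm (h ▸ hu hσ) (le_runningMax u le_rfl)

/-- The running maximum grows on `[s, t]` only through a new maximum at some `σ` there, and `u σ`
exceeds `u s` by at most `ρ σ - ρ s`. -/
lemma runningMax_sub_le {u : C(Icc a b, ℝ)} {ρ : Icc a b → ℝ} (hρ : Monotone ρ)
    (hu : ∀ s t, s ≤ t → u t - u s ≤ ρ t - ρ s) {s t : Icc a b} (hst : s ≤ t) :
    runningMax u t - runningMax u s ≤ ρ t - ρ s := by
  obtain ⟨σ, hσ, h⟩ := exists_runningMax_eq u t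
  rw [h]
  have h0 := hρ hst
  rcases le_total σ s with h1 | h1
  · have := le_runningMax u h1
    linarith
  · have h2 := hu s σ h1
    have h3 := le_runningMax u (le_refl s)
    have h4 := hρ hσ
    linarith

lemma mem_of_between {s t σ : Icc a b} {η : ℝ} (ht : dist t s < η)
    (h : (s ≤ σ ∧ σ ≤ t) ∨ (t ≤ σ ∧ σ ≤ s)) : dist σ s < η := by
  refine lt_of_le_of_lt ?_ ht
  rw [Subtype.dist_eq, Subtype.dist_eq, Real.dist_eq, Real.dist_eq]
  rcases h with ⟨h3, h4⟩ | ⟨h3, h4⟩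
  · have h3 : (s : ℝ) ≤ σ := h3
    have h4 : (σ : ℝ) ≤ t := h4
    rw [abs_of_nonneg (by linarith), abs_of_nonneg (by linarith)]
    linarith
  · have h3 : (t : ℝ) ≤ σ := h3
    have h4 : (σ : ℝ) ≤ s := h4
    rw [abs_of_nonpos (by linarith), abs_of_nonpos (by linarith)]
    linarith

lemma eventually_runningMax_le {u : C(Icc a b, ℝ)} {s : Icc a b}
    (h : ∀ᶠ t in 𝓝 s, u t ≤ runningMax u s) :
    ∀ᶠ t in 𝓝 s, runningMax u t ≤ runningMax u s := by
  obtain ⟨η, hη, h2⟩ := Metric.eventually_nhds_iff.1 h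
  refine Metric.eventually_nhds_iff.2 ⟨η, hη, fun t ht => ?_⟩
  obtain ⟨σ, hσ, h3⟩ := exists_runningMax_eq u t
  rw [h3]
  rcases le_total σ s with h4 | h4
  · exact le_runningMax u h4
  · exact h2 (mem_of_between ht (Or.inl ⟨h4, hσ⟩))

/-- Near `s` the function stays below the old maximum. Hence no new maximum appears to the right,
and the old one was attained before the neighbourhood was entered from the left. -/
lemma eventually_runningMax_eq {u : C(Icc a b, ℝ)} {s : Icc a b} (h : u s < runningMax u s) :
    ∀ᶠ t in 𝓝 s, runningMax u t = runningMax u s := by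
  have h1 : ∀ᶠ t in 𝓝 s, u t < runningMax u s := u.continuous.continuousAt.eventually_lt_const h
  obtain ⟨η, hη, h2⟩ := Metric.eventually_nhds_iff.1 h1
  filter_upwards [eventually_runningMax_le (h1.mono fun t ht => ht.le),
    Metric.eventually_nhds_iff.2 ⟨η, hη, fun t ht => ht⟩] with t ht htη
  refine le_antisymm ht ?_
  obtain ⟨σ, hσ, h3⟩ := exists_runningMax_eq u s
  rcases le_total σ t with h4 | h4
  · rw [h3]
    exact le_runningMax u h4
  · exact absurd h3.symm (h2 (mem_of_between htη (Or.inr ⟨h4, hσ⟩))).ne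

/-- Reflection of several processes at upper barriers. The function `D j` is the least push that
keeps `h j - ∑ j', K j j' * D j' - D j` non-positive, and it grows only while this is zero. -/
lemma exists_reflection {n : ℕ} (hab : a ≤ b) {ρ : Icc a b → ℝ} (hρc : Continuous ρ)
    (hρ : Monotone ρ) (h : Fin n → C(Icc a b, ℝ))
    (hh : ∀ j s t, s ≤ t → h j t - h j s ≤ ρ t - ρ s) (h0 : ∀ j, h j ⟨a, le_rfl, hab⟩ ≤ 0)
    {K : Fin n → Fin n → ℝ} (hK : ∀ j j', 0 ≤ K j j') :
    ∃ D : Fin n → C(Icc a b, ℝ), (∀ j, D j ⟨a, le_rfl, hab⟩ = 0) ∧ (∀ j, Monotone (D j)) ∧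
      (∀ j s t, s ≤ t → D j t - D j s ≤ ρ t - ρ s) ∧
      (∀ j s, h j s - ∑ j', K j j' * D j' s ≤ D j s) ∧
      ∀ j s, h j s - ∑ j', K j j' * D j' s < D j s → ∀ᶠ t in 𝓝 s, D j t = D j s := by
  set comp : C(Icc a b, Fin n → ℝ) → Fin n → C(Icc a b, ℝ) := fun u j =>
    ⟨fun s => max (u s j) 0, by fun_prop⟩
  have hcomp0 : ∀ u j s, 0 ≤ comp u j s := fun u j s => le_max_right _ _
  have hcompc : ∀ j, Continuous fun u => comp u j := by
    intro j
    have : (fun u => comp u j) = fun u : C(Icc a b, Fin n → ℝ) =>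
        (⟨fun v => max (v j) 0, by fun_prop⟩ : C(Fin n → ℝ, ℝ)).comp u := rfl
    rw [this]
    exact ContinuousMap.continuous_postcomp _
  -- The wanted pushes satisfy `D j = runningMax (h j - ∑ K j j' D j')⁺`. Replacing each input by
  -- the running maximum of its positive part makes the subtracted sum non-decreasing for arbitrary
  -- `u`, so that `B u j` inherits the growth bound `ρ` of `h j`.
  set B : C(Icc a b, Fin n → ℝ) → Fin n → C(Icc a b, ℝ) := fun u j =>
    (⟨fun r => max r 0, by fun_prop⟩ : C(ℝ, ℝ)).comp
      (h j - ∑ j', K j j' • runningMax (comp u j')) with hB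
  have hBc : ∀ j, Continuous fun u => B u j := by
    intro j
    refine (ContinuousMap.continuous_postcomp _).comp (continuous_const.sub ?_)
    exact continuous_finsetSum _ fun j' _ =>
      (continuous_const_smul (K j j')).comp (continuous_runningMax.comp (hcompc j'))
  have hBapp : ∀ u j s, B u j s = max (h j s - ∑ j', K j j' * runningMax (comp u j') s) 0 := by
    intro u j s
    simp [hB, ContinuousMap.sum_apply]
  have hB0 : ∀ u j s, 0 ≤ B u j s := fun u j s => by rw [hBapp]; exact le_max_right _ _
  have hBinc : ∀ u j s t, s ≤ t → B u j t - B u j s ≤ ρ t - ρ s := by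
    intro u j s t hst
    rw [hBapp, hBapp]
    have h1 : ∑ j', K j j' * runningMax (comp u j') s ≤ ∑ j', K j j' * runningMax (comp u j') t :=
      Finset.sum_le_sum fun j' _ => mul_le_mul_of_nonneg_left (runningMax_mono _ hst) (hK j j')
    have h2 := hh j s t hst
    have h3 := hρ hst
    rw [sub_le_iff_le_add]
    refine max_le ?_ ?_
    · linarith [le_max_left (h j s - ∑ j', K j j' * runningMax (comp u j') s) 0]
    · linarith [le_max_right (h j s - ∑ j', K j j' * runningMax (comp u j') s) 0]
  have hBa : ∀ u j, runningMax (B u j) ⟨a, le_rfl, hab⟩ = 0 := by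
    intro u j
    obtain ⟨σ, hσ, h1⟩ := exists_runningMax_eq (B u j) ⟨a, le_rfl, hab⟩
    have hσa : σ = ⟨a, le_rfl, hab⟩ := le_antisymm hσ σ.2.1
    rw [h1, hσa, hBapp]
    refine max_eq_right ?_
    have h2 : 0 ≤ ∑ j', K j j' * runningMax (comp u j') ⟨a, le_rfl, hab⟩ :=
      Finset.sum_nonneg fun j' _ => mul_nonneg (hK j j')
        ((hcomp0 u j' _).trans (le_runningMax _ le_rfl))
    linarith [h0 j]
  set Φ : C(Icc a b, Fin n → ℝ) → C(Icc a b, Fin n → ℝ) := fun u =>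
    ContinuousMap.pi fun j => runningMax (B u j)
  have hΦapp : ∀ u s j, Φ u s j = runningMax (B u j) s := fun u s j => rfl
  have hΦ : Continuous Φ := by
    rw [Metric.continuous_iff]
    intro u ε hε
    have h1 : ∀ j, ∀ᶠ v in 𝓝 u, dist (runningMax (B v j)) (runningMax (B u j)) < ε / 2 := fun j =>
      Metric.tendsto_nhds.1 ((continuous_runningMax.comp (hBc j)).tendsto u) _ (half_pos hε)
    obtain ⟨η, hη, h2⟩ := Metric.eventually_nhds_iff.1 (eventually_all.2 h1)
    refine ⟨η, hη, fun v hv => lt_of_le_of_lt ?_ (half_lt_self hε)⟩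
    rw [ContinuousMap.dist_le (half_pos hε).le]
    intro s
    rw [dist_pi_le_iff (half_pos hε).le]
    intro j
    exact (ContinuousMap.dist_apply_le_dist s).trans (h2 hv j).le
  have hcaus : ∀ u v : C(Icc a b, Fin n → ℝ), ∀ s, (∀ σ ≤ s, u σ = v σ) → Φ u s = Φ v s := by
    intro u v s huv
    funext j
    rw [hΦapp, hΦapp]
    refine runningMax_congr fun σ hσ => ?_
    rw [hBapp, hBapp]
    congr 2
    refine Finset.sum_congr rfl fun j' _ => ?_
    congr 1
    refine runningMax_congr fun τ hτ => ?_
    change max (u τ j') 0 = max (v τ j') 0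
    rw [huv τ (hτ.trans hσ)]
  have hΦa : ∀ u, Φ u ⟨a, le_rfl, hab⟩ = 0 := fun u => funext fun j => hBa u j
  have hmod : ∀ u s t, dist (Φ u s) (Φ u t) ≤ |ρ s - ρ t| := by
    intro u s t
    have h1 : ∀ s t : Icc a b, s ≤ t → ∀ j, |Φ u s j - Φ u t j| ≤ |ρ s - ρ t| := by
      intro s t hst j
      rw [hΦapp, hΦapp, abs_sub_comm, abs_sub_comm (ρ s), abs_of_nonneg (sub_nonneg.2 (hρ hst)),
        abs_of_nonneg (sub_nonneg.2 (runningMax_mono _ hst))]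
      exact runningMax_sub_le hρ (hBinc u j) hst
    rw [dist_pi_le_iff (abs_nonneg _)]
    intro j
    rw [Real.dist_eq]
    rcases le_total s t with hst | hst
    · exact h1 s t hst j
    · rw [abs_sub_comm, abs_sub_comm (ρ s)]
      exact h1 t s hst j
  obtain ⟨u, hu⟩ := exists_fixedPoint_of_causal hab hΦ hcaus hΦa hρc hmod
  have hD : ∀ j s, comp u j s = runningMax (B u j) s := by
    intro j s
    change max (u s j) 0 = _
    conv_lhs => rw [← hu]
    exact max_eq_left ((hB0 u j s).trans (le_runningMax _ le_rfl))
  have hmon : ∀ j, Monotone (comp u j) := by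
    intro j s t hst
    rw [hD, hD]
    exact runningMax_mono _ hst
  -- At the fixed point the inputs are already monotone, and the inner running maxima drop out.
  have hBu : ∀ j s, B u j s = max (h j s - ∑ j', K j j' * comp u j' s) 0 := by
    intro j s
    rw [hBapp]
    simp only [runningMax_eq_of_monotone (hmon _)]
  have hstart : ∀ j, comp u j ⟨a, le_rfl, hab⟩ = 0 := fun j => (hD j _).trans (hBa u j)
  refine ⟨comp u, hstart, hmon, fun j s t hst => ?_, fun j s => ?_, fun j s hlt => ?_⟩
  · rw [hD, hD]
    exact runningMax_sub_le hρ (hBinc u j) hst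
  · rw [hD]
    refine le_trans ?_ (le_runningMax _ le_rfl)
    rw [hBu]
    exact le_max_left _ _
  -- With a positive push, `B u j` is strictly below its running maximum. With zero push the two may
  -- coincide at `0`; then the unclipped process is negative nearby, so `B u j` vanishes there.
  · by_cases hpos : 0 < comp u j s
    · have h1 : B u j s < runningMax (B u j) s := by
        rw [← hD, hBu]
        exact max_lt hlt hpos
      filter_upwards [eventually_runningMax_eq h1] with t ht
      rw [hD, hD, ht]
    · have h1 : comp u j s = 0 := le_antisymm (not_lt.1 hpos) (hcomp0 u j s)
      have h2 : ∀ᶠ t in 𝓝 s, h j t - ∑ j', K j j' * comp u j' t < 0 := by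
        have h2 : Continuous fun t => h j t - ∑ j', K j j' * comp u j' t := by fun_prop
        exact h2.continuousAt.eventually_lt_const (h1 ▸ hlt)
      have h3 : ∀ᶠ t in 𝓝 s, B u j t ≤ runningMax (B u j) s := by
        filter_upwards [h2] with t ht
        rw [← hD, h1, hBu]
        exact max_le ht.le le_rfl
      filter_upwards [eventually_runningMax_le h3] with t ht
      rw [← hD, ← hD, h1] at ht
      rw [h1]
      exact le_antisymm ht (hcomp0 u j t)

end RunningMax

/-! ### From cumulative pushes to intensities. -/

section Intensity

variable {a b : ℝ}

lemma absolutelyContinuousOnInterval_of_dist_le {g ρ : ℝ → ℝ}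
    (hρ : AbsolutelyContinuousOnInterval ρ a b)
    (h : ∀ s ∈ uIcc a b, ∀ t ∈ uIcc a b, dist (g s) (g t) ≤ dist (ρ s) (ρ t)) :
    AbsolutelyContinuousOnInterval g a b := by
  rw [absolutelyContinuousOnInterval_iff] at hρ ⊢
  intro ε hε
  obtain ⟨η, hη, h1⟩ := hρ ε hε
  refine ⟨η, hη, fun E hE hlt => lt_of_le_of_lt (Finset.sum_le_sum fun i hi => ?_) (h1 E hE hlt)⟩
  exact h _ (hE.1 i hi).1 _ (hE.1 i hi).2

/-- A non-decreasing function that grows at most at rate `r` is the integral of `l * r`, where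
`0 ≤ l ≤ 1` and `l` vanishes where the function is locally constant. -/
lemma exists_intensity (hab : a ≤ b) {r : ℝ → ℝ} (hr : IntervalIntegrable r volume a b)
    {g : ℝ → ℝ} (hg : Monotone g)
    (hgr : ∀ s ∈ Icc a b, ∀ t ∈ Icc a b, s ≤ t → g t - g s ≤ ∫ σ in s..t, r σ) :
    ∃ l : ℝ → ℝ, (∀ s, 0 ≤ l s ∧ l s ≤ 1) ∧
      IntervalIntegrable (fun s => l s * r s) volume a b ∧
      (∀ s ∈ Icc a b, ∫ σ in a..s, l σ * r σ = g s - g a) ∧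
      ∀ s, (∀ᶠ t in 𝓝 s, g t = g s) → l s = 0 := by
  set ρ : ℝ → ℝ := fun s => ∫ σ in a..s, r σ
  have hρsub : ∀ s ∈ Icc a b, ∀ t ∈ Icc a b, ρ t - ρ s = ∫ σ in s..t, r σ := fun s hs t ht =>
    integral_sub_primitive hr hs ht
  have hac : AbsolutelyContinuousOnInterval g a b := by
    refine absolutelyContinuousOnInterval_of_dist_le
      (hr.absolutelyContinuousOnInterval_intervalIntegral left_mem_uIcc) ?_
    rw [uIcc_of_le hab]
    have key : ∀ s ∈ Icc a b, ∀ t ∈ Icc a b, s ≤ t → dist (g s) (g t) ≤ dist (ρ s) (ρ t) := by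
      intro s hs t ht hst
      have h1 := hgr s hs t ht hst
      rw [← hρsub s hs t ht] at h1
      rw [dist_comm, dist_comm (ρ s), Real.dist_eq, Real.dist_eq,
        abs_of_nonneg (sub_nonneg.2 (hg hst))]
      exact h1.trans (le_abs_self _)
    intro s hs t ht
    rcases le_total s t with hst | hst
    · exact key s hs t ht hst
    · rw [dist_comm, dist_comm (ρ s)]
      exact key t ht s hs hst
  have hderiv : ∀ᵐ s ∂volume.restrict (Ioo a b), 0 ≤ deriv g s ∧ deriv g s ≤ r s := by
    rw [ae_restrict_iff' measurableSet_Ioo]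
    filter_upwards [hac.ae_differentiableAt, hr.ae_hasDerivAt_integral] with s h1 h2 hs
    rw [uIcc_of_le hab] at h1 h2
    have hsI := Ioo_subset_Icc_self hs
    refine ⟨hg.deriv_nonneg, ?_⟩
    have h3 : HasDerivAt (fun s => ρ s - g s) (r s - deriv g s) s :=
      (h2 hsI a ⟨le_rfl, hab⟩).sub (h1 hsI).hasDerivAt
    have h4 : Tendsto (slope (fun s => ρ s - g s) s) (𝓝[>] s) (𝓝 (r s - deriv g s)) :=
      h3.tendsto_slope.mono_left (nhdsWithin_mono _ fun t ht => ne_of_gt ht)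
    have h5 : 0 ≤ r s - deriv g s := by
      refine ge_of_tendsto h4 ?_
      filter_upwards [Ioo_mem_nhdsGT hs.2] with t ht
      have htI : t ∈ Icc a b := ⟨hs.1.le.trans ht.1.le, ht.2.le⟩
      have h6 := hgr s hsI t htI ht.1.le
      rw [← hρsub s hsI t htI] at h6
      rw [slope_def_field]
      exact div_nonneg (by linarith) (sub_nonneg.2 ht.1.le)
    linarith
  -- Almost everywhere `0 ≤ deriv g ≤ r`, so the truncation has no effect where `r > 0`. Where `r =
  -- 0` the derivative is `0` too, and the value of the quotient is irrelevant.
  set l : ℝ → ℝ := fun s => max 0 (min 1 (deriv g s / r s)) with hl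
  have hlr : ∀ᵐ s ∂volume.restrict (Ioo a b), l s * r s = deriv g s := by
    filter_upwards [hderiv] with s hs
    rcases (hs.1.trans hs.2).eq_or_lt with h0 | h0
    · rw [← h0, mul_zero]
      exact le_antisymm hs.1 (h0 ▸ hs.2)
    · rw [hl]
      dsimp only
      rw [min_eq_right ((div_le_one h0).2 hs.2), max_eq_right (div_nonneg hs.1 h0.le),
        div_mul_cancel₀ _ h0.ne']
  refine ⟨l, fun s => ⟨le_max_left _ _, max_le zero_le_one (min_le_left _ _)⟩, ?_, ?_, ?_⟩
  · refine hac.intervalIntegrable_deriv.congr_ae ?_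
    rw [uIoc_of_le hab, ← Measure.restrict_congr_set Ioo_ae_eq_Ioc]
    exact hlr.mono fun s hs => hs.symm
  · intro s hs
    rw [integral_congr_of_ae_Ioo hs.1 (ae_restrict_Ioo_mono hlr le_rfl hs.2)]
    refine (hac.mono ?_).integral_deriv_eq_sub
    rw [uIcc_of_le hab]
    exact uIcc_subset_Icc ⟨le_rfl, hab⟩ hs
  · intro s hs
    have : deriv g s = 0 := by
      rw [EventuallyEq.deriv_eq (f := fun _ => g s) hs]
      simp
    simp [hl, this]

/-- Reflection at upper barriers, with the pushes performed at intensities in `[0, 1]`. -/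
lemma exists_reflection_intensity {n : ℕ} (hab : a ≤ b) {r : ℝ → ℝ}
    (hr : IntervalIntegrable r volume a b) (hr0 : ∀ᵐ s ∂volume.restrict (Ioo a b), 0 ≤ r s)
    {h : Fin n → ℝ → ℝ} (hc : ∀ j, ContinuousOn (h j) (Icc a b))
    (hh : ∀ j, ∀ s ∈ Icc a b, ∀ t ∈ Icc a b, s ≤ t → h j t - h j s ≤ ∫ σ in s..t, r σ)
    (h0 : ∀ j, h j a ≤ 0) {K : Fin n → Fin n → ℝ} (hK : ∀ j j', 0 ≤ K j j') :
    ∃ l : Fin n → ℝ → ℝ, (∀ j s, 0 ≤ l j s ∧ l j s ≤ 1) ∧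
      (∀ j, IntervalIntegrable (fun s => l j s * r s) volume a b) ∧
      (∀ j, ∀ s ∈ Icc a b, h j s - ∑ j', K j j' * ∫ σ in a..s, l j' σ * r σ
        ≤ ∫ σ in a..s, l j σ * r σ) ∧
      ∀ j, ∀ s ∈ Ioo a b, (h j s - ∑ j', K j j' * ∫ σ in a..s, l j' σ * r σ
        < ∫ σ in a..s, l j σ * r σ) → l j s = 0 := by
  set ρ : Icc a b → ℝ := fun s => ∫ σ in a..s, r σ
  have hρsub : ∀ s t : Icc a b, ρ t - ρ s = ∫ σ in s..t, r σ := fun s t =>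
    integral_sub_primitive hr s.2 t.2
  have hρc : Continuous ρ :=
    continuousOn_iff_continuous_domRestrict.1 (continuousOn_primitive_Icc hab hr)
  have hρm : Monotone ρ := by
    intro s t hst
    rw [← sub_nonneg, hρsub]
    have hst' : (s : ℝ) ≤ t := hst
    have := integral_mono_of_ae_Ioo hst' intervalIntegrable_const
      (intervalIntegrable_mono hr s.2 t.2) (ae_restrict_Ioo_mono hr0 s.2.1 t.2.2)
    simpa using this
  obtain ⟨D, hD0, hDm, hDρ, hDle, hDloc⟩ := exists_reflection hab hρc hρm
    (fun j => ⟨fun s => h j s, continuousOn_iff_continuous_domRestrict.1 (hc j)⟩)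
    (fun j s t hst => by rw [hρsub]; exact hh j s s.2 t t.2 hst) h0 hK
  have hint : ∀ j, ∃ l : ℝ → ℝ, (∀ s, 0 ≤ l s ∧ l s ≤ 1) ∧
      IntervalIntegrable (fun s => l s * r s) volume a b ∧
      (∀ s ∈ Icc a b, ∫ σ in a..s, l σ * r σ = IccExtend hab (D j) s - IccExtend hab (D j) a) ∧
      ∀ s, (∀ᶠ t in 𝓝 s, IccExtend hab (D j) t = IccExtend hab (D j) s) → l s = 0 := by
    intro j
    refine exists_intensity hab hr ((hDm j).IccExtend hab) fun s hs t ht hst => ?_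
    rw [IccExtend_of_mem _ _ hs, IccExtend_of_mem _ _ ht]
    have := hDρ j ⟨s, hs⟩ ⟨t, ht⟩ hst
    rwa [hρsub] at this
  choose l hl01 hli hlD hl0 using hint
  have hlD' : ∀ j s (hs : s ∈ Icc a b), ∫ σ in a..s, l j σ * r σ = D j ⟨s, hs⟩ := by
    intro j s hs
    rw [hlD j s hs, IccExtend_left, hD0, sub_zero, IccExtend_of_mem _ _ hs]
  refine ⟨l, hl01, hli, fun j s hs => ?_, fun j s hs hlt => hl0 j s ?_⟩
  · simp only [hlD' _ s hs]
    exact hDle j ⟨s, hs⟩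
  · have hsI := Ioo_subset_Icc_self hs
    simp only [hlD' _ s hsI] at hlt
    have h1 := hDloc j ⟨s, hsI⟩ hlt
    have h2 : Tendsto (projIcc a b hab) (𝓝 s) (𝓝 ⟨s, hsI⟩) := by
      have := (continuous_projIcc (h := hab)).tendsto s
      rwa [projIcc_of_mem hab hsI] at this
    filter_upwards [h2.eventually h1] with t ht
    rw [IccExtend_of_mem _ _ hsI]
    exact ht

end Intensity

/-! ### Primal runs and the exponential bound. -/

section PrimalRun

/-- The standing assumptions on the objective, the constraint matrix and the parameters. -/
structure Admissible {m n : ℕ} (f : (Fin n → ℝ) → ℝ) (A : Matrix (Fin m) (Fin n) ℝ) (d : ℕ)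
    (δ : ℝ) : Prop where
  convex : ConvexOn ℝ univ f
  diff : Differentiable ℝ f
  nonneg : ∀ x, 0 ≤ x → 0 ≤ f x
  mono : ∀ x x', 0 ≤ x' → x' ≤ x → f x' ≤ f x
  grad_mono : ∀ x x', 0 ≤ x' → x' ≤ x → grad f x' ≤ grad f x
  entry_nonneg : ∀ i j, 0 ≤ A i j
  card_le : ∀ i, (Finset.univ.filter fun j => A i j ≠ 0).card ≤ d
  pos : 0 < δ

/-- The trajectory `x` obeys the primal rule with velocity `p` on `[0, T]`, while row `t` is not
more than satisfied. -/
structure IsPrimalRun {m n : ℕ} (f : (Fin n → ℝ) → ℝ) (A : Matrix (Fin m) (Fin n) ℝ) (d : ℕ)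
    (t : Fin m) (T : ℝ) (x p : ℝ → Fin n → ℝ) : Prop where
  nonneg : 0 ≤ T
  start : 0 ≤ x 0
  entry : ∃ j, 0 < A t j
  integrable : ∀ j, IntervalIntegrable (fun s => p s j) volume 0 T
  eq : ∀ s ∈ Icc 0 T, ∀ j, x s j = x 0 j + ∫ σ in (0 : ℝ)..s, p σ j
  rate : ∀ᵐ s ∂volume.restrict (Ioo 0 T), IsPrimalRate f A d t (x s) (p s)
  below : ∀ s ∈ Icc 0 T, A t ⬝ᵥ x s ≤ 1

/-- For every set `S` of rows, `x_j` is exponentially large in `∑_{i ∈ S} a_{ij} y_i`. -/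
def IsExpBounded {m n : ℕ} (f : (Fin n → ℝ) → ℝ) (A : Matrix (Fin m) (Fin n) ℝ) (d : ℕ) (δ : ℝ)
    (x : Fin n → ℝ) (y : Fin m → ℝ) : Prop :=
  ∀ (S : Finset (Fin m)) (j : Fin n) (a : ℝ), 0 < a → (∀ i ∈ S, A i j ≤ a) →
    Real.log (1 + 2 * (d : ℝ) ^ 2) * ∑ i ∈ S, A i j * y i
      ≤ grad f (δ • x) j * Real.log (1 + a * d * x j)

variable {m n : ℕ} {f : (Fin n → ℝ) → ℝ} {A : Matrix (Fin m) (Fin n) ℝ} {d : ℕ} {δ : ℝ}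
  {t : Fin m} {T : ℝ} {x p : ℝ → Fin n → ℝ}

namespace Admissible

lemma one_le (h : Admissible f A d δ) (ht : ∃ j, 0 < A t j) : 1 ≤ d := by
  obtain ⟨j, hj⟩ := ht
  refine le_trans (Finset.card_pos.2 ⟨j, ?_⟩) (h.card_le t)
  simp [hj.ne']

lemma grad_smul_nonneg (h : Admissible f A d δ) {z : Fin n → ℝ} (hz : 0 ≤ z) (j : Fin n) :
    0 ≤ grad f (δ • z) j :=
  grad_nonneg h.diff h.mono (smul_nonneg h.pos.le hz) j

lemma grad_smul_mono (h : Admissible f A d δ) {z z' : Fin n → ℝ} (hz : 0 ≤ z) (hzz' : z ≤ z') :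
    grad f (δ • z) ≤ grad f (δ • z') :=
  h.grad_mono _ _ (smul_nonneg h.pos.le hz) (smul_le_smul_of_nonneg_left hzz' h.pos.le)

end Admissible

namespace IsPrimalRun

lemma continuousOn_apply (hx : IsPrimalRun f A d t T x p) (j : Fin n) :
    ContinuousOn (fun s => x s j) (Icc 0 T) := by
  refine ContinuousOn.congr ?_ fun s hs => hx.eq s hs j
  exact continuousOn_const.add (continuousOn_primitive_Icc hx.nonneg (hx.integrable j))

lemma continuousOn (hx : IsPrimalRun f A d t T x p) : ContinuousOn x (Icc 0 T) :=
  continuousOn_pi.2 hx.continuousOn_apply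

/-- In a thin strip below `0` the numerator `a_{tj} x_j + 1/d` is still positive, so `x_j` does not
decrease there; this is why the barrier lemma asks for a condition only within distance `κ`. -/
lemma x_nonneg (hx : IsPrimalRun f A d t T x p) (h : Admissible f A d δ) {s : ℝ}
    (hs : s ∈ Icc 0 T) : 0 ≤ x s := by
  intro j
  have hd : (1 : ℝ) ≤ d := by exact_mod_cast h.one_le hx.entry
  have hκ : 0 < 1 / (d * (A t j + 1)) := by
    have := h.entry_nonneg t j
    positivity
  have := le_barrier (u := fun s => -x s j) (w := fun s => -p s j) (M := fun _ => 0) hκ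
    (hx.integrable j).neg (fun s hs => ?_) (fun _ _ _ _ _ => le_rfl) (by simpa using hx.start j) ?_
    s hs
  · simpa using this
  · simp only [intervalIntegral.integral_neg]
    rw [hx.eq s hs j]
    ring
  · filter_upwards [hx.rate] with σ hσ h1 h2
    rcases (h.entry_nonneg t j).eq_or_lt with h3 | h3
    · rw [(hσ j).1 h3.symm, neg_zero]
    · obtain ⟨h4, h5⟩ := (hσ j).2 h3
      rw [h5, neg_nonpos]
      refine div_nonneg ?_ h4.le
      rw [zero_add, lt_div_iff₀ (by positivity)] at h2
      have h6 : 1 / (d : ℝ) * d = 1 := by field_simp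
      by_contra! h7
      have h8 := mul_lt_mul_of_pos_right h7 (by linarith : (0 : ℝ) < d)
      rw [add_mul, h6, zero_mul] at h8
      nlinarith

lemma ae_rate_nonneg (hx : IsPrimalRun f A d t T x p) (h : Admissible f A d δ) :
    ∀ᵐ s ∂volume.restrict (Ioo 0 T), ∀ j, 0 ≤ p s j := by
  filter_upwards [hx.rate, ae_restrict_mem measurableSet_Ioo] with s hs hsm j
  rcases (h.entry_nonneg t j).eq_or_lt with h3 | h3
  · rw [(hs j).1 h3.symm]
  · obtain ⟨h4, h5⟩ := (hs j).2 h3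
    rw [h5]
    have := hx.x_nonneg h (Ioo_subset_Icc_self hsm) j
    have : 0 ≤ x s j := this
    positivity

lemma sub_eq (hx : IsPrimalRun f A d t T x p) {s s' : ℝ} (hs : s ∈ Icc 0 T) (hs' : s' ∈ Icc 0 T)
    (j : Fin n) : x s' j - x s j = ∫ σ in s..s', p σ j := by
  rw [← integral_sub_primitive (hx.integrable j) hs hs', hx.eq s hs, hx.eq s' hs']
  ring

lemma monotoneOn (hx : IsPrimalRun f A d t T x p) (h : Admissible f A d δ) :
    MonotoneOn x (Icc 0 T) := by
  intro s hs s' hs' hle j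
  rw [← sub_nonneg, hx.sub_eq hs hs']
  have h1 := integral_mono_of_ae_Ioo (g := fun _ => 0) hle intervalIntegrable_const
    (intervalIntegrable_mono (hx.integrable j) hs hs')
    (ae_restrict_Ioo_mono ((hx.ae_rate_nonneg h).mono fun σ hσ => hσ j) hs.1 hs'.2)
  simpa using h1

lemma monotoneOn_grad (hx : IsPrimalRun f A d t T x p) (h : Admissible f A d δ) :
    MonotoneOn (fun s => grad f (δ • x s)) (Icc 0 T) := fun _ hs _ hs' hle =>
  h.grad_smul_mono (hx.x_nonneg h hs) (hx.monotoneOn h hs hs' hle)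

lemma continuousOn_grad (hx : IsPrimalRun f A d t T x p) (h : Admissible f A d δ) (c : ℝ)
    (j : Fin n) : ContinuousOn (fun s => grad f (c • x s) j) (Icc 0 T) :=
  (continuous_grad_apply h.convex h.diff j).comp_continuousOn (hx.continuousOn.const_smul c)

lemma entry_mul_le (hx : IsPrimalRun f A d t T x p) (h : Admissible f A d δ) {s : ℝ}
    (hs : s ∈ Icc 0 T) (j : Fin n) : A t j * x s j ≤ 1 :=
  (Finset.single_le_sum (f := fun j => A t j * x s j)
    (fun j _ => mul_nonneg (h.entry_nonneg t j) (hx.x_nonneg h hs j)) (Finset.mem_univ j)).trans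
    (hx.below s hs)

lemma dualRate_nonneg (hx : IsPrimalRun f A d t T x p) (h : Admissible f A d δ) {s : ℝ}
    (hs : s ∈ Icc 0 T) : 0 ≤ dualRate f d δ (x s) :=
  OnlineCovering.dualRate_nonneg h.diff h.mono h.pos (hx.x_nonneg h hs) d

/-- The rate may be unbounded where `∇_j f(x)` is small, but it is dominated by a multiple of the
integrable velocity `p_j` of any column in the row: `L r ≤ μ_j / ∇_j f(x)`, `μ_j` is at most its
final value, and `1 / ∇_j f(x) ≤ d p_j`. -/
lemma intervalIntegrable_dualRate (hx : IsPrimalRun f A d t T x p) (h : Admissible f A d δ) :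
    IntervalIntegrable (fun s => dualRate f d δ (x s)) volume 0 T := by
  obtain ⟨j, hj⟩ := hx.entry
  have hd1 := h.one_le hx.entry
  have hd : (1 : ℝ) ≤ d := by exact_mod_cast hd1
  have hL := log_pos_of_one_le hd1
  refine intervalIntegrable_of_ae_le hx.nonneg ?_ ((hx.integrable j).const_mul
    (grad f (δ • x T) j * d / Real.log (1 + 2 * (d : ℝ) ^ 2))) ?_
  · exact ((measurable_dualRate h.convex h.diff d δ).comp_aemeasurable
      ((hx.continuousOn.mono Ioo_subset_Icc_self).aemeasurable
        measurableSet_Ioo)).aestronglyMeasurable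
  · filter_upwards [hx.rate, ae_restrict_mem measurableSet_Ioo] with s hs hsm
    have hsI := Ioo_subset_Icc_self hsm
    obtain ⟨h1, h2⟩ := (hs j).2 hj
    have hx0 := hx.x_nonneg h hsI
    have h3 := log_mul_dualRate_le h.diff h.mono h.pos hx0 hd1 h1
    rw [abs_of_nonneg (hx.dualRate_nonneg h hsI), div_mul_eq_mul_div, le_div_iff₀ hL, mul_comm]
    refine h3.trans ?_
    rw [h2, mul_div_assoc', div_le_div_iff_of_pos_right h1]
    have h4 : grad f (δ • x s) j ≤ grad f (δ • x T) j :=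
      hx.monotoneOn_grad h hsI ⟨hx.nonneg, le_rfl⟩ hsm.2.le j
    have h5 : 1 ≤ d * (A t j * x s j + 1 / d) := by
      have : 0 ≤ x s j := hx0 j
      rw [mul_add, mul_one_div_cancel (by positivity)]
      have : 0 ≤ (d : ℝ) * (A t j * x s j) := by positivity
      linarith
    have h6 := h.grad_smul_nonneg (hx.x_nonneg h ⟨hx.nonneg, le_rfl⟩) j
    rw [mul_assoc]
    nlinarith

/-- The growth of `μ_j ln (1 + a d x_j)` pays for the growth of `y_t`. -/
lemma entry_mul_integral_le (hx : IsPrimalRun f A d t T x p) (h : Admissible f A d δ) (j : Fin n)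
    {a : ℝ} (ha : 0 < a) (hta : A t j ≤ a) {s : ℝ} (hs : s ∈ Icc 0 T) :
    A t j * (Real.log (1 + 2 * (d : ℝ) ^ 2) * ∫ σ in (0 : ℝ)..s, dualRate f d δ (x σ)) ≤
      grad f (δ • x s) j * Real.log (1 + a * d * x s j) -
        grad f (δ • x 0) j * Real.log (1 + a * d * x 0 j) := by
  have hd1 := h.one_le hx.entry
  have hd : (1 : ℝ) ≤ d := by exact_mod_cast hd1
  have had : 0 < a * d := by positivity
  have hsub : Icc 0 s ⊆ Icc 0 T := Icc_subset_Icc le_rfl hs.2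
  have hT0 : (0 : ℝ) ∈ Icc 0 T := ⟨le_rfl, hx.nonneg⟩
  have hpos : ∀ σ ∈ Icc 0 T, 1 ≤ 1 + a * d * x σ j := by
    intro σ hσ
    have : 0 ≤ x σ j := hx.x_nonneg h hσ j
    have : 0 ≤ a * d * x σ j := by positivity
    linarith
  -- Over `[σ, τ]` the increment of `μ_j ln(1 + a d x_j)` is at least `μ_j(σ)` times that of the
  -- logarithm, by monotonicity of `μ_j`. Concavity bounds the latter below by the slope at `τ`.
  -- Hence one factor of the weight is taken at each endpoint.
  have h1 := integral_sum_le_sub (ι := Unit) hs.1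
    (F := fun s => grad f (δ • x s) j * Real.log (1 + a * d * x s j))
    (p := fun _ σ => p σ j) (c := fun _ σ τ => grad f (δ • x σ) j * (a * d / (1 + a * d * x τ j)))
    (fun _ => intervalIntegrable_mono (hx.integrable j) hT0 hs)
    ((ae_restrict_Ioo_mono (hx.ae_rate_nonneg h) le_rfl hs.2).mono fun σ hσ _ => hσ j) ?_ ?_
  · refine le_trans ?_ h1
    rw [← mul_assoc, ← intervalIntegral.integral_const_mul]
    have hri := intervalIntegrable_mono (hx.intervalIntegrable_dualRate h) hT0 hs
    refine integral_mono_of_ae_Ioo hs.1 (hri.const_mul _) ?_ ?_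
    · refine intervalIntegrable_sum fun _ => ?_
      refine (intervalIntegrable_mono (hx.integrable j) hT0 hs).continuousOn_mul ?_
      rw [uIcc_of_le hs.1]
      refine ((hx.continuousOn_grad h δ j).mono hsub).mul (continuousOn_const.div ?_ ?_)
      · exact continuousOn_const.add (continuousOn_const.mul ((hx.continuousOn_apply j).mono hsub))
      · exact fun σ hσ => by linarith [hpos σ (hsub hσ)]
    · filter_upwards [ae_restrict_Ioo_mono hx.rate le_rfl hs.2,
        ae_restrict_Ioo_mono (hx.ae_rate_nonneg h) le_rfl hs.2,
        ae_restrict_mem measurableSet_Ioo] with σ hσ hσ0 hσm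
      have hσI := hsub (Ioo_subset_Icc_self hσm)
      have hx0 : 0 ≤ x σ j := hx.x_nonneg h hσI j
      have hμ := h.grad_smul_nonneg (hx.x_nonneg h hσI) j
      have hp := hpos σ hσI
      simp only [Finset.univ_unique, Finset.sum_const, Finset.card_singleton, one_smul]
      rcases (h.entry_nonneg t j).eq_or_lt with h3 | h3
      · rw [← h3, zero_mul, zero_mul]
        have := hσ0 j
        positivity
      · obtain ⟨h4, h5⟩ := (hσ j).2 h3
        have h6 := log_mul_dualRate_le h.diff h.mono h.pos (hx.x_nonneg h hσI) hd1 h4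
        calc A t j * Real.log (1 + 2 * (d : ℝ) ^ 2) * dualRate f d δ (x σ)
            ≤ A t j * (grad f (δ • x σ) j / grad f (x σ) j) := by
              rw [mul_assoc]
              exact mul_le_mul_of_nonneg_left h6 h3.le
          _ = grad f (δ • x σ) j * (A t j / grad f (x σ) j) := by ring
          _ ≤ grad f (δ • x σ) j * (a * d / (1 + a * d * x σ j) * p σ j) := by
              refine mul_le_mul_of_nonneg_left ?_ hμ
              rw [h5, div_mul_div_comm, div_le_div_iff₀ h4 (by positivity)]
              -- The summand `1/d` of the primal rate is tuned to the factor `d` in the logarithm: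
              -- what remains to be shown is `a_{tj} ≤ a`.
              have h7 : a * d * (A t j * x σ j + 1 / d) = a * d * x σ j * A t j + a := by
                field_simp
              rw [h7]
              nlinarith
          _ = _ := by ring
  · intro _
    refine ContinuousOn.mul ?_ (continuousOn_const.div ?_ ?_)
    · exact ((hx.continuousOn_grad h δ j).mono hsub).comp continuousOn_fst fun q hq => hq.1
    · refine continuousOn_const.add (continuousOn_const.mul ?_)
      exact ((hx.continuousOn_apply j).mono hsub).comp continuousOn_snd fun q hq => hq.2
    · exact fun q hq => by linarith [hpos q.2 (hsub hq.2)]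
  · intro σ hσ τ hτ hστ
    simp only [Finset.univ_unique, Finset.sum_const, Finset.card_singleton, one_smul]
    rw [← hx.sub_eq (hsub hσ) (hsub hτ)]
    have h2 : 1 + a * d * x σ j ≤ 1 + a * d * x τ j := by
      have := hx.monotoneOn h (hsub hσ) (hsub hτ) hστ j
      nlinarith
    have hp := hpos σ (hsub hσ)
    have h3 : a * d / (1 + a * d * x τ j) * (x τ j - x σ j) ≤
        Real.log (1 + a * d * x τ j) - Real.log (1 + a * d * x σ j) := by
      have h4 := Real.one_sub_inv_le_log_of_pos
        (x := (1 + a * d * x τ j) / (1 + a * d * x σ j)) (by apply div_pos <;> linarith)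
      rw [Real.log_div (by linarith) (by linarith)] at h4
      refine le_trans (le_of_eq ?_) h4
      rw [inv_div]
      have : 1 + a * d * x τ j ≠ 0 := by linarith
      field_simp
      ring
    have h5 := h.grad_smul_nonneg (hx.x_nonneg h (hsub hσ)) j
    have h6 : grad f (δ • x σ) j ≤ grad f (δ • x τ) j :=
      hx.monotoneOn_grad h (hsub hσ) (hsub hτ) hστ j
    have h7 := Real.log_nonneg (hpos τ (hsub hτ))
    have h8 := mul_le_mul_of_nonneg_left h3 h5
    have h9 := mul_le_mul_of_nonneg_right h6 h7
    linarith

/-- The exponential bound persists while `y_t` grows at most at the dual rate and the other dual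
variables do not grow. -/
lemma isExpBounded (hx : IsPrimalRun f A d t T x p) (h : Admissible f A d δ) {y₀ y : Fin m → ℝ}
    (h0 : IsExpBounded f A d δ (x 0) y₀) {s : ℝ} (hs : s ∈ Icc 0 T) (hy : ∀ i ≠ t, y i ≤ y₀ i)
    (hyt : y t ≤ y₀ t + ∫ σ in (0 : ℝ)..s, dualRate f d δ (x σ)) :
    IsExpBounded f A d δ (x s) y := by
  intro S j a ha hS
  have hd1 := h.one_le hx.entry
  have hL := log_pos_of_one_le hd1
  have hT0 : (0 : ℝ) ∈ Icc 0 T := ⟨le_rfl, hx.nonneg⟩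
  have h1 := h0 S j a ha hS
  by_cases ht : t ∈ S
  · have h2 := hx.entry_mul_integral_le h j ha (hS t ht) hs
    have h3 : ∑ i ∈ S, A i j * y i ≤ ∑ i ∈ S, A i j * y₀ i +
        A t j * ∫ σ in (0 : ℝ)..s, dualRate f d δ (x σ) := by
      rw [← Finset.add_sum_erase _ _ ht, ← Finset.add_sum_erase S (fun i => A i j * y₀ i) ht]
      have h4 := mul_le_mul_of_nonneg_left hyt (h.entry_nonneg t j)
      have h5 : ∑ i ∈ S.erase t, A i j * y i ≤ ∑ i ∈ S.erase t, A i j * y₀ i :=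
        Finset.sum_le_sum fun i hi =>
          mul_le_mul_of_nonneg_left (hy i (Finset.ne_of_mem_erase hi)) (h.entry_nonneg i j)
      linarith
    have h4 := mul_le_mul_of_nonneg_left h3 hL.le
    nlinarith
  · have h3 : ∑ i ∈ S, A i j * y i ≤ ∑ i ∈ S, A i j * y₀ i :=
      Finset.sum_le_sum fun i hi =>
        mul_le_mul_of_nonneg_left (hy i fun hit => ht (hit ▸ hi)) (h.entry_nonneg i j)
    refine (mul_le_mul_of_nonneg_left h3 hL.le).trans (h1.trans ?_)
    have hx0 : 0 ≤ x 0 j := hx.start j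
    have hxs : x 0 j ≤ x s j := hx.monotoneOn h hT0 hs hs.1 j
    have h5 : (0 : ℝ) ≤ a * d := by positivity
    refine mul_le_mul (hx.monotoneOn_grad h hT0 hs hs.1 j) ?_ ?_
      (h.grad_smul_nonneg (hx.x_nonneg h hs) j)
    · refine Real.log_le_log (by positivity) ?_
      nlinarith
    · refine Real.log_nonneg ?_
      have : 0 ≤ a * d * x 0 j := by positivity
      linarith

/-- The gradient cancels and leaves `a_{tj} x_j + 1/d` on the support of the row. That support has
between `1` and `d` columns, and the row is not more than satisfied. -/
lemma ae_sum_grad_mul_rate (hx : IsPrimalRun f A d t T x p) (h : Admissible f A d δ) :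
    ∀ᵐ s ∂volume.restrict (Ioo 0 T), 1 / (d : ℝ) ≤ ∑ j, grad f (x s) j * p s j ∧
      ∑ j, grad f (x s) j * p s j ≤ 2 := by
  have hd1 := h.one_le hx.entry
  have hd : (1 : ℝ) ≤ d := by exact_mod_cast hd1
  filter_upwards [hx.rate, ae_restrict_mem measurableSet_Ioo] with s hs hsm
  have hsI := Ioo_subset_Icc_self hsm
  have hAx : ∀ j, 0 ≤ A t j * x s j := fun j =>
    mul_nonneg (h.entry_nonneg t j) (hx.x_nonneg h hsI j)
  have h1 : ∀ j, grad f (x s) j * p s j =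
      A t j * x s j + if A t j ≠ 0 then 1 / (d : ℝ) else 0 := by
    intro j
    rcases (h.entry_nonneg t j).eq_or_lt with h3 | h3
    · rw [(hs j).1 h3.symm, ← h3]
      simp
    · obtain ⟨h4, h5⟩ := (hs j).2 h3
      rw [h5, mul_div_cancel₀ _ h4.ne', if_pos h3.ne']
  simp only [h1]
  constructor
  · obtain ⟨j, hj⟩ := hx.entry
    refine le_trans ?_ (Finset.single_le_sum (f := fun j => A t j * x s j +
      if A t j ≠ 0 then 1 / (d : ℝ) else 0) (fun j _ => ?_) (Finset.mem_univ j))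
    · rw [if_pos hj.ne']
      linarith [hAx j]
    · refine add_nonneg (hAx j) ?_
      split_ifs <;> positivity
  · rw [Finset.sum_add_distrib, ← Finset.sum_filter, Finset.sum_const, nsmul_eq_mul]
    have h2 := hx.below s hsI
    rw [dotProduct] at h2
    have h3 : ((Finset.univ.filter fun j => A t j ≠ 0).card : ℝ) ≤ d := by
      exact_mod_cast h.card_le t
    have h4 := mul_le_mul_of_nonneg_right h3 (by positivity : 0 ≤ 1 / (d : ℝ))
    rw [mul_one_div_cancel (by positivity)] at h4
    linarith

lemma intervalIntegrable_sum_grad_mul_rate (hx : IsPrimalRun f A d t T x p)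
    (h : Admissible f A d δ) :
    IntervalIntegrable (fun s => ∑ j, grad f (x s) j * p s j) volume 0 T := by
  refine intervalIntegrable_sum fun j => (hx.integrable j).continuousOn_mul ?_
  rw [uIcc_of_le hx.nonneg]
  simpa using hx.continuousOn_grad h 1 j

/-- An upper bound for increments of `f` comes from the gradient inequality at the right endpoint;
applying the growth lemma to `-f` turns it into a lower bound. -/
lemma sub_le_two_mul (hx : IsPrimalRun f A d t T x p) (h : Admissible f A d δ) :
    f (x T) - f (x 0) ≤ 2 * T := by
  have h1 := integral_sum_le_sub hx.nonneg (F := fun s => -f (x s)) (p := fun j σ => p σ j)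
    (c := fun j _ τ => -grad f (x τ) j) hx.integrable (hx.ae_rate_nonneg h) (fun j => ?_) ?_
  · have h2 := integral_mono_of_ae_Ioo hx.nonneg (hx.intervalIntegrable_sum_grad_mul_rate h)
      (intervalIntegrable_const (c := (2 : ℝ)))
      ((hx.ae_sum_grad_mul_rate h).mono fun σ hσ => hσ.2)
    simp only [neg_mul, Finset.sum_neg_distrib, intervalIntegral.integral_neg] at h1
    rw [intervalIntegral.integral_const, smul_eq_mul] at h2
    linarith
  · have := hx.continuousOn_grad h 1 j
    simp only [one_smul] at this
    exact (this.comp continuousOn_snd fun q hq => hq.2).neg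
  · intro σ hσ τ hτ _
    have h2 := grad_dotProduct_sub_le h.convex h.diff (x τ) (x σ)
    simp only [← hx.sub_eq hσ hτ]
    rw [dotProduct] at h2
    have h3 : ∑ j, -grad f (x τ) j * (x τ j - x σ j) =
        ∑ j, grad f (x τ) j * (x σ - x τ) j :=
      Finset.sum_congr rfl fun j _ => by rw [Pi.sub_apply]; ring
    rw [h3]
    linarith

/-- The counterpart, with the gradient at the left endpoint. It shows that a round of positive
length strictly raises `f`. -/
lemma div_le_sub (hx : IsPrimalRun f A d t T x p) (h : Admissible f A d δ) :
    T / d ≤ f (x T) - f (x 0) := by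
  have h1 := integral_sum_le_sub hx.nonneg (F := fun s => f (x s)) (p := fun j σ => p σ j)
    (c := fun j σ _ => grad f (x σ) j) hx.integrable (hx.ae_rate_nonneg h) (fun j => ?_) ?_
  · have h2 := integral_mono_of_ae_Ioo hx.nonneg (intervalIntegrable_const (c := 1 / (d : ℝ)))
      (hx.intervalIntegrable_sum_grad_mul_rate h)
      ((hx.ae_sum_grad_mul_rate h).mono fun σ hσ => hσ.1)
    rw [intervalIntegral.integral_const, smul_eq_mul, sub_zero, mul_one_div] at h2
    exact h2.trans h1
  · have := hx.continuousOn_grad h 1 j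
    simp only [one_smul] at this
    exact this.comp continuousOn_fst fun q hq => hq.1
  · intro σ hσ τ hτ _
    have h2 := grad_dotProduct_sub_le h.convex h.diff (x σ) (x τ)
    simp only [← hx.sub_eq hσ hτ]
    exact h2

end IsPrimalRun

lemma vecMul_apply (y : Fin m → ℝ) (A : Matrix (Fin m) (Fin n) ℝ) (j : Fin n) :
    (y ᵥ* A) j = ∑ i, y i * A i j := rfl

lemma sum_filter_pos_mul {y : Fin m → ℝ} (hy : 0 ≤ y) (j : Fin n) :
    ∑ i ∈ Finset.univ.filter (fun i => 0 < y i), A i j * y i = (y ᵥ* A) j := by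
  rw [Finset.sum_filter, vecMul_apply]
  refine Finset.sum_congr rfl fun i _ => ?_
  split_ifs with hi
  · exact mul_comm _ _
  · simp [le_antisymm (not_lt.1 hi) (hy i)]

/-- A tight column has a large primal variable. -/
lemma two_mul_le_of_tight (h : Admissible f A d δ) (hd : 1 ≤ d) {x : Fin n → ℝ} {y : Fin m → ℝ}
    (hx : 0 ≤ x) (hy : 0 ≤ y) (hb : IsExpBounded f A d δ x y) {j : Fin n} {i : Fin m}
    (hij : 0 < A i j) (hyi : 0 < y i) {a : ℝ} (htop : ∀ i', 0 < y i' → A i' j ≤ a)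
    (htight : (y ᵥ* A) j = grad f (δ • x) j) : 2 * d ≤ a * x j := by
  have hd' : (1 : ℝ) ≤ d := by exact_mod_cast hd
  have ha : 0 < a := hij.trans_le (htop i hyi)
  have h1 := hb (Finset.univ.filter fun i => 0 < y i) j a ha fun i' hi' =>
    htop i' (Finset.mem_filter.1 hi').2
  have h2 := sum_filter_pos_mul (A := A) hy j
  have h3 : 0 < (y ᵥ* A) j := by
    rw [← h2]
    refine lt_of_lt_of_le (mul_pos hij hyi) (Finset.single_le_sum (f := fun i => A i j * y i)
      (fun i _ => mul_nonneg (h.entry_nonneg i j) (hy i)) ?_)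
    simpa using hyi
  -- By tightness `μ_j` is the column load, which is positive and cancels. What is left is `ln(1 +
  -- 2d²) ≤ ln(1 + a d x_j)`, that is, `2d² ≤ a d x_j`.
  rw [h2, ← htight, mul_comm] at h1
  have h4 := le_of_mul_le_mul_left h1 h3
  have hxj : 0 ≤ x j := hx j
  rw [Real.log_le_log_iff (by positivity) (by positivity)] at h4
  have h5 : (d : ℝ) * (2 * d) ≤ d * (a * x j) := by nlinarith
  exact le_of_mul_le_mul_left h5 (by linarith)

end PrimalRun

/-! ### Dual runs, the invariants and the competitive ratio. -/

section Rounds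

variable {m n : ℕ} {f : (Fin n → ℝ) → ℝ} {A : Matrix (Fin m) (Fin n) ℝ} {d : ℕ} {δ : ℝ}
  {t : Fin m} {T : ℝ} {x p : ℝ → Fin n → ℝ}

/-- Regroups the decreases by column instead of by row. Weights `B = 1` give their effect on `∑
y_i`, and a column of `A` gives their effect on its load. -/
lemma sum_sum_ite_mul (top : Fin n → Fin m) (q : Fin n → ℝ) (B : Fin m → ℝ) :
    ∑ i, (∑ j, if top j = i then q j else 0) * B i = ∑ j, q j * B (top j) := by
  simp_rw [Finset.sum_mul]
  rw [Finset.sum_comm]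
  simp

/-- The trajectory `y` obeys the dual rule with velocity `w` along the primal run `x`. -/
structure IsDualRun {m n : ℕ} (f : (Fin n → ℝ) → ℝ) (A : Matrix (Fin m) (Fin n) ℝ) (d : ℕ) (δ : ℝ)
    (t : Fin m) (T : ℝ) (x : ℝ → Fin n → ℝ) (y w : ℝ → Fin m → ℝ) : Prop where
  start : DualFeasible A (y 0) (grad f (δ • x 0))
  integrable : ∀ i, IntervalIntegrable (fun s => w s i) volume 0 T
  eq : ∀ s ∈ Icc 0 T, ∀ i, y s i = y 0 i + ∫ σ in (0 : ℝ)..s, w σ i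
  rate : ∀ᵐ s ∂volume.restrict (Ioo 0 T), IsDualRate f A d δ t (x s) (y s) (w s)

namespace IsDualRun

variable {y w : ℝ → Fin m → ℝ}

/-- Only top rows are lowered, and these have `y_i > 0`; a negative variable would therefore not
decrease. -/
lemma y_nonneg (hy : IsDualRun f A d δ t T x y w) (hx : IsPrimalRun f A d t T x p)
    (h : Admissible f A d δ) {s : ℝ} (hs : s ∈ Icc 0 T) : 0 ≤ y s := by
  intro i
  have := le_barrier (u := fun s => -y s i) (w := fun s => -w s i) (M := fun _ => 0) one_pos
    (hy.integrable i).neg (fun s hs => ?_) (fun _ _ _ _ _ => le_rfl)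
    (by simpa using hy.start.1 i) ?_ s hs
  · simpa using this
  · simp only [intervalIntegral.integral_neg]
    rw [hy.eq s hs i]
    ring
  · filter_upwards [hy.rate, ae_restrict_mem measurableSet_Ioo] with σ hσ hσm h1 _
    obtain ⟨lam, top, hlam, -, -, htop, hv⟩ := hσ
    rw [neg_nonpos, hv, sub_nonneg]
    have h2 : (∑ j, if top j = i then
        lam j * (A t j / A (top j) j * dualRate f d δ (x σ)) else 0) = 0 := by
      refine Finset.sum_eq_zero fun j _ => ?_
      split_ifs with hj
      · rcases (hlam j).1.eq_or_lt with h3 | h3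
        · rw [← h3, zero_mul]
        · have h4 := (htop j h3).1
          rw [hj] at h4
          linarith
      · rfl
    rw [h2]
    split_ifs
    · exact hx.dualRate_nonneg h (Ioo_subset_Icc_self hσm)
    · exact le_rfl

lemma vecMul_eq (hy : IsDualRun f A d δ t T x y w) (j : Fin n) :
    IntervalIntegrable (fun s => (w s ᵥ* A) j) volume 0 T ∧
      ∀ s ∈ Icc 0 T, (y s ᵥ* A) j = (y 0 ᵥ* A) j + ∫ σ in (0 : ℝ)..s, (w σ ᵥ* A) j := by
  simp only [vecMul_apply]
  refine ⟨intervalIntegrable_sum fun i => (hy.integrable i).mul_const _, fun s hs => ?_⟩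
  rw [intervalIntegral.integral_finsetSum fun i _ => (intervalIntegrable_mono (hy.integrable i)
      ⟨le_rfl, hs.1.trans hs.2⟩ hs).mul_const _, ← Finset.sum_add_distrib]
  refine Finset.sum_congr rfl fun i _ => ?_
  rw [intervalIntegral.integral_mul_const, hy.eq s hs i]
  ring

/-- Above the constraint the intensity is `1`, so lowering `y_{m_j}` at rate `a_{tj} r / a_{m_j j}`
exactly cancels the contribution `a_{tj} r` of row `t`. The decreases made for other columns only
help, and `μ_j` does not fall. -/
lemma vecMul_le (hy : IsDualRun f A d δ t T x y w) (hx : IsPrimalRun f A d t T x p)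
    (h : Admissible f A d δ) {s : ℝ} (hs : s ∈ Icc 0 T) : y s ᵥ* A ≤ grad f (δ • x s) := by
  intro j
  refine le_barrier (u := fun s => (y s ᵥ* A) j) (w := fun s => (w s ᵥ* A) j)
    (M := fun s => grad f (δ • x s) j) one_pos (hy.vecMul_eq j).1 (hy.vecMul_eq j).2
    (fun a ha b hb hab => hx.monotoneOn_grad h ha hb hab j) (hy.start.2 j) ?_ s hs
  filter_upwards [hy.rate, ae_restrict_mem measurableSet_Ioo] with σ hσ hσm h1 _
  obtain ⟨lam, top, hlam, -, habove, htop, hv⟩ := hσ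
  have hr := hx.dualRate_nonneg h (Ioo_subset_Icc_self hσm)
  have h2 : (w σ ᵥ* A) j = dualRate f d δ (x σ) * A t j -
      ∑ j', lam j' * (A t j' / A (top j') j' * dualRate f d δ (x σ)) * A (top j') j := by
    rw [vecMul_apply, ← sum_sum_ite_mul top _ fun i => A i j]
    simp only [hv, sub_mul, Finset.sum_sub_distrib, ite_mul, zero_mul, Finset.sum_ite_eq',
      Finset.mem_univ, if_true]
  have h3 := habove j h1
  have h4 : 0 < A (top j) j := (htop j (by rw [h3]; exact one_pos)).2.1
  have h5 := Finset.single_le_sum (f := fun j' => lam j' *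
    (A t j' / A (top j') j' * dualRate f d δ (x σ)) * A (top j') j) (fun j' _ => ?_)
    (Finset.mem_univ j)
  · rw [h3, one_mul, div_mul_eq_mul_div, div_mul_cancel₀ _ h4.ne'] at h5
    rw [h2]
    linarith
  · exact mul_nonneg (mul_nonneg (hlam j').1 (mul_nonneg (div_nonneg (h.entry_nonneg _ _)
      (h.entry_nonneg _ _)) hr)) (h.entry_nonneg _ _)

lemma dualFeasible (hy : IsDualRun f A d δ t T x y w) (hx : IsPrimalRun f A d t T x p)
    (h : Admissible f A d δ) {s : ℝ} (hs : s ∈ Icc 0 T) :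
    DualFeasible A (y s) (grad f (δ • x s)) :=
  ⟨hy.y_nonneg hx h hs, hy.vecMul_le hx h hs⟩

lemma ae_rate_le (hy : IsDualRun f A d δ t T x y w) (hx : IsPrimalRun f A d t T x p)
    (h : Admissible f A d δ) : ∀ᵐ s ∂volume.restrict (Ioo 0 T), ∀ i,
      w s i ≤ if i = t then dualRate f d δ (x s) else 0 := by
  filter_upwards [hy.rate, ae_restrict_mem measurableSet_Ioo] with σ hσ hσm i
  obtain ⟨lam, top, hlam, -, -, -, hv⟩ := hσ
  have hr := hx.dualRate_nonneg h (Ioo_subset_Icc_self hσm)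
  rw [hv]
  refine sub_le_self _ (Finset.sum_nonneg fun j _ => ?_)
  split_ifs
  · exact mul_nonneg (hlam j).1 (mul_nonneg (div_nonneg (h.entry_nonneg _ _)
      (h.entry_nonneg _ _)) hr)
  · exact le_rfl

lemma le_start (hy : IsDualRun f A d δ t T x y w) (hx : IsPrimalRun f A d t T x p)
    (h : Admissible f A d δ) {s : ℝ} (hs : s ∈ Icc 0 T) {i : Fin m} (hi : i ≠ t) :
    y s i ≤ y 0 i := by
  rw [hy.eq s hs i]
  have h0 : (0 : ℝ) ∈ Icc 0 T := ⟨le_rfl, hx.nonneg⟩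
  have h1 := integral_mono_of_ae_Ioo (h := fun _ => 0) hs.1
    (intervalIntegrable_mono (hy.integrable i) h0 hs) intervalIntegrable_const
    ((ae_restrict_Ioo_mono (hy.ae_rate_le hx h) le_rfl hs.2).mono fun σ hσ => by
      have := hσ i
      rwa [if_neg hi] at this)
  rw [intervalIntegral.integral_const, smul_zero] at h1
  linarith

lemma current_le (hy : IsDualRun f A d δ t T x y w) (hx : IsPrimalRun f A d t T x p)
    (h : Admissible f A d δ) {s : ℝ} (hs : s ∈ Icc 0 T) :
    y s t ≤ y 0 t + ∫ σ in (0 : ℝ)..s, dualRate f d δ (x σ) := by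
  rw [hy.eq s hs t]
  have h0 : (0 : ℝ) ∈ Icc 0 T := ⟨le_rfl, hx.nonneg⟩
  have h1 := integral_mono_of_ae_Ioo hs.1 (intervalIntegrable_mono (hy.integrable t) h0 hs)
    (intervalIntegrable_mono (hx.intervalIntegrable_dualRate h) h0 hs)
    ((ae_restrict_Ioo_mono (hy.ae_rate_le hx h) le_rfl hs.2).mono fun σ hσ => by
      have := hσ t
      rwa [if_pos rfl] at this)
  linarith

lemma isExpBounded (hy : IsDualRun f A d δ t T x y w) (hx : IsPrimalRun f A d t T x p)
    (h : Admissible f A d δ) (h0 : IsExpBounded f A d δ (x 0) (y 0)) {s : ℝ} (hs : s ∈ Icc 0 T) :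
    IsExpBounded f A d δ (x s) (y s) :=
  hx.isExpBounded h h0 hs (fun _ hi => hy.le_start hx h hs hi) (hy.current_le hx h hs)

/-- The dual objective grows at least at half the dual rate. -/
lemma ae_half_dualRate_le (hy : IsDualRun f A d δ t T x y w) (hx : IsPrimalRun f A d t T x p)
    (h : Admissible f A d δ) (h0 : IsExpBounded f A d δ (x 0) (y 0)) :
    ∀ᵐ s ∂volume.restrict (Ioo 0 T), dualRate f d δ (x s) / 2 ≤ ∑ i, w s i := by
  have hd1 := h.one_le hx.entry
  have hd : (1 : ℝ) ≤ d := by exact_mod_cast hd1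
  filter_upwards [hy.rate, ae_restrict_mem measurableSet_Ioo] with s hs hsm
  have hsI := Ioo_subset_Icc_self hsm
  obtain ⟨lam, top, hlam, hslack, -, htop, hv⟩ := hs
  have hr := hx.dualRate_nonneg h hsI
  set r := dualRate f d δ (x s)
  have h1 : ∑ i, w s i = r - ∑ j, lam j * (A t j / A (top j) j * r) := by
    have h2 := sum_sum_ite_mul top (fun j => lam j * (A t j / A (top j) j * r)) fun _ => 1
    simp only [mul_one] at h2
    rw [← h2]
    simp only [hv, Finset.sum_sub_distrib, Finset.sum_ite_eq', Finset.mem_univ, if_true]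
  have h3 : ∀ j, lam j * (A t j / A (top j) j * r) ≤ A t j * x s j * (r / (2 * d)) := by
    intro j
    have hAx : 0 ≤ A t j * x s j := mul_nonneg (h.entry_nonneg t j) (hx.x_nonneg h hsI j)
    rcases (hlam j).1.eq_or_lt with h4 | h4
    · rw [← h4, zero_mul]
      positivity
    · obtain ⟨h5, h6, h7⟩ := htop j h4
      have h8 : (y s ᵥ* A) j = grad f (δ • x s) j := by
        refine le_antisymm (hy.vecMul_le hx h hsI j) (not_lt.1 fun h9 => ?_)
        exact h4.ne' (hslack j h9)
      have h9 := two_mul_le_of_tight h hd1 (hx.x_nonneg h hsI) (hy.y_nonneg hx h hsI)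
        (hy.isExpBounded hx h h0 hsI) h6 h5 h7 h8
      have h10 : 0 ≤ A t j / A (top j) j * r :=
        mul_nonneg (div_nonneg (h.entry_nonneg _ _) h6.le) hr
      have h11 : lam j * (A t j / A (top j) j * r) ≤ A t j / A (top j) j * r :=
        mul_le_of_le_one_left h10 (hlam j).2
      refine h11.trans ?_
      -- The bound `2d ≤ a_{m_j j} x_j` replaces `1 / a_{m_j j}` by `x_j / (2d)`; the bounds can
      -- then be summed over `j` using `∑_j a_{tj} x_j ≤ 1`.
      rw [div_mul_eq_mul_div, mul_div_assoc', div_le_div_iff₀ h6 (by positivity)]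
      have h12 : 0 ≤ A t j * r := mul_nonneg (h.entry_nonneg _ _) hr
      nlinarith [mul_le_mul_of_nonneg_left h9 h12]
  have h4 : ∑ j, lam j * (A t j / A (top j) j * r) ≤ r / 2 := by
    refine (Finset.sum_le_sum fun j _ => h3 j).trans ?_
    rw [← Finset.sum_mul]
    have h5 := hx.below s hsI
    rw [dotProduct] at h5
    refine (mul_le_of_le_one_left (by positivity) h5).trans ?_
    exact div_le_div_of_nonneg_left hr two_pos (by linarith)
  rw [h1]
  linarith

lemma mul_sub_le (hy : IsDualRun f A d δ t T x y w) (hx : IsPrimalRun f A d t T x p)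
    (h : Admissible f A d δ) (h0 : IsExpBounded f A d δ (x 0) (y 0)) {c : ℝ} (hc : 0 ≤ c)
    (hcle : ∀ z, 0 ≤ z →
      (c : EReal) ≤ gradRatio f δ z / ((4 * Real.log (1 + 2 * (d : ℝ) ^ 2) : ℝ) : EReal)) :
    c * (f (x T) - f (x 0)) ≤ ∑ i, y T i - ∑ i, y 0 i := by
  have hT : T ∈ Icc 0 T := ⟨hx.nonneg, le_rfl⟩
  have hL := log_pos_of_one_le (h.one_le hx.entry)
  have h1 : ∑ i, y T i - ∑ i, y 0 i = ∫ σ in (0 : ℝ)..T, ∑ i, w σ i := by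
    rw [intervalIntegral.integral_finsetSum fun i _ => hy.integrable i, ← Finset.sum_sub_distrib]
    refine Finset.sum_congr rfl fun i _ => ?_
    rw [hy.eq T hT i]
    ring
  -- The `4` splits as `2 · 2`: half the dual rate is the gradient ratio over `2L`, hence at least
  -- `2c`, and `f` grows by at most `2T`.
  have h2 := integral_mono_of_ae_Ioo (g := fun _ => 2 * c) hx.nonneg intervalIntegrable_const
    (intervalIntegrable_sum hy.integrable) ?_
  · rw [intervalIntegral.integral_const, smul_eq_mul, sub_zero] at h2
    have h3 := mul_le_mul_of_nonneg_left (hx.sub_le_two_mul h) hc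
    rw [h1]
    linarith
  · filter_upwards [hy.ae_half_dualRate_le hx h h0, hx.rate, ae_restrict_mem measurableSet_Ioo]
      with s hs hs' hsm
    have hx0 := hx.x_nonneg h (Ioo_subset_Icc_self hsm)
    obtain ⟨j, hj⟩ := hx.entry
    refine le_trans ?_ hs
    have h3 := hcle _ hx0
    rw [← coe_toReal_gradRatio h.diff h.mono h.pos hx0 ((hs' j).2 hj).1, ← EReal.coe_div,
      EReal.coe_le_coe_iff, le_div_iff₀ (by positivity)] at h3
    rw [dualRate, div_div, le_div_iff₀ (by positivity)]
    linarith

end IsDualRun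

/-- The invariants of the algorithm. -/
structure Invariant {m n : ℕ} (f : (Fin n → ℝ) → ℝ) (A : Matrix (Fin m) (Fin n) ℝ) (d : ℕ)
    (δ : ℝ) (k : ℕ) (x : Fin n → ℝ) (y : Fin m → ℝ) : Prop where
  nonneg : 0 ≤ x
  satisfied : ∀ i : Fin m, (i : ℕ) < k → 1 ≤ A i ⬝ᵥ x
  eq_zero : ∀ i : Fin m, k ≤ (i : ℕ) → y i = 0
  feasible : DualFeasible A y (grad f (δ • x))
  expBounded : IsExpBounded f A d δ x y
  eq_zero_of_value : f 0 = 0 → f x = 0 → x = 0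
  ratio : f 0 = 0 → ∀ c : ℝ, 0 ≤ c → (∀ z, 0 ≤ z →
    (c : EReal) ≤ gradRatio f δ z / ((4 * Real.log (1 + 2 * (d : ℝ) ^ 2) : ℝ) : EReal)) →
    c * f x ≤ ∑ i, y i

lemma invariant_zero (h : Admissible f A d δ) : Invariant f A d δ 0 0 0 where
  nonneg := le_rfl
  satisfied i hi := absurd hi (Nat.not_lt_zero _)
  eq_zero _ _ := rfl
  feasible := ⟨le_rfl, fun j => by
    rw [Matrix.zero_vecMul]
    exact h.grad_smul_nonneg le_rfl j⟩
  expBounded S j a _ _ := by simp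
  eq_zero_of_value _ _ := rfl
  ratio h0 c _ _ := by simp [h0]

/-- Positive length is essential: then continuity gives `A t ⬝ᵥ x ≤ 1` up to the final time, whereas
a round of length `0` may start with the row over-satisfied. The row has a positive entry because it
ends up satisfied. -/
lemma IsRound.exists_runs {y : ℝ → Fin m → ℝ} (hr : IsRound f A d δ t T x y)
    (h : Admissible f A d δ) (hx0 : 0 ≤ x 0) (hy0 : DualFeasible A (y 0) (grad f (δ • x 0)))
    (hT : 0 < T) :
    ∃ p w, IsPrimalRun f A d t T x p ∧ IsDualRun f A d δ t T x y w := by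
  obtain ⟨p, hp1, hp2, hp3⟩ := hr.primal
  obtain ⟨w, hw1, hw2, hw3⟩ := hr.dual
  have hcont : ContinuousOn (fun s => A t ⬝ᵥ x s) (Icc 0 T) := by
    refine continuousOn_finsetSum _ fun j _ => continuousOn_const.mul ?_
    refine ContinuousOn.congr ?_ fun s hs => hp2 s hs j
    exact continuousOn_const.add (continuousOn_primitive_Icc hr.nonneg (hp1 j))
  have hbelow := le_of_continuousOn_of_Ico hT hcont hr.unsatisfied
  have hentry : ∃ j, 0 < A t j := by
    by_contra! hle
    have h1 : A t ⬝ᵥ x T = 0 :=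
      Finset.sum_eq_zero fun j _ => by rw [le_antisymm (hle j) (h.entry_nonneg t j), zero_mul]
    linarith [hr.satisfied]
  exact ⟨p, w, ⟨hr.nonneg, hx0, hentry, hp1, hp2, hp3, hbelow⟩, ⟨hy0, hw1, hw2, hw3⟩⟩

lemma Invariant.step (h : Admissible f A d δ) {k : ℕ} (hk : k < m) {y : ℝ → Fin m → ℝ}
    (hinv : Invariant f A d δ k (x 0) (y 0)) (hr : IsRound f A d δ ⟨k, hk⟩ T x y) :
    Invariant f A d δ (k + 1) (x T) (y T) := by
  rcases hr.nonneg.eq_or_lt with rfl | hT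
  · refine { hinv with
      satisfied := fun i hi => ?_
      eq_zero := fun i hi => hinv.eq_zero i (by omega) }
    rcases Nat.lt_succ_iff_lt_or_eq.1 hi with h1 | h1
    · exact hinv.satisfied i h1
    · obtain rfl : i = ⟨k, hk⟩ := Fin.ext h1
      exact hr.satisfied
  · obtain ⟨p, w, hx, hy⟩ := hr.exists_runs h hinv.nonneg hinv.feasible hT
    have h0I : (0 : ℝ) ∈ Icc 0 T := ⟨le_rfl, hT.le⟩
    have hTI : T ∈ Icc 0 T := ⟨hT.le, le_rfl⟩
    have hmono := hx.monotoneOn h h0I hTI hT.le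
    have hd : (1 : ℝ) ≤ d := by exact_mod_cast h.one_le hx.entry
    -- Together with `f ≥ 0` this gives `f (x T) > 0` after a round of positive length, so `f x = 0`
    -- is possible only while `x` has never moved.
    have hval := hx.div_le_sub h
    have hval0 := h.nonneg _ hinv.nonneg
    have hTd : 0 < T / d := div_pos hT (by linarith)
    refine ⟨hx.x_nonneg h hTI, fun i hi => ?_, fun i hi => ?_, hy.dualFeasible hx h hTI,
      hy.isExpBounded hx h hinv.expBounded hTI, fun _ h1 => ?_, fun h1 c hc hcle => ?_⟩
    · rcases Nat.lt_succ_iff_lt_or_eq.1 hi with h1 | h1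
      · refine (hinv.satisfied i h1).trans (Finset.sum_le_sum fun j _ => ?_)
        exact mul_le_mul_of_nonneg_left (hmono j) (h.entry_nonneg i j)
      · obtain rfl : i = ⟨k, hk⟩ := Fin.ext h1
        exact hr.satisfied
    · refine le_antisymm ?_ (hy.y_nonneg hx h hTI i)
      refine le_trans ?_ (hinv.eq_zero i (by omega)).le
      refine hy.le_start hx h hTI fun h1 => ?_
      rw [h1] at hi
      simp at hi
    · linarith
    · have h2 := hinv.ratio h1 c hc hcle
      have h3 := hy.mul_sub_le hx h hinv.expBounded hc hcle
      linarith

lemma Reachable.invariant (h : Admissible f A d δ) {k : ℕ} {x : Fin n → ℝ} {y : Fin m → ℝ}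
    (hr : Reachable f A d δ k x y) : Invariant f A d δ k x y := by
  induction hr with
  | start => exact invariant_zero h
  | step hk _ hr ih => exact ih.step h hk hr

/-- When `f x > 0`, the infimum is at most `∑ y_i / f x` and the supremum at least its term at `z =
x`; by the Fenchel equality the difference times `f x` is the dual objective. When `f x = 0`, then
`x = 0` and the claim is `0 ≤ ∑ y_i`, whatever the bracket is. -/
lemma Invariant.competitiveRatio_mul_le (h : Admissible f A d δ) {k : ℕ} {x : Fin n → ℝ}
    {y : Fin m → ℝ} (hinv : Invariant f A d δ k x y) (h0 : f 0 = 0) :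
    competitiveRatio f d δ * ((f x : ℝ) : EReal) ≤ dualObjective f y (grad f (δ • x)) := by
  rw [dualObjective, fenchel_grad h.convex h.diff, ← EReal.coe_sub]
  rcases (h.nonneg _ hinv.nonneg).eq_or_lt with hfx | hfx
  · have hx : x = 0 := hinv.eq_zero_of_value h0 hfx.symm
    rw [← hfx, EReal.coe_zero, mul_zero, ← EReal.coe_zero, EReal.coe_le_coe_iff, hx]
    have := Finset.sum_nonneg fun i (_ : i ∈ Finset.univ) => hinv.feasible.1 i
    simpa [h0] using this
  · have hsum : 0 ≤ ∑ i, y i := Finset.sum_nonneg fun i _ => hinv.feasible.1 i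
    have h1 : (⨅ z : Fin n → ℝ, ⨅ _ : 0 ≤ z,
        gradRatio f δ z / ((4 * Real.log (1 + 2 * (d : ℝ) ^ 2) : ℝ) : EReal))
        ≤ (((∑ i, y i) / f x : ℝ) : EReal) := by
      -- The infimum may be `⊤`, so the invariant `ratio` is stated for real constants `c` and
      -- applied to one strictly in between.
      by_contra! hlt
      obtain ⟨c, hc1, hc2⟩ := EReal.lt_iff_exists_real_btwn.1 hlt
      rw [EReal.coe_lt_coe_iff] at hc1
      have := hinv.ratio h0 c ((div_nonneg hsum hfx.le).trans hc1.le) fun z hz =>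
        hc2.le.trans (iInf₂_le z hz)
      rw [div_lt_iff₀ hfx] at hc1
      linarith
    have h2 : ((((δ • x) ⬝ᵥ grad f (δ • x) - f (δ • x)) / f x : ℝ) : EReal) ≤
        ⨆ z : Fin n → ℝ, ⨆ _ : 0 ≤ z, ⨆ _ : 0 < f z,
          ((((δ • z) ⬝ᵥ grad f (δ • z) - f (δ • z)) / f z : ℝ) : EReal) :=
      le_trans (le_iSup₂_of_le (f := fun (_ : 0 ≤ x) (_ : 0 < f x) =>
        ((((δ • x) ⬝ᵥ grad f (δ • x) - f (δ • x)) / f x : ℝ) : EReal)) hinv.nonneg hfx le_rfl)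
        (le_iSup (fun z : Fin n → ℝ => ⨆ _ : 0 ≤ z, ⨆ _ : 0 < f z,
          ((((δ • z) ⬝ᵥ grad f (δ • z) - f (δ • z)) / f z : ℝ) : EReal)) x)
    have h3 := EReal.sub_le_sub h1 h2
    rw [← EReal.coe_sub] at h3
    refine (mul_le_mul_of_nonneg_right h3 (EReal.coe_nonneg.2 hfx.le)).trans ?_
    rw [← EReal.coe_mul, EReal.coe_le_coe_iff, sub_mul, div_mul_cancel₀ _ hfx.ne',
      div_mul_cancel₀ _ hfx.ne']

end Rounds

/-! ### Peano's existence theorem. -/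

section Peano

lemma aestronglyMeasurable_comp {E : Type*} [NormedAddCommGroup E] {b : ℝ} {F : ℝ → E → E}
    (hF : ContinuousOn (fun q : ℝ × E => F q.1 q.2) (Ioc 0 b ×ˢ univ))
    {u : ℝ → E} (hu : Continuous u) :
    AEStronglyMeasurable (fun s => F s (u s)) (volume.restrict (Ioc 0 b)) := by
  refine ContinuousOn.aestronglyMeasurable ?_ measurableSet_Ioc
  exact hF.comp (f := fun s => (s, u s)) (by fun_prop) fun s hs => ⟨hs, mem_univ _⟩

/-- Peano's theorem for a bounded field that is continuous except at the initial time. -/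
lemma exists_integral_solution {E : Type*} [NormedAddCommGroup E] [NormedSpace ℝ E]
    [FiniteDimensional ℝ E] {b C : ℝ} (hb : 0 ≤ b) {F : ℝ → E → E}
    (hF : ContinuousOn (fun q : ℝ × E => F q.1 q.2) (Ioc 0 b ×ˢ univ))
    (hC : ∀ s ∈ Ioc 0 b, ∀ w, ‖F s w‖ ≤ C) (w₀ : E) :
    ∃ u : ℝ → E, Continuous u ∧ IntervalIntegrable (fun s => F s (u s)) volume 0 b ∧
      ∀ s ∈ Icc 0 b, u s = w₀ + ∫ σ in (0 : ℝ)..s, F σ (u σ) := by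
  have : ProperSpace E := FiniteDimensional.proper ℝ E
  have : CompleteSpace E := FiniteDimensional.complete ℝ E
  set C' := max C 0 with hC'
  have hint : ∀ u : ℝ → E, Continuous u → IntervalIntegrable (fun s => F s (u s)) volume 0 b := by
    intro u hu
    rw [intervalIntegrable_iff_integrableOn_Ioc_of_le hb]
    refine Integrable.mono' (integrable_const C) (aestronglyMeasurable_comp hF hu) ?_
    exact (ae_restrict_iff' measurableSet_Ioc).2 (Eventually.of_forall fun s hs => hC s hs _)
  have hmono : ∀ u : ℝ → E, Continuous u → ∀ s ∈ Icc 0 b, ∀ t ∈ Icc 0 b,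
      IntervalIntegrable (fun s => F s (u s)) volume s t := by
    intro u hu s hs t ht
    refine (hint u hu).mono_set ?_
    rw [uIcc_of_le hb]
    exact uIcc_subset_Icc hs ht
  set ext : C(Icc 0 b, E) → ℝ → E := fun u => IccExtend hb u with hext
  have hextc : ∀ u, Continuous (ext u) := fun u => u.continuous.Icc_extend'
  have hprim : ∀ u : ℝ → E, Continuous u → ∀ s ∈ Icc 0 b, ∀ t ∈ Icc 0 b,
      dist (∫ σ in (0 : ℝ)..s, F σ (u σ)) (∫ σ in (0 : ℝ)..t, F σ (u σ)) ≤ |C' * s - C' * t| := by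
    intro u hu s hs t ht
    rw [dist_eq_norm, intervalIntegral.integral_interval_sub_left
      (hmono u hu 0 ⟨le_rfl, hb⟩ s hs) (hmono u hu 0 ⟨le_rfl, hb⟩ t ht), ← mul_sub, abs_mul,
      abs_of_nonneg (le_max_right C 0)]
    refine intervalIntegral.norm_integral_le_of_norm_le_const fun σ hσ => ?_
    refine (hC σ ?_ _).trans (le_max_left _ _)
    exact ⟨lt_of_le_of_lt (le_min ht.1 hs.1) hσ.1, hσ.2.trans (max_le ht.2 hs.2)⟩
  have hcont : ∀ u : C(Icc 0 b, E),
      Continuous fun s : Icc 0 b => w₀ + ∫ σ in (0 : ℝ)..s, F σ (ext u σ) := by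
    intro u
    refine continuous_const.add ?_
    have h1 := intervalIntegral.continuousOn_primitive_interval' (hint _ (hextc u)) left_mem_uIcc
    rw [uIcc_of_le hb] at h1
    exact continuousOn_iff_continuous_domRestrict.1 h1
  set Φ : C(Icc 0 b, E) → C(Icc 0 b, E) := fun u => ⟨_, hcont u⟩
  have hΦapp : ∀ u (s : Icc 0 b), Φ u s = w₀ + ∫ σ in (0 : ℝ)..s, F σ (ext u σ) := fun _ _ => rfl
  have hΦc : Continuous Φ := by
    refine continuous_iff_continuousAt.2 fun u => tendsto_iff_dist_tendsto_zero.2 ?_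
    -- Dominated convergence with the bound `2C`: the lack of continuity at time `0` does not matter
    -- to the integral, and the estimate is uniform in the upper limit.
    have h1 : Tendsto (fun v : C(Icc 0 b, E) => ∫ σ in (0 : ℝ)..b, ‖F σ (ext v σ) - F σ (ext u σ)‖)
        (𝓝 u) (𝓝 (∫ _ in (0 : ℝ)..b, (0 : ℝ))) := by
      refine intervalIntegral.tendsto_integral_filter_of_dominated_convergence (fun _ => 2 * C) ?_
        ?_ intervalIntegrable_const ?_
      · refine Eventually.of_forall fun v => ?_
        rw [uIoc_of_le hb]
        exact ((aestronglyMeasurable_comp hF (hextc v)).sub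
          (aestronglyMeasurable_comp hF (hextc u))).norm
      · refine Eventually.of_forall fun v => Eventually.of_forall fun s hs => ?_
        rw [uIoc_of_le hb] at hs
        rw [norm_norm]
        refine (norm_sub_le _ _).trans ?_
        linarith [hC s hs (ext v s), hC s hs (ext u s)]
      · refine Eventually.of_forall fun s hs => ?_
        rw [uIoc_of_le hb] at hs
        rw [← tendsto_iff_norm_sub_tendsto_zero]
        have h2 : ContinuousWithinAt (fun q : ℝ × E => F q.1 q.2) (Ioc 0 b ×ˢ univ)
            (s, ext u s) := hF _ ⟨hs, mem_univ _⟩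
        refine Tendsto.comp (f := fun v : C(Icc 0 b, E) => (s, ext v s)) h2 ?_
        refine tendsto_nhdsWithin_iff.2 ⟨?_, Eventually.of_forall fun v => ⟨hs, mem_univ _⟩⟩
        refine Tendsto.prodMk_nhds tendsto_const_nhds ?_
        exact (continuous_eval_const (projIcc 0 b hb s)).tendsto u
    rw [intervalIntegral.integral_zero] at h1
    refine squeeze_zero (fun _ => dist_nonneg) (fun v => ?_) h1
    have hni : IntervalIntegrable (fun σ => ‖F σ (ext v σ) - F σ (ext u σ)‖) volume 0 b :=
      ((hint _ (hextc v)).sub (hint _ (hextc u))).norm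
    rw [ContinuousMap.dist_le (intervalIntegral.integral_nonneg hb fun _ _ => norm_nonneg _)]
    intro s
    have h0 : (0 : ℝ) ∈ Icc 0 b := ⟨le_rfl, hb⟩
    rw [hΦapp, hΦapp, dist_add_left, dist_eq_norm, ← intervalIntegral.integral_sub
      (hmono _ (hextc v) 0 h0 s s.2) (hmono _ (hextc u) 0 h0 s s.2)]
    refine (intervalIntegral.norm_integral_le_integral_norm s.2.1).trans ?_
    refine intervalIntegral.integral_mono_interval le_rfl s.2.1 s.2.2 ?_ hni
    exact Eventually.of_forall fun σ => norm_nonneg _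
  obtain ⟨u, hu⟩ := exists_fixedPoint_of_causal hb hΦc (e := w₀) (ρ := fun s => C' * s)
    (fun u v s huv => by
      rw [hΦapp, hΦapp]
      congr 1
      refine intervalIntegral.integral_congr fun σ hσ => ?_
      rw [uIcc_of_le s.2.1] at hσ
      have hσI : σ ∈ Icc 0 b := ⟨hσ.1, hσ.2.trans s.2.2⟩
      simp only [hext]
      rw [IccExtend_of_mem _ _ hσI, IccExtend_of_mem _ _ hσI, huv ⟨σ, hσI⟩ hσ.2])
    (fun u => by simp [hΦapp]) (by fun_prop)
    (fun u s t => by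
      rw [hΦapp, hΦapp, dist_add_left]
      exact hprim _ (hextc u) s s.2 t t.2)
  refine ⟨ext u, hextc u, hint _ (hextc u), fun s hs => ?_⟩
  rw [← hΦapp u ⟨s, hs⟩, hu]
  exact IccExtend_of_mem _ _ hs

end Peano

/-- A continuous, strictly increasing function of linear growth on `[0, ∞)` has a continuous
inverse. -/
lemma exists_continuous_inverse {g : ℝ → ℝ} (hg : Continuous g) (hmono : StrictMonoOn g (Ici 0))
    {c k : ℝ} (hc : 0 < c) (hlin : ∀ u, 0 ≤ u → c * u + k ≤ g u) :
    ∃ θ : ℝ → ℝ, Continuous θ ∧ Monotone θ ∧ (∀ u, 0 ≤ u → θ (g u) = u) ∧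
      ∀ w, g 0 ≤ w → g (θ w) = w := by
  -- To the left of `0` the function is continued by a line of slope `1`, which makes it a bijection
  -- of `ℝ`.
  set h : ℝ → ℝ := fun u => g (max u 0) + min u 0 with hh
  have hmono' : StrictMono h := by
    intro u v huv
    rcases lt_or_ge u 0 with hu | hu
    · have h1 : g (max u 0) ≤ g (max v 0) :=
        hmono.monotoneOn (mem_Ici.2 (le_max_right _ _)) (mem_Ici.2 (le_max_right _ _))
          (max_le_max huv.le le_rfl)
      have h2 : min u 0 < min v 0 := by
        rw [min_eq_left hu.le]
        exact lt_min huv hu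
      exact add_lt_add_of_le_of_lt h1 h2
    · have hv : 0 ≤ v := hu.trans huv.le
      simp only [hh, max_eq_left hu, max_eq_left hv, min_eq_right hu, min_eq_right hv]
      exact add_lt_add_left (hmono hu hv huv) _
  have hcont : Continuous h := by fun_prop
  have hsurj : Function.Surjective h := by
    refine hcont.surjective ?_ ?_
    · refine tendsto_atTop_mono' atTop (f₁ := fun u => c * u + k) ?_ ?_
      · filter_upwards [eventually_ge_atTop 0] with u hu
        simpa [hh, max_eq_left hu, min_eq_right hu] using hlin u hu
      · exact tendsto_atTop_add_const_right _ _ (tendsto_id.const_mul_atTop hc)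
    · refine tendsto_atBot_mono' atBot (f₁ := fun u => g 0 + u) ?_ ?_
      · filter_upwards [eventually_le_atBot 0] with u hu
        simp [hh, max_eq_right hu, min_eq_left hu]
      · exact tendsto_atBot_add_const_left _ _ tendsto_id
  set e := hmono'.orderIsoOfSurjective h hsurj
  have hval : ∀ u, 0 ≤ u → h u = g u := fun u hu => by simp [hh, hu]
  refine ⟨e.symm, e.symm.continuous, e.symm.monotone, fun u hu => ?_, fun w hw => ?_⟩
  · rw [← hval u hu]
    exact e.symm_apply_apply u
  · have h1 : h (e.symm w) = w := e.apply_symm_apply w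
    rw [← hval 0 le_rfl, ← h1] at hw
    rw [← hval _ (hmono'.le_iff_le.1 hw)]
    exact h1

/-! ### Existence of primal runs. -/

section PrimalExistence

variable {m n : ℕ} {f : (Fin n → ℝ) → ℝ} {A : Matrix (Fin m) (Fin n) ℝ} {d : ℕ} {δ : ℝ}
  {t : Fin m}

/-- The objective along a coordinate axis is invertible. -/
lemma exists_axis_inverse (h : Admissible f A d δ)
    (hpos : ∀ z, 0 ≤ z → ∀ ℓ, 0 < z ℓ → 0 < grad f z ℓ) (j : Fin n) :
    ∃ θ : ℝ → ℝ, Continuous θ ∧ Monotone θ ∧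
      (∀ u, 0 ≤ u → θ (f (u • Pi.single j 1)) = u) ∧
      (∀ w, f 0 ≤ w → f (θ w • Pi.single j 1) = w) ∧
      StrictMonoOn (fun u : ℝ => f (u • Pi.single j 1)) (Ici 0) := by
  have he : (0 : Fin n → ℝ) ≤ Pi.single j 1 := by simp [Pi.single_nonneg]
  have hder : ∀ u : ℝ, HasDerivAt (fun u : ℝ => f (u • Pi.single j 1))
      (grad f (u • Pi.single j 1) j) u := by
    intro u
    simpa using hasDerivAt_line h.diff 0 (Pi.single j 1) u
  have hcont : Continuous fun u : ℝ => f (u • Pi.single j 1) :=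
    continuous_iff_continuousAt.2 fun u => (hder u).continuousAt
  have hmono : StrictMonoOn (fun u : ℝ => f (u • Pi.single j 1)) (Ici 0) := by
    refine strictMonoOn_of_deriv_pos (convex_Ici 0) hcont.continuousOn fun u hu => ?_
    rw [interior_Ici, mem_Ioi] at hu
    rw [(hder u).deriv]
    exact hpos _ (smul_nonneg hu.le he) j (by simpa using hu)
  -- The linear lower bound is the tangent to `f` along the axis at `e_j`, whose slope is positive.
  obtain ⟨θ, h1, h2, h3, h4⟩ := exists_continuous_inverse (c := grad f (Pi.single j 1) j)
    (k := f (Pi.single j 1) - grad f (Pi.single j 1) j) hcont hmono (hpos _ he j (by simp))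
    fun u hu => by
      have := grad_dotProduct_sub_le h.convex h.diff (Pi.single j 1) (u • Pi.single j 1)
      rw [dotProduct_sub, dotProduct_smul, dotProduct_single_one, smul_eq_mul] at this
      linarith
  refine ⟨θ, h1, h2, h3, fun w hw => h4 w (by simpa using hw), hmono⟩

/-- The primal rule, started at an unsatisfied state, has a solution that satisfies the row after
finite time. -/
lemma exists_primalRun (h : Admissible f A d δ) (hrow : ∃ j, 0 < A t j)
    (hpos : ∀ z, 0 ≤ z → ∀ ℓ, 0 < z ℓ → 0 < grad f z ℓ) {x₀ : Fin n → ℝ} (hx₀ : 0 ≤ x₀)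
    (hlt : A t ⬝ᵥ x₀ < 1) :
    ∃ (T : ℝ) (x p : ℝ → Fin n → ℝ), 0 < T ∧ x 0 = x₀ ∧ IsPrimalRun f A d t T x p ∧
      (∀ s ∈ Ico 0 T, A t ⬝ᵥ x s < 1) ∧ 1 ≤ A t ⬝ᵥ x T := by
  have hd : (1 : ℝ) ≤ d := by exact_mod_cast h.one_le hrow
  have hd0 : (0 : ℝ) < d := by linarith
  have hA := h.entry_nonneg t
  have hApos : ∀ {j}, A t j ≠ 0 → 0 < A t j := fun {j} hj => (hA j).lt_of_ne' hj
  choose θ hθc hθm hθf hfθ hfmono using exists_axis_inverse h hpos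
  set C₀ := ∑ j, (A t j)⁻¹
  have hinv : ∀ j, (A t j)⁻¹ ≤ C₀ := fun j =>
    Finset.single_le_sum (f := fun j => (A t j)⁻¹) (fun j _ => inv_nonneg.2 (hA j))
      (Finset.mem_univ j)
  have hC₀pos : 0 < C₀ := by
    obtain ⟨j, hj⟩ := hrow
    exact (inv_pos.2 hj).trans_le (hinv j)
  -- An a priori upper bound for the trajectory. With the convention `0⁻¹ = 0`, `C₀` dominates every
  -- `1 / a_{tj}`, the largest value `x_j` can reach before the row is satisfied.
  set top : Fin n → ℝ := fun j => x₀ j + C₀ with htop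
  have htop0 : 0 ≤ top := fun j => add_nonneg (hx₀ j) hC₀pos.le
  set M := 1 + ∑ j, grad f top j with hM
  have hgrad0 : ∀ z, 0 ≤ z → ∀ j, 0 ≤ grad f z j := fun z hz => grad_nonneg h.diff h.mono hz
  have hgM : ∀ j, grad f top j ≤ M := by
    intro j
    have := Finset.single_le_sum (f := fun j => grad f top j)
      (fun j _ => hgrad0 top htop0 j) (Finset.mem_univ j)
    linarith
  have hMpos : 0 < M := by
    have := Finset.sum_nonneg fun j (_ : j ∈ Finset.univ) => hgrad0 top htop0 j
    linarith
  -- Below `top` the gradient is at most `M`, so each moving coordinate has speed at least `(1/d) /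
  -- M = κ`. After time `b = C₀ / κ` it has grown by `C₀` and the row is satisfied.
  set κ := 1 / (d * M) with hκ
  have hκpos : 0 < κ := by positivity
  set b := C₀ / κ
  have hbpos : 0 < b := by positivity
  have hκb : κ * b = C₀ := mul_div_cancel₀ _ hκpos.ne'
  -- The point encoded by `w`, truncated to the a priori bounds. The lower one, `x₀ j + κ s`, is
  -- positive for `s > 0` and keeps the gradient away from `0` after the initial time.
  set z : ℝ → (Fin n → ℝ) → Fin n → ℝ := fun s w j =>
    if A t j = 0 then x₀ j else max (x₀ j + κ * s) (min (θ j (w j)) (A t j)⁻¹) with hz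
  have hzge : ∀ s ∈ Ioc 0 b, ∀ w j, A t j ≠ 0 → x₀ j + κ * s ≤ z s w j := by
    intro s _ w j hj
    simp only [hz, if_neg hj]
    exact le_max_left _ _
  have hz0 : ∀ s ∈ Ioc 0 b, ∀ w, 0 ≤ z s w := by
    intro s hs w j
    by_cases hj : A t j = 0
    · simp only [hz, if_pos hj]
      exact hx₀ j
    · refine le_trans ?_ (hzge s hs w j hj)
      exact add_nonneg (hx₀ j) (mul_nonneg hκpos.le hs.1.le)
  have hzle : ∀ s ∈ Ioc 0 b, ∀ w, z s w ≤ top := by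
    intro s hs w j
    by_cases hj : A t j = 0
    · simp only [hz, if_pos hj, htop]
      linarith
    · simp only [hz, if_neg hj, htop]
      refine max_le ?_ ((min_le_right _ _).trans ((hinv j).trans ?_))
      · have := mul_le_mul_of_nonneg_left hs.2 hκpos.le
        linarith
      · linarith [show 0 ≤ x₀ j from hx₀ j]
  have hzpos : ∀ s ∈ Ioc 0 b, ∀ w j, A t j ≠ 0 → 0 < grad f (z s w) j := by
    intro s hs w j hj
    refine hpos _ (hz0 s hs w) j ((hzge s hs w j hj).trans_lt' ?_)
    exact add_pos_of_nonneg_of_pos (hx₀ j) (mul_pos hκpos hs.1)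
  set φ : Fin n → ℝ → ℝ := fun j u => grad f (u • Pi.single j 1) j
  have he : ∀ j, (0 : Fin n → ℝ) ≤ Pi.single j 1 := fun j => by simp [Pi.single_nonneg]
  have hφc : ∀ j, Continuous (φ j) := fun j =>
    (continuous_grad_apply h.convex h.diff j).comp (by fun_prop)
  have hφd : ∀ j u, HasDerivAt (fun u : ℝ => f (u • Pi.single j 1)) (φ j u) u := by
    intro j u
    simpa using hasDerivAt_line h.diff 0 (Pi.single j 1) u
  have hφ0 : ∀ j u, 0 ≤ u → 0 ≤ φ j u := fun j u hu =>
    hgrad0 _ (smul_nonneg hu (he j)) j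
  have hφm : ∀ j u v, 0 ≤ u → u ≤ v → φ j u ≤ φ j v := fun j u v hu huv =>
    h.grad_mono _ _ (smul_nonneg hu (he j)) (smul_le_smul_of_nonneg_right huv (he j)) j
  have hφle : ∀ j (z : Fin n → ℝ), 0 ≤ z → φ j (z j) ≤ grad f z j := by
    intro j z hz
    refine h.grad_mono _ _ (smul_nonneg (hz j) (he j)) (fun i => ?_) j
    by_cases hi : i = j
    · subst hi
      simp
    · simpa [Pi.single_apply, hi] using hz i
  -- The velocity of `u_j = f(x_j e_j)` is `φ_j(x_j)` times that of `x_j`. The quotient `φ_j(x_j) /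
  -- ∇_j f(x)` is at most `1` by monotonicity of the gradient, so the field stays bounded as `s →
  -- 0`.
  set F : ℝ → (Fin n → ℝ) → Fin n → ℝ := fun s w j =>
    if A t j = 0 then 0 else
      φ j (z s w j) * (A t j * z s w j + 1 / d) / grad f (z s w) j with hF
  have hFapp : ∀ s w j, A t j ≠ 0 →
      F s w j = φ j (z s w j) * (A t j * z s w j + 1 / d) / grad f (z s w) j := by
    intro s w j hj
    simp only [hF, if_neg hj]
  have hzc : Continuous fun q : ℝ × (Fin n → ℝ) => z q.1 q.2 := by
    refine continuous_pi fun j => ?_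
    by_cases hj : A t j = 0
    · simp only [hz, if_pos hj]
      exact continuous_const
    · simp only [hz, if_neg hj]
      have := hθc j
      fun_prop
  have hFc : ContinuousOn (fun q : ℝ × (Fin n → ℝ) => F q.1 q.2) (Ioc 0 b ×ˢ univ) := by
    refine continuousOn_pi.2 fun j => ?_
    by_cases hj : A t j = 0
    · simp only [hF, if_pos hj]
      exact continuousOn_const
    · simp only [hF, if_neg hj]
      have hzcj : Continuous fun q : ℝ × (Fin n → ℝ) => z q.1 q.2 j :=
        (continuous_apply j).comp hzc
      refine ContinuousOn.div ?_ ?_ fun q hq => (hzpos q.1 hq.1 q.2 j hj).ne'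
      · exact (((hφc j).comp hzcj).mul ((continuous_const.mul hzcj).add
          continuous_const)).continuousOn
      · exact ((continuous_grad_apply h.convex h.diff j).comp hzc).continuousOn
  have hFbound : ∀ s ∈ Ioc 0 b, ∀ w, ‖F s w‖ ≤ ∑ j, A t j * top j + 1 := by
    intro s hs w
    have hAtop : ∀ j, 0 ≤ A t j * top j := fun j => mul_nonneg (hA j) (htop0 j)
    have hsum : 0 ≤ ∑ j, A t j * top j := Finset.sum_nonneg fun j _ => hAtop j
    refine (pi_norm_le_iff_of_nonneg (by linarith)).2 fun j => ?_
    by_cases hj : A t j = 0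
    · simp only [hF, if_pos hj, norm_zero]
      linarith
    · have hg := hzpos s hs w j hj
      have hzj : 0 ≤ z s w j := hz0 s hs w j
      have h1 : 0 ≤ A t j * z s w j + 1 / (d : ℝ) :=
        add_nonneg (mul_nonneg (hA j) hzj) (by positivity)
      rw [hFapp s w j hj, Real.norm_of_nonneg
        (div_nonneg (mul_nonneg (hφ0 j _ hzj) h1) hg.le), div_le_iff₀ hg, mul_comm]
      refine mul_le_mul ?_ (hφle j _ (hz0 s hs w)) (hφ0 j _ hzj) (by linarith)
      have h2 : A t j * z s w j ≤ A t j * top j :=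
        mul_le_mul_of_nonneg_left (hzle s hs w j) (hA j)
      have h3 := Finset.single_le_sum (f := fun j => A t j * top j) (fun j _ => hAtop j)
        (Finset.mem_univ j)
      have h4 : 1 / (d : ℝ) ≤ 1 := (div_le_one hd0).2 hd
      linarith
  obtain ⟨u, huc, hui, hu⟩ := exists_integral_solution hbpos.le hFc hFbound
    (fun j => f (x₀ j • Pi.single j 1))
  have huij : ∀ j, IntervalIntegrable (fun σ => F σ (u σ) j) volume 0 b := by
    intro j
    rw [intervalIntegrable_iff] at hui ⊢
    exact Integrable.eval hui j
  have huj : ∀ s ∈ Icc 0 b, ∀ j,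
      u s j = f (x₀ j • Pi.single j 1) + ∫ σ in (0 : ℝ)..s, F σ (u σ) j := by
    intro s hs j
    have h1 : IntervalIntegrable (fun s => F s (u s)) volume 0 s := by
      refine hui.mono_set ?_
      rw [uIcc_of_le hbpos.le, uIcc_of_le hs.1]
      exact Icc_subset_Icc le_rfl hs.2
    have h2 := congrFun (hu s hs) j
    rw [Pi.add_apply] at h2
    rw [h2, ← ContinuousLinearMap.proj_apply (R := ℝ) (φ := fun _ : Fin n => ℝ) j
      (∫ σ in (0 : ℝ)..s, F σ (u σ)), ← ContinuousLinearMap.intervalIntegral_comp_comm _ h1]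
    rfl
  -- Comparison of velocities: `φ_j` is monotone and `z_j ≥ x₀ j + κ σ`, so `u_j` grows at least as
  -- fast as `f` along the axis point moving at speed `κ`.
  have hlow : ∀ s ∈ Icc 0 b, ∀ j, A t j ≠ 0 → f ((x₀ j + κ * s) • Pi.single j 1) ≤ u s j := by
    intro s hs j hj
    have hder : ∀ σ : ℝ, HasDerivAt (fun σ : ℝ => f ((x₀ j + κ * σ) • Pi.single j 1))
        (φ j (x₀ j + κ * σ) * κ) σ := fun σ =>
      HasDerivAt.comp (h₂ := fun u : ℝ => f (u • Pi.single j 1)) (h := fun σ => x₀ j + κ * σ) σ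
        (hφd j (x₀ j + κ * σ)) (by simpa using ((hasDerivAt_id σ).const_mul κ).const_add (x₀ j))
    have hcont : Continuous fun σ : ℝ => φ j (x₀ j + κ * σ) * κ := by
      have := hφc j
      fun_prop
    have h1 := intervalIntegral.integral_eq_sub_of_hasDerivAt (a := 0) (b := s)
      (fun σ _ => hder σ) (hcont.intervalIntegrable _ _)
    have h2 := integral_mono_of_ae_Ioo hs.1 (hcont.intervalIntegrable _ _)
      (intervalIntegrable_mono (huij j) ⟨le_rfl, hbpos.le⟩ hs) ?_
    · rw [huj s hs j]
      rw [mul_zero, add_zero] at h1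
      linarith
    · filter_upwards [ae_restrict_mem measurableSet_Ioo] with σ hσ
      have hσb : σ ∈ Ioc 0 b := ⟨hσ.1, hσ.2.le.trans hs.2⟩
      have hlo : 0 ≤ x₀ j + κ * σ := add_nonneg (hx₀ j) (mul_nonneg hκpos.le hσ.1.le)
      have hzj := hz0 σ hσb (u σ) j
      rw [hFapp _ _ _ hj, mul_div_assoc]
      refine mul_le_mul (hφm j _ _ hlo (hzge σ hσb _ j hj)) ?_ hκpos.le (hφ0 j _ hzj)
      rw [hκ, ← div_div]
      refine div_le_div₀ (add_nonneg (mul_nonneg (hA j) hzj) (by positivity)) ?_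
        (hzpos σ hσb _ j hj) ?_
      · exact le_add_of_nonneg_left (mul_nonneg (hA j) hzj)
      · exact (h.grad_mono _ _ (hz0 σ hσb _) (hzle σ hσb _) j).trans (hgM j)
  set x : ℝ → Fin n → ℝ := fun s j => if A t j = 0 then x₀ j else θ j (u s j) with hx
  have hxc : Continuous x := by
    refine continuous_pi fun j => ?_
    by_cases hj : A t j = 0
    · simp only [hx, if_pos hj]
      exact continuous_const
    · simp only [hx, if_neg hj]
      exact (hθc j).comp ((continuous_apply j).comp huc)
  have hxstart : x 0 = x₀ := by
    funext j
    by_cases hj : A t j = 0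
    · simp only [hx, if_pos hj]
    · simp only [hx, if_neg hj]
      rw [huj 0 ⟨le_rfl, hbpos.le⟩, intervalIntegral.integral_same, add_zero, hθf j _ (hx₀ j)]
  have hxlow : ∀ s ∈ Icc 0 b, ∀ j, A t j ≠ 0 → x₀ j + κ * s ≤ x s j := by
    intro s hs j hj
    simp only [hx, if_neg hj]
    rw [← hθf j (x₀ j + κ * s) (add_nonneg (hx₀ j) (mul_nonneg hκpos.le hs.1))]
    exact hθm j (hlow s hs j hj)
  have hx0 : ∀ s ∈ Icc 0 b, 0 ≤ x s := by
    intro s hs j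
    by_cases hj : A t j = 0
    · simp only [hx, if_pos hj]
      exact hx₀ j
    · exact (add_nonneg (hx₀ j) (mul_nonneg hκpos.le hs.1)).trans (hxlow s hs j hj)
  have hAx : Continuous fun s => A t ⬝ᵥ x s := by
    refine continuous_finsetSum _ fun j _ => continuous_const.mul ?_
    exact (continuous_apply j).comp hxc
  have hsingle : ∀ s ∈ Icc 0 b, ∀ j, A t j * x s j ≤ A t ⬝ᵥ x s := fun s hs j =>
    Finset.single_le_sum (f := fun j => A t j * x s j)
      (fun j _ => mul_nonneg (hA j) (hx0 s hs j)) (Finset.mem_univ j)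
  have hend : 1 ≤ A t ⬝ᵥ x b := by
    obtain ⟨j, hj⟩ := hrow
    have hbI : b ∈ Icc 0 b := ⟨hbpos.le, le_rfl⟩
    refine le_trans ?_ (hsingle b hbI j)
    have h1 := hxlow b hbI j hj.ne'
    rw [hκb] at h1
    have h2 : (A t j)⁻¹ ≤ x b j := by
      linarith [hinv j, show 0 ≤ x₀ j from hx₀ j]
    rwa [inv_le_iff_one_le_mul₀' hj] at h2
  obtain ⟨T, ⟨hTI, hT1⟩, hTmin⟩ := (isCompact_Icc.inter_right
    (isClosed_le continuous_const hAx)).exists_isLeast (⟨b, ⟨hbpos.le, le_rfl⟩, hend⟩ :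
      (Icc 0 b ∩ {s | 1 ≤ A t ⬝ᵥ x s}).Nonempty)
  have hunsat : ∀ s ∈ Ico 0 T, A t ⬝ᵥ x s < 1 := by
    intro s hs
    by_contra! hge
    exact absurd (hTmin ⟨⟨hs.1, hs.2.le.trans hTI.2⟩, hge⟩) (not_le.2 hs.2)
  have hT1 : 1 ≤ A t ⬝ᵥ x T := hT1
  have hTpos : 0 < T := by
    refine hTI.1.lt_of_ne fun h0 => ?_
    rw [← h0, hxstart] at hT1
    linarith
  -- Before `T` neither truncation is active: the lower bound has been proved, and `x_j < 1 /
  -- a_{tj}` since the row is unsatisfied.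
  have hzx : ∀ s ∈ Ioo 0 T, z s (u s) = x s := by
    intro s hs
    have hsb : s ∈ Icc 0 b := ⟨hs.1.le, hs.2.le.trans hTI.2⟩
    funext j
    by_cases hj : A t j = 0
    · simp only [hz, hx, if_pos hj]
    · have h1 := hxlow s hsb j hj
      have h2 := (hsingle s hsb j).trans_lt (hunsat s ⟨hs.1.le, hs.2⟩)
      rw [mul_comm, ← lt_div_iff₀ (hApos hj), one_div] at h2
      simp only [hx, if_neg hj] at h1 h2
      simp only [hz, hx, if_neg hj]
      rw [min_eq_left h2.le, max_eq_right h1]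
  set p : ℝ → Fin n → ℝ := fun s j =>
    if A t j = 0 then 0 else (A t j * x s j + 1 / d) / grad f (x s) j with hp
  have hxpos : ∀ s ∈ Ioo 0 T, ∀ j, A t j ≠ 0 → 0 < x s j := fun s hs j hj =>
    (add_pos_of_nonneg_of_pos (hx₀ j) (mul_pos hκpos hs.1)).trans_le
      (hxlow s ⟨hs.1.le, hs.2.le.trans hTI.2⟩ j hj)
  have hder : ∀ j, ∀ s ∈ Ioo 0 T, HasDerivAt (fun s => x s j) (p s j) s := by
    intro j s hs
    by_cases hj : A t j = 0
    · simp only [hx, hp, if_pos hj]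
      exact hasDerivAt_const _ _
    · have hsb : s ∈ Icc 0 b := ⟨hs.1.le, hs.2.le.trans hTI.2⟩
      have hsb' : s ∈ Ioc 0 b := ⟨hs.1, hsb.2⟩
      have hxs := hxpos s hs j hj
      have hφpos : 0 < φ j (x s j) := hpos _ (smul_nonneg hxs.le (he j)) j (by simpa using hxs)
      have hus : f 0 < u s j := by
        refine lt_of_lt_of_le ?_ (hlow s hsb j hj)
        have hgt := add_pos_of_nonneg_of_pos (hx₀ j) (mul_pos hκpos hs.1)
        have := hfmono j (mem_Ici.2 le_rfl) (mem_Ici.2 hgt.le) hgt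
        simpa using this
      have hxθ : x s j = θ j (u s j) := by simp only [hx, if_neg hj]
      have h1 : HasDerivAt (θ j) (φ j (x s j))⁻¹ (u s j) := by
        have h0 : HasDerivAt (fun u : ℝ => f (u • Pi.single j 1)) (φ j (x s j)) (θ j (u s j)) := by
          rw [← hxθ]
          exact hφd j (x s j)
        refine HasDerivAt.of_local_left_inverse (hθc j).continuousAt h0 hφpos.ne' ?_
        filter_upwards [lt_mem_nhds hus] with w hw
        exact hfθ j w hw.le
      have hFs : ContinuousOn (fun σ => F σ (u σ) j) (Ioc 0 b) :=
        ((continuousOn_pi.1 hFc j).comp (f := fun σ => (σ, u σ)) (by fun_prop)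
          fun σ hσ => ⟨hσ, mem_univ _⟩)
      have hnhds : Ioo 0 T ∈ 𝓝 s := Ioo_mem_nhds hs.1 hs.2
      have hsub : Ioo 0 T ⊆ Ioc 0 b := fun σ hσ => ⟨hσ.1, hσ.2.le.trans hTI.2⟩
      have h2 : HasDerivAt (fun s => u s j) (F s (u s) j) s := by
        have h3 := intervalIntegral.integral_hasDerivAt_right
          (intervalIntegrable_mono (huij j) ⟨le_rfl, hbpos.le⟩ hsb)
          ((hFs.mono hsub).stronglyMeasurableAtFilter isOpen_Ioo s hs)
          ((hFs.mono hsub).continuousAt hnhds)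
        refine (h3.const_add (f (x₀ j • Pi.single j 1))).congr_of_eventuallyEq ?_
        filter_upwards [hnhds] with σ hσ
        exact huj σ (Ioc_subset_Icc_self (hsub hσ)) j
      have h3 := h1.comp s h2
      have h4 : (fun s => x s j) = θ j ∘ fun s => u s j := by
        funext s
        simp only [hx, if_neg hj, Function.comp]
      rw [h4]
      refine h3.congr_deriv ?_
      rw [hFapp _ _ _ hj, hzx s hs]
      simp only [hp, if_neg hj]
      field_simp
  have hp0 : ∀ j, ∀ s ∈ Ioo 0 T, 0 ≤ p s j := by
    intro j s hs
    by_cases hj : A t j = 0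
    · simp only [hp, if_pos hj, le_refl]
    · simp only [hp, if_neg hj]
      have hxs := hx0 s ⟨hs.1.le, hs.2.le.trans hTI.2⟩
      exact div_nonneg (add_nonneg (mul_nonneg (hA j) (hxs j)) (by positivity))
        (hgrad0 _ hxs j)
  have hxcj : ∀ j, Continuous fun s => x s j := fun j => (continuous_apply j).comp hxc
  have hpi : ∀ j, IntervalIntegrable (fun s => p s j) volume 0 T := by
    intro j
    -- The velocity may blow up at time `0`. It is integrable as the non-negative derivative of a
    -- function continuous on the closed interval.
    refine intervalIntegral.intervalIntegrable_deriv_of_nonneg (g := fun s => x s j)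
      (hxcj j).continuousOn ?_ ?_
    · rw [min_eq_left hTpos.le, max_eq_right hTpos.le]
      exact hder j
    · rw [min_eq_left hTpos.le, max_eq_right hTpos.le]
      exact hp0 j
  refine ⟨T, x, p, hTpos, hxstart, ⟨hTpos.le, hxstart ▸ hx₀, hrow, hpi, fun s hs j => ?_, ?_,
    fun s hs => le_of_continuousOn_of_Ico hTpos hAx.continuousOn hunsat s hs⟩, hunsat, hT1⟩
  · rw [intervalIntegral.integral_eq_sub_of_hasDerivAt_of_le hs.1 (hxcj j).continuousOn
      (fun σ hσ => hder j σ ⟨hσ.1, hσ.2.trans_le hs.2⟩)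
      (intervalIntegrable_mono (hpi j) ⟨le_rfl, hTpos.le⟩ hs)]
    ring
  · filter_upwards [ae_restrict_mem measurableSet_Ioo] with s hs j
    refine ⟨fun hj => by simp only [hp, if_pos hj], fun hj => ⟨?_, ?_⟩⟩
    · exact hpos _ (hx0 s ⟨hs.1.le, hs.2.le.trans hTI.2⟩) j (hxpos s hs j hj.ne')
    · simp only [hp, if_neg hj.ne']

end PrimalExistence

/-! ### Existence of dual runs. -/

section DualExistence

variable {m n : ℕ} {f : (Fin n → ℝ) → ℝ} {A : Matrix (Fin m) (Fin n) ℝ} {d : ℕ} {δ : ℝ}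
  {t : Fin m} {T : ℝ} {x p : ℝ → Fin n → ℝ}

/-- A column in which the current row has the largest entry is not tight. -/
lemma IsPrimalRun.vecMul_lt_of_current_top (hx : IsPrimalRun f A d t T x p)
    (h : Admissible f A d δ) {s : ℝ} (hs : s ∈ Icc 0 T) {y : Fin m → ℝ} (hy : 0 ≤ y)
    (hb : IsExpBounded f A d δ (x s) y) {j : Fin n} (htop : ∀ i, 0 < y i → A i j ≤ A t j)
    (hpos : 0 < (y ᵥ* A) j) : (y ᵥ* A) j < grad f (δ • x s) j := by
  have hd1 := h.one_le hx.entry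
  have hd : (1 : ℝ) ≤ d := by exact_mod_cast hd1
  have hL := log_pos_of_one_le hd1
  have hμ := h.grad_smul_nonneg (hx.x_nonneg h hs) j
  have hAt : 0 < A t j := by
    by_contra! hle
    refine hpos.not_ge ?_
    rw [vecMul_apply]
    refine Finset.sum_nonpos fun i _ => ?_
    rcases (hy i).eq_or_lt with h1 | h1
    · rw [← h1, Pi.zero_apply, zero_mul]
    · exact mul_nonpos_of_nonneg_of_nonpos h1.le ((htop i h1).trans hle)
  have h1 := hb (Finset.univ.filter fun i => 0 < y i) j (A t j) hAt fun i hi =>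
    htop i (Finset.mem_filter.1 hi).2
  rw [sum_filter_pos_mul hy] at h1
  have hxj : 0 ≤ x s j := hx.x_nonneg h hs j
  -- During the round `a_{tj} x_j ≤ 1`, and `d < 2d²`.
  have h2 : Real.log (1 + A t j * d * x s j) < Real.log (1 + 2 * (d : ℝ) ^ 2) := by
    refine Real.log_lt_log (by positivity) ?_
    have := hx.entry_mul_le h hs j
    nlinarith
  have hμ0 : grad f (δ • x s) j ≠ 0 := by
    intro h0
    rw [h0, zero_mul] at h1
    exact h1.not_gt (mul_pos hL hpos)
  have h3 := mul_lt_mul_of_pos_left h2 (hμ.lt_of_ne' hμ0)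
  rw [mul_comm (grad f (δ • x s) j) (Real.log (1 + 2 * (d : ℝ) ^ 2))] at h3
  exact lt_of_mul_lt_mul_left (h1.trans_lt h3) hL.le

/-- The dual states that can occur at time `s` of a round started at `y₀`. -/
structure IsDualState {m n : ℕ} (f : (Fin n → ℝ) → ℝ) (A : Matrix (Fin m) (Fin n) ℝ) (d : ℕ)
    (δ : ℝ) (t : Fin m) (x : ℝ → Fin n → ℝ) (y₀ : Fin m → ℝ) (s : ℝ) (y : Fin m → ℝ) : Prop where
  nonneg : 0 ≤ y
  current : y t = ∫ σ in (0 : ℝ)..s, dualRate f d δ (x σ)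
  le_start : ∀ i ≠ t, y i ≤ y₀ i
  feasible : y ᵥ* A ≤ grad f (δ • x s)

/-- A phase of a round, during which the set of positive old dual variables does not change. -/
lemma IsPrimalRun.exists_phase (hx : IsPrimalRun f A d t T x p) (h : Admissible f A d δ)
    {y₀ : Fin m → ℝ} (h0 : IsExpBounded f A d δ (x 0) y₀) (hy₀t : y₀ t = 0) {a : ℝ}
    (ha : a ∈ Icc 0 T) {ya : Fin m → ℝ} (hya : IsDualState f A d δ t x y₀ a ya) :
    ∃ b ∈ Icc a T, ∃ w : ℝ → Fin m → ℝ, (∀ i, IntervalIntegrable (fun s => w s i) volume a b) ∧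
      (∀ᵐ s ∂volume.restrict (Ioo a b),
        IsDualRate f A d δ t (x s) (fun i => ya i + ∫ σ in a..s, w σ i) (w s)) ∧
      IsDualState f A d δ t x y₀ b (fun i => ya i + ∫ σ in a..b, w σ i) ∧
      (b = T ∨ (Finset.univ.filter fun i => i ≠ t ∧ 0 < ya i + ∫ σ in a..b, w σ i).card <
        (Finset.univ.filter fun i => i ≠ t ∧ 0 < ya i).card) := by
  classical
  set r : ℝ → ℝ := fun s => dualRate f d δ (x s) with hr
  have hTI : T ∈ Icc 0 T := ⟨hx.nonneg, le_rfl⟩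
  have hri : IntervalIntegrable r volume a T :=
    intervalIntegrable_mono (hx.intervalIntegrable_dualRate h) ha hTI
  have hr0 : ∀ s ∈ Icc a T, 0 ≤ r s := fun s hs =>
    hx.dualRate_nonneg h ⟨ha.1.trans hs.1, hs.2⟩
  have hr0' : ∀ᵐ s ∂volume.restrict (Ioo a T), 0 ≤ r s := by
    filter_upwards [ae_restrict_mem measurableSet_Ioo] with s hs
    exact hr0 s (Ioo_subset_Icc_self hs)
  have haI : ∀ {s}, s ∈ Icc a T → s ∈ Icc 0 T := fun hs => ⟨ha.1.trans hs.1, hs.2⟩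
  set P : Fin m → Prop := fun i => i ≠ t ∧ 0 < ya i
  -- Only these columns can need a decrease: if `a_{tj} = 0` the load does not grow, and if no
  -- positive old row meets the column then row `t` is its top row and it is never tight.
  set Act : Fin n → Prop := fun j => 0 < A t j ∧ ∃ i, P i ∧ 0 < A i j
  have hAnn := h.entry_nonneg
  have htop : ∀ j, ∃ i, Act j → P i ∧ 0 < A i j ∧ ∀ i', P i' → A i' j ≤ A i j := by
    intro j
    by_cases hj : Act j
    · obtain ⟨i, hi, hij⟩ := hj.2
      obtain ⟨i', hi', hmax⟩ := Finset.exists_max_image (Finset.univ.filter P) (fun i => A i j)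
        ⟨i, by simpa using hi⟩
      refine ⟨i', fun _ => ⟨by simpa using hi', hij.trans_le (hmax i (by simpa using hi)),
        fun k hk => hmax k (by simpa using hk)⟩⟩
    · exact ⟨t, fun h => absurd h hj⟩
  choose top htop using htop
  set β : Fin n → ℝ := fun j => if Act j then A t j / A (top j) j else 0 with hβ
  have hβ0 : ∀ j, 0 ≤ β j := by
    intro j
    simp only [hβ]
    split_ifs
    · exact div_nonneg (hAnn _ _) (hAnn _ _)
    · exact le_rfl
  -- The excess of column `j` without any decreases, in units of `a_{tj}`. In these units it grows
  -- at most at rate `r`, because `μ_j` does not decrease.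
  set g : Fin n → ℝ → ℝ := fun j s => if Act j then
    ((ya ᵥ* A) j + A t j * (∫ σ in a..s, r σ) - grad f (δ • x s) j) / A t j else 0 with hg
  -- The relief that a unit push for column `j'` brings to column `j`, in the same units. The push
  -- for `j` itself counts with coefficient `1` and is kept apart.
  set K : Fin n → Fin n → ℝ := fun j j' =>
    if Act j ∧ j' ≠ j then β j' * A (top j') j / A t j else 0 with hK
  have hK0 : ∀ j j', 0 ≤ K j j' := by
    intro j j'
    simp only [hK]
    split_ifs
    · exact div_nonneg (mul_nonneg (hβ0 _) (hAnn _ _)) (hAnn _ _)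
    · exact le_rfl
  have hgc : ∀ j, ContinuousOn (g j) (Icc a T) := by
    intro j
    by_cases hj : Act j
    · simp only [hg, if_pos hj]
      refine ContinuousOn.div_const (ContinuousOn.sub (continuousOn_const.add
        (continuousOn_const.mul (continuousOn_primitive_Icc ha.2 hri))) ?_) _
      exact (hx.continuousOn_grad h δ j).mono fun s hs => haI hs
    · simp only [hg, if_neg hj]
      exact continuousOn_const
  have hginc : ∀ j, ∀ s ∈ Icc a T, ∀ s' ∈ Icc a T, s ≤ s' → g j s' - g j s ≤ ∫ σ in s..s', r σ := by
    intro j s hs s' hs' hle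
    by_cases hj : Act j
    · simp only [hg, if_pos hj]
      rw [← integral_sub_primitive hri hs hs', ← sub_div, div_le_iff₀ hj.1]
      have := hx.monotoneOn_grad h (haI hs) (haI hs') hle j
      dsimp only at this
      linarith
    · simp only [hg, if_neg hj, sub_zero]
      exact intervalIntegral.integral_nonneg hle fun σ hσ =>
        hr0 σ ⟨hs.1.trans hσ.1, hσ.2.trans hs'.2⟩
  have hga : ∀ j, g j a ≤ 0 := by
    intro j
    by_cases hj : Act j
    · simp only [hg, if_pos hj, intervalIntegral.integral_same]
      refine div_nonpos_of_nonpos_of_nonneg ?_ hj.1.le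
      linarith [hya.feasible j]
    · simp only [hg, if_neg hj, le_refl]
  obtain ⟨l, hl01, hli, hlle, hlslack⟩ :=
    exists_reflection_intensity ha.2 hri hr0' hgc hginc hga hK0
  set D : Fin n → ℝ → ℝ := fun j s => ∫ σ in a..s, l j σ * r σ with hD
  have hD0 : ∀ j, ∀ s ∈ Icc a T, 0 ≤ D j s := fun j s hs =>
    intervalIntegral.integral_nonneg hs.1 fun σ hσ =>
      mul_nonneg (hl01 j σ).1 (hr0 σ ⟨hσ.1, hσ.2.trans hs.2⟩)
  set w : ℝ → Fin m → ℝ := fun s i => (if i = t then r s else 0) -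
    ∑ j, if top j = i then β j * (l j s * r s) else 0 with hw
  have hterm : ∀ i j, IntervalIntegrable
      (fun s => if top j = i then β j * (l j s * r s) else 0) volume a T := by
    intro i j
    split_ifs
    · exact (hli j).const_mul _
    · exact intervalIntegrable_const
  have hcur : ∀ i, IntervalIntegrable (fun s => if i = t then r s else 0) volume a T := by
    intro i
    split_ifs
    · exact hri
    · exact intervalIntegrable_const
  have hwi : ∀ i, IntervalIntegrable (fun s => w s i) volume a T := fun i =>
    (hcur i).sub (intervalIntegrable_sum (hterm i))
  set Y : ℝ → Fin m → ℝ := fun s i => ya i + ∫ σ in a..s, w σ i with hY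
  have hYeq : ∀ s ∈ Icc a T, ∀ i, Y s i = ya i + (if i = t then ∫ σ in a..s, r σ else 0) -
      ∑ j, if top j = i then β j * D j s else 0 := by
    intro s hs i
    have haT : a ∈ Icc a T := ⟨le_rfl, ha.2⟩
    simp only [hY, hw]
    rw [intervalIntegral.integral_sub (intervalIntegrable_mono (hcur i) haT hs)
      (intervalIntegrable_mono (intervalIntegrable_sum (hterm i)) haT hs),
      intervalIntegral.integral_finsetSum fun j _ => intervalIntegrable_mono (hterm i j) haT hs,
      add_sub_assoc]
    congr 2
    · split_ifs <;> simp
    · refine Finset.sum_congr rfl fun j _ => ?_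
      split_ifs
      · rw [intervalIntegral.integral_const_mul]
      · simp
  have hYa : Y a = ya := by
    funext i
    simp [hY]
  have hYc : ∀ i, ContinuousOn (fun s => Y s i) (Icc a T) := fun i =>
    continuousOn_const.add (continuousOn_primitive_Icc ha.2 (hwi i))
  have hYt : ∀ s ∈ Icc a T, Y s t = ∫ σ in (0 : ℝ)..s, r σ := by
    intro s hs
    have h1 : (∑ j, if top j = t then β j * D j s else 0) = 0 := by
      refine Finset.sum_eq_zero fun j _ => ?_
      split_ifs with hj
      · have hnot : ¬ Act j := fun hact => (htop j hact).1.1 hj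
        simp only [hβ, if_neg hnot, zero_mul]
      · rfl
    rw [hYeq s hs, h1, if_pos rfl, sub_zero, hya.current]
    have h2 := integral_sub_primitive (hx.intervalIntegrable_dualRate h) ha (haI hs)
    simp only [hr]
    linarith
  have hYle : ∀ s ∈ Icc a T, ∀ i ≠ t, Y s i ≤ ya i := by
    intro s hs i hi
    rw [hYeq s hs, if_neg hi, add_zero]
    refine sub_le_self _ (Finset.sum_nonneg fun j _ => ?_)
    split_ifs
    · exact mul_nonneg (hβ0 j) (hD0 j s hs)
    · exact le_rfl
  have hYzero : ∀ s ∈ Icc a T, ∀ i ≠ t, ¬ P i → Y s i = 0 := by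
    intro s hs i hi hPi
    have h1 : (∑ j, if top j = i then β j * D j s else 0) = 0 := by
      refine Finset.sum_eq_zero fun j _ => ?_
      split_ifs with hj
      · have hnot : ¬ Act j := fun hact => hPi (hj ▸ (htop j hact).1)
        simp only [hβ, if_neg hnot, zero_mul]
      · rfl
    have h2 : ya i = 0 := le_antisymm (not_lt.1 fun hlt => hPi ⟨hi, hlt⟩) (hya.nonneg i)
    rw [hYeq s hs, h1, if_neg hi, h2]
    ring
  have hYt0 : ∀ s ∈ Icc a T, 0 ≤ Y s t := by
    intro s hs
    rw [hYt s hs]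
    exact intervalIntegral.integral_nonneg (haI hs).1 fun σ hσ =>
      hx.dualRate_nonneg h ⟨hσ.1, hσ.2.trans hs.2⟩
  have hYexp : ∀ s ∈ Icc a T, IsExpBounded f A d δ (x s) (Y s) := by
    intro s hs
    refine hx.isExpBounded h h0 (haI hs)
      (fun i hi => (hYle s hs i hi).trans (hya.le_start i hi)) ?_
    rw [hYt s hs, hy₀t, zero_add]
  have hYact : ∀ s ∈ Icc a T, ∀ j, Act j → (Y s ᵥ* A) j - grad f (δ • x s) j =
      A t j * (g j s - (∑ j', K j j' * D j' s) - D j s) := by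
    intro s hs j hj
    have h1 : (Y s ᵥ* A) j = (ya ᵥ* A) j + A t j * (∫ σ in a..s, r σ) -
        ∑ j', β j' * D j' s * A (top j') j := by
      rw [vecMul_apply, vecMul_apply, ← sum_sum_ite_mul top _ fun i => A i j]
      simp only [hYeq s hs, sub_mul, add_mul, Finset.sum_sub_distrib, Finset.sum_add_distrib,
        ite_mul, zero_mul, Finset.sum_ite_eq', Finset.mem_univ, if_true]
      rw [mul_comm (A t j)]
    have h2 : ∑ j', β j' * D j' s * A (top j') j =
        A t j * ((∑ j', K j j' * D j' s) + D j s) := by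
      rw [← Finset.add_sum_erase _ _ (Finset.mem_univ j),
        ← Finset.add_sum_erase _ (fun j' => K j j' * D j' s) (Finset.mem_univ j), mul_add, mul_add,
        Finset.mul_sum]
      have h3 : β j * D j s * A (top j) j = A t j * D j s := by
        simp only [hβ, if_pos hj]
        have := (htop j hj).2.1
        field_simp
      have h4 : K j j = 0 := by simp [hK]
      rw [h3, h4, zero_mul, mul_zero, zero_add, add_comm]
      congr 1
      refine Finset.sum_congr rfl fun j' hj' => ?_
      simp only [hK, if_pos (And.intro hj (Finset.ne_of_mem_erase hj'))]
      have := hj.1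
      field_simp
    have h3 : A t j * g j s =
        (ya ᵥ* A) j + A t j * (∫ σ in a..s, r σ) - grad f (δ • x s) j := by
      simp only [hg, if_pos hj]
      exact mul_div_cancel₀ _ hj.1.ne'
    rw [h1, h2, mul_sub, mul_sub, h3]
    ring
  have hYpos_of : ∀ s ∈ Icc a T, ∀ i, i ≠ t → 0 < Y s i → P i := fun s hs i hi hlt =>
    ⟨hi, hlt.trans_le (hYle s hs i hi)⟩
  have hYfeas : ∀ s ∈ Icc a T, 0 ≤ Y s → Y s ᵥ* A ≤ grad f (δ • x s) := by
    intro s hs hs0 j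
    by_cases hj : Act j
    · have h1 := hYact s hs j hj
      have h2 := hlle j s hs
      have h3 : A t j * (g j s - (∑ j', K j j' * D j' s) - D j s) ≤ 0 :=
        mul_nonpos_of_nonneg_of_nonpos hj.1.le (by simp only [hD]; linarith)
      linarith
    -- For a column that is not pushed, either `a_{tj} = 0` and the load cannot grow, or row `t` has
    -- the largest entry among positive rows and the exponential bound keeps the column slack.
    · rcases (hAnn t j).eq_or_lt with htj | htj
      · have h1 : (Y s ᵥ* A) j ≤ (ya ᵥ* A) j := by
          rw [vecMul_apply, vecMul_apply]
          refine Finset.sum_le_sum fun i _ => ?_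
          by_cases hi : i = t
          · rw [hi, ← htj, mul_zero, mul_zero]
          · exact mul_le_mul_of_nonneg_right (hYle s hs i hi) (hAnn i j)
        exact h1.trans ((hya.feasible j).trans (hx.monotoneOn_grad h ha (haI hs) hs.1 j))
      · by_contra hgt
        have hgt := not_le.1 hgt
        have h1 := (h.grad_smul_nonneg (hx.x_nonneg h (haI hs)) j).trans_lt hgt
        refine hgt.not_gt (hx.vecMul_lt_of_current_top h (haI hs) hs0 (hYexp s hs) (fun i hi => ?_)
          h1)
        by_cases hit : i = t
        · rw [hit]
        · by_contra! hlt
          exact hj ⟨htj, i, hYpos_of s hs i hit hi, htj.trans hlt⟩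
  -- The phase ends when the first old variable reaches zero, or at `T`. Until then the chosen rows
  -- `top j` remain positive.
  obtain ⟨b, hb, hbpos, hbend⟩ : ∃ b ∈ Icc a T, (∀ s ∈ Ico a b, ∀ i, P i → 0 < Y s i) ∧
      ((b = T ∧ ∀ i, P i → 0 < Y b i) ∨ ∃ i, P i ∧ Y b i ≤ 0) := by
    by_cases hZ : ∃ s ∈ Icc a T, ∃ i, P i ∧ Y s i ≤ 0
    · have hclosed : IsClosed (⋃ i ∈ {i | P i}, Icc a T ∩ (fun s => Y s i) ⁻¹' Iic 0) :=
        Set.Finite.isClosed_biUnion (Set.toFinite _) fun i _ =>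
          (hYc i).preimage_isClosed_of_isClosed isClosed_Icc isClosed_Iic
      have hcomp : IsCompact (⋃ i ∈ {i | P i}, Icc a T ∩ (fun s => Y s i) ⁻¹' Iic 0) :=
        isCompact_Icc.of_isClosed_subset hclosed
          (iUnion₂_subset fun i _ => inter_subset_left)
      obtain ⟨s, hs, i, hi, hsi⟩ := hZ
      obtain ⟨b, hb, hmin⟩ := hcomp.exists_isLeast ⟨s, mem_iUnion₂.2 ⟨i, hi, hs, hsi⟩⟩
      obtain ⟨k, hk, hbI, hbk⟩ := mem_iUnion₂.1 hb
      refine ⟨b, hbI, fun σ hσ i' hi' => ?_, Or.inr ⟨k, hk, hbk⟩⟩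
      by_contra! hle
      exact absurd (hmin (mem_iUnion₂.2 ⟨i', hi', ⟨hσ.1, hσ.2.le.trans hbI.2⟩, hle⟩))
        (not_le.2 hσ.2)
    · push Not at hZ
      exact ⟨T, ⟨ha.2, le_rfl⟩, fun s hs i hi => hZ s ⟨hs.1, hs.2.le⟩ i hi,
        Or.inl ⟨rfl, fun i hi => hZ T ⟨ha.2, le_rfl⟩ i hi⟩⟩
  have hsub : ∀ {s}, s ∈ Icc a b → s ∈ Icc a T := fun hs => ⟨hs.1, hs.2.trans hb.2⟩
  have hY0 : ∀ s ∈ Icc a b, 0 ≤ Y s := by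
    intro s hs i
    by_cases hit : i = t
    · rw [hit]
      exact hYt0 s (hsub hs)
    by_cases hPi : P i
    · rcases hb.1.eq_or_lt with hab | hab
      · have : s = a := le_antisymm (hab ▸ hs.2) hs.1
        rw [this, hYa]
        exact hya.nonneg i
      · have h1 := le_of_continuousOn_of_Ico (c := 0) hab
          (((hYc i).mono fun σ hσ => hsub hσ).neg) (fun σ hσ => ?_) s hs
        · simpa using h1
        · simpa using hbpos σ hσ i hPi
    · exact (hYzero s (hsub hs) i hit hPi).ge
  have hbI : b ∈ Icc a b := ⟨hb.1, le_rfl⟩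
  refine ⟨b, hb, w, fun i => intervalIntegrable_mono (hwi i) ⟨le_rfl, ha.2⟩ hb, ?_,
    ⟨hY0 b hbI, hYt b hb, fun i hi => (hYle b hb i hi).trans (hya.le_start i hi),
      hYfeas b hb (hY0 b hbI)⟩, ?_⟩
  · filter_upwards [ae_restrict_mem measurableSet_Ioo] with s hs
    have hsT := hsub (Ioo_subset_Icc_self hs)
    have hs0 := hY0 s (Ioo_subset_Icc_self hs)
    have hfeas := hYfeas s hsT hs0
    have hslack : ∀ j, Act j → (Y s ᵥ* A) j < grad f (δ • x s) j → l j s = 0 := by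
      intro j hj hlt
      refine hlslack j s ⟨hs.1, hs.2.trans_le hb.2⟩ ?_
      have h1 := hYact s hsT j hj
      have h2 : A t j * (g j s - (∑ j', K j j' * D j' s) - D j s) < A t j * 0 := by linarith
      have h3 := lt_of_mul_lt_mul_left h2 hj.1.le
      simp only [hD] at h3
      linarith
    refine ⟨fun j => if Act j then l j s else 0, top, fun j => ?_, fun j hlt => ?_, fun j hgt => ?_,
      fun j hpos => ?_, fun i => ?_⟩
    · dsimp only
      split_ifs
      · exact hl01 j s
      · exact ⟨le_rfl, zero_le_one⟩
    · dsimp only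
      split_ifs with hj
      · exact hslack j hj hlt
      · rfl
    · exact absurd (hfeas j) (not_le.2 hgt)
    · dsimp only at hpos
      split_ifs at hpos with hj
      · obtain ⟨h1, h2, h3⟩ := htop j hj
        have h4 := hbpos s ⟨hs.1.le, hs.2⟩ _ h1
        refine ⟨h4, h2, fun i' hi' => ?_⟩
        -- The row `top j` was chosen among old rows only. If `a_{tj}` were larger, row `t` would be
        -- the top row, the column would be slack, and its intensity would be `0`.
        by_cases hit : i' = t
        · subst hit
          by_contra! hlt
          refine hpos.ne' (hslack j hj (hx.vecMul_lt_of_current_top h (haI hsT) hs0 (hYexp s hsT)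
            (fun k hk => ?_) ?_))
          · by_cases hkt : k = i'
            · rw [hkt]
            · exact (h3 k (hYpos_of s hsT k hkt hk)).trans hlt.le
          · rw [vecMul_apply]
            exact lt_of_lt_of_le (mul_pos h4 h2) (Finset.single_le_sum (f := fun i => Y s i * A i j)
              (fun i _ => mul_nonneg (hs0 i) (hAnn i j)) (Finset.mem_univ (top j)))
        · exact h3 i' (hYpos_of s hsT i' hit hi')
      · exact absurd hpos (lt_irrefl 0)
    · simp only [hw]
      congr 1
      refine Finset.sum_congr rfl fun j _ => ?_
      congr 1
      by_cases hj : Act j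
      · simp only [hβ, if_pos hj]
        ring
      · simp only [hβ, if_neg hj, zero_mul]
  · rcases hbend with ⟨hbT, -⟩ | ⟨i, hi, hbi⟩
    · exact Or.inl hbT
    · refine Or.inr (Finset.card_lt_card (Finset.ssubset_iff_of_subset ?_ |>.2 ⟨i, ?_, ?_⟩))
      · intro k hk
        rw [Finset.mem_filter] at hk ⊢
        exact ⟨hk.1, hYpos_of b hb k hk.2.1 hk.2.2⟩
      · simpa using hi
      · simpa using fun _ => hbi

/-- The dual rule can be followed along every primal run. -/
lemma IsPrimalRun.exists_dual_velocity (hx : IsPrimalRun f A d t T x p) (h : Admissible f A d δ)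
    {y₀ : Fin m → ℝ} (h0 : IsExpBounded f A d δ (x 0) y₀) (hy₀t : y₀ t = 0) (N : ℕ) :
    ∀ a ∈ Icc 0 T, ∀ ya : Fin m → ℝ, IsDualState f A d δ t x y₀ a ya →
      (Finset.univ.filter fun i => i ≠ t ∧ 0 < ya i).card ≤ N →
      ∃ w : ℝ → Fin m → ℝ, (∀ i, IntervalIntegrable (fun s => w s i) volume a T) ∧
        ∀ᵐ s ∂volume.restrict (Ioo a T),
          IsDualRate f A d δ t (x s) (fun i => ya i + ∫ σ in a..s, w σ i) (w s) := by
  -- Each phase that stops before `T` lowers the number of positive old variables, so `N` bounds the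
  -- number of further interruptions.
  induction N with
  | zero =>
    intro a ha ya hya hcard
    obtain ⟨b, hb, w, hw, hrate, -, rfl | hlt⟩ := hx.exists_phase h h0 hy₀t ha hya
    · exact ⟨w, hw, hrate⟩
    · omega
  | succ N ih =>
    intro a ha ya hya hcard
    obtain ⟨b, hb, w, hw, hrate, hyb, rfl | hlt⟩ := hx.exists_phase h h0 hy₀t ha hya
    · exact ⟨w, hw, hrate⟩
    · obtain ⟨w', hw', hrate'⟩ := ih b ⟨ha.1.trans hb.1, hb.2⟩ _ hyb (by omega)
      set v : ℝ → Fin m → ℝ := fun s => if s ≤ b then w s else w' s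
      have hv1 : ∀ s, s ≤ b → v s = w s := fun s hs => if_pos hs
      have hv2 : ∀ s, b < s → v s = w' s := fun s hs => if_neg (not_le.2 hs)
      have hi1 : ∀ i, IntervalIntegrable (fun s => v s i) volume a b := by
        intro i
        refine (hw i).congr fun s hs => ?_
        rw [uIoc_of_le hb.1] at hs
        rw [hv1 s hs.2]
      have hi2 : ∀ i, IntervalIntegrable (fun s => v s i) volume b T := by
        intro i
        refine (hw' i).congr fun s hs => ?_
        rw [uIoc_of_le hb.2] at hs
        rw [hv2 s hs.1]
      have hint1 : ∀ s ∈ Icc a b, ∀ i, ∫ σ in a..s, v σ i = ∫ σ in a..s, w σ i := by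
        intro s hs i
        refine integral_congr_of_ae_Ioo hs.1 ?_
        filter_upwards [ae_restrict_mem measurableSet_Ioo] with σ hσ
        rw [hv1 σ (hσ.2.le.trans hs.2)]
      have hint2 : ∀ s ∈ Icc b T, ∀ i, ∫ σ in b..s, v σ i = ∫ σ in b..s, w' σ i := by
        intro s hs i
        refine integral_congr_of_ae_Ioo hs.1 ?_
        filter_upwards [ae_restrict_mem measurableSet_Ioo] with σ hσ
        rw [hv2 σ hσ.1]
      refine ⟨v, fun i => (hi1 i).trans (hi2 i), ?_⟩
      rw [ae_restrict_iff' measurableSet_Ioo] at hrate hrate' ⊢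
      -- The junction of the two phases is a null set, so no rule has to hold there.
      have hne : ∀ᵐ s : ℝ, s ≠ b := by simp [ae_iff]
      filter_upwards [hrate, hrate', hne] with s h1 h2 h3 hs
      rcases lt_or_gt_of_ne h3 with hlt | hgt
      · have h4 := h1 ⟨hs.1, hlt⟩
        rw [hv1 s hlt.le]
        simp only [hint1 s ⟨hs.1.le, hlt.le⟩]
        exact h4
      · have h4 := h2 ⟨hgt, hs.2⟩
        rw [hv2 s hgt]
        have h5 : ∀ i, ya i + ∫ σ in a..s, v σ i =
            (ya i + ∫ σ in a..b, w σ i) + ∫ σ in b..s, w' σ i := by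
          intro i
          rw [← hint2 s ⟨hgt.le, hs.2.le⟩, ← hint1 b ⟨hb.1, le_rfl⟩, add_assoc,
            intervalIntegral.integral_add_adjacent_intervals (hi1 i)
              (intervalIntegrable_mono (hi2 i) ⟨le_rfl, hb.2⟩ ⟨hgt.le, hs.2.le⟩)]
        simp only [h5]
        exact h4

end DualExistence

/-! ### Carrying out a round. -/

section Algorithm

variable {m n : ℕ} {f : (Fin n → ℝ) → ℝ} {A : Matrix (Fin m) (Fin n) ℝ} {d : ℕ} {δ : ℝ}

lemma follows_zero {k : ℕ} (u : ℝ → Fin k → ℝ) (R : ℝ → (Fin k → ℝ) → Prop) : Follows 0 u R := by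
  refine ⟨0, fun i => intervalIntegrable_const, fun s hs i => ?_, by simp⟩
  rw [le_antisymm hs.2 hs.1]
  simp

/-- Every round can be carried out. -/
lemma Invariant.exists_isRound (h : Admissible f A d δ) {k : ℕ} (hk : k < m)
    (hrow : ∃ j, 0 < A ⟨k, hk⟩ j) (hpos : ∀ z, 0 ≤ z → ∀ ℓ, 0 < z ℓ → 0 < grad f z ℓ)
    {x₀ : Fin n → ℝ} {y₀ : Fin m → ℝ} (hinv : Invariant f A d δ k x₀ y₀) :
    ∃ (T : ℝ) (x : ℝ → Fin n → ℝ) (y : ℝ → Fin m → ℝ),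
      x 0 = x₀ ∧ y 0 = y₀ ∧ IsRound f A d δ ⟨k, hk⟩ T x y := by
  by_cases hsat : 1 ≤ A ⟨k, hk⟩ ⬝ᵥ x₀
  -- A row that is already satisfied on arrival gets a round of length `0`.
  · exact ⟨0, fun _ => x₀, fun _ => y₀, rfl, rfl, le_rfl,
      fun s hs => absurd hs.2 (not_lt.2 hs.1), hsat, follows_zero _ _, follows_zero _ _⟩
  · obtain ⟨T, x, p, hT, rfl, hx, hunsat, hend⟩ :=
      exists_primalRun h hrow hpos hinv.nonneg (not_le.1 hsat)
    have hy₀t := hinv.eq_zero ⟨k, hk⟩ le_rfl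
    obtain ⟨w, hw, hrate⟩ := hx.exists_dual_velocity h hinv.expBounded hy₀t _ 0 ⟨le_rfl, hT.le⟩ y₀
      ⟨hinv.feasible.1, by rw [hy₀t, intervalIntegral.integral_same], fun _ _ => le_rfl,
        hinv.feasible.2⟩ le_rfl
    refine ⟨T, x, fun s i => y₀ i + ∫ σ in (0 : ℝ)..s, w σ i, rfl, by simp, hT.le, hunsat, hend,
      ⟨p, hx.integrable, hx.eq, hx.rate⟩, ⟨w, hw, fun s _ i => by simp, hrate⟩⟩

end Algorithm

end OnlineCovering

/-! ### The main theorem. -/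

theorem mainTheorem1 {m n : ℕ} (f : (Fin n → ℝ) → ℝ)
    (hconv : ConvexOn ℝ Set.univ f) (hdiff : Differentiable ℝ f)
    (hnonneg : ∀ x, 0 ≤ x → 0 ≤ f x)
    (hmono : ∀ x x', 0 ≤ x' → x' ≤ x → f x' ≤ f x)
    (hgrad : ∀ x x', 0 ≤ x' → x' ≤ x → OnlineCovering.grad f x' ≤ OnlineCovering.grad f x)
    (A : Matrix (Fin m) (Fin n) ℝ) (hA : ∀ i j, 0 ≤ A i j)
    (d : ℕ) (hd : ∀ i, (Finset.univ.filter fun j => A i j ≠ 0).card ≤ d)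
    (δ : ℝ) (hδ : 0 < δ) :
    -- the algorithm can be run: every round can be carried out, and it ends after finite time
    ((∀ i, ∃ j, 0 < A i j) →
      (∀ z, 0 ≤ z → ∀ ℓ, 0 < z ℓ → 0 < OnlineCovering.grad f z ℓ) →
      ∀ (k : ℕ) (hk : k < m) (x₀ : Fin n → ℝ) (y₀ : Fin m → ℝ),
        OnlineCovering.Reachable f A d δ k x₀ y₀ →
        ∃ (T : ℝ) (x : ℝ → Fin n → ℝ) (y : ℝ → Fin m → ℝ),
          x 0 = x₀ ∧ y 0 = y₀ ∧ OnlineCovering.IsRound f A d δ ⟨k, hk⟩ T x y) ∧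
    -- during every round, `x` and `μ = ∇f(δx)` only increase and the dual is feasible
    (∀ (k : ℕ) (hk : k < m) (T : ℝ) (x : ℝ → Fin n → ℝ) (y : ℝ → Fin m → ℝ),
      OnlineCovering.Reachable f A d δ k (x 0) (y 0) →
      OnlineCovering.IsRound f A d δ ⟨k, hk⟩ T x y →
        MonotoneOn x (Set.Icc 0 T) ∧
        MonotoneOn (fun s => OnlineCovering.grad f (δ • x s)) (Set.Icc 0 T) ∧
        ∀ s ∈ Set.Icc 0 T,
          OnlineCovering.DualFeasible A (y s) (OnlineCovering.grad f (δ • x s))) ∧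
    -- after every round, both solutions are feasible and satisfy the competitive ratio
    (∀ (k : ℕ) (x : Fin n → ℝ) (y : Fin m → ℝ), OnlineCovering.Reachable f A d δ k x y →
      0 ≤ x ∧ (∀ i : Fin m, (i : ℕ) < k → 1 ≤ A i ⬝ᵥ x) ∧
      (∀ i : Fin m, k ≤ (i : ℕ) → y i = 0) ∧
      OnlineCovering.DualFeasible A y (OnlineCovering.grad f (δ • x)) ∧
      (f 0 = 0 →
        OnlineCovering.competitiveRatio f d δ * ((f x : ℝ) : EReal)
          ≤ OnlineCovering.dualObjective f y (OnlineCovering.grad f (δ • x)))) := by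
  have h : OnlineCovering.Admissible f A d δ :=
    ⟨hconv, hdiff, hnonneg, hmono, hgrad, hA, hd, hδ⟩
  refine ⟨fun hrow hpos k hk x₀ y₀ hreach =>
    (hreach.invariant h).exists_isRound h hk (hrow _) hpos, fun k hk T x y hreach hround => ?_,
    fun k x y hreach => ?_⟩
  · have hinv := hreach.invariant h
    rcases hround.nonneg.eq_or_lt with rfl | hT
    · rw [Set.Icc_self]
      refine ⟨Set.subsingleton_singleton.monotoneOn _, Set.subsingleton_singleton.monotoneOn _, ?_⟩
      rintro s rfl
      exact hinv.feasible
    · obtain ⟨p, w, hx, hy⟩ := hround.exists_runs h hinv.nonneg hinv.feasible hT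
      exact ⟨hx.monotoneOn h, hx.monotoneOn_grad h, fun s hs => hy.dualFeasible hx h hs⟩
  · have hinv := hreach.invariant h
    exact ⟨hinv.nonneg, hinv.satisfied, hinv.eq_zero, hinv.feasible,
      hinv.competitiveRatio_mul_le h⟩
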